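/- Let $G$ be a group with a finite inverse-closed generating set $X$, and suppose that, for some $\delta\ge 1$, all geodesic triangles in the Cayley graph of $G$ with respect to $X$ are $\delta$-thin (that is, for any two sides $\alpha,\beta$ issuing from a corner $z$ of a geodesic triangle with corners $x,y,z$, one has $d(\alpha(t),\beta(t))\le\delta$ whenever $0\le t\le (x,y)_z=\tfrac12(d(x,z)+d(y,z)-d(x,y))$). Let $V$ be the number of elements of $G$ in the closed ball of radius $2\delta$ around $1$. A word is a finite sequence of elements of $X$; $|w|$ is the length of the word $w$, and $w=_Gw'$ means that $w$ and $w'$ represent the same element of $G$. A word $y$ is straight if, for every integer $n\ge 1$, the word $y^n$ has minimal length among all words that represent the same element of $G$. Write $u^g=g^{-1}ug$. Then there is an algorithm (depending on $G$, $X$ and $\delta$ only), on a random access machine on which elementary operations on integers take constant time, which, given words $u$, $v$ and a straight word $y$, computes in time $O(|u|+|v|+|y|)$ elements $r,t\in\mathbb Z\cup\{\infty\}$ such that one of the following (mutually exclusive) cases holds: 1. $r,t\in\mathbb Z$, $0\le r<t\le V$ and, for all $j\in\mathbb Z$, $u^{y^j}=_Gv$ if and only if $j\equiv r \pmod t$;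 2. $r\in\mathbb Z$, $t=\infty$ and $r$ is the unique integer such that $u^{y^r}=_Gv$; 3. $r=t=\infty$ and there is no integer $n$ such that $u^{y^n}=_Gv$. The constant implied in $O(\cdot)$ depends only on $G$, $X$ and $\delta$. -/

import Mathlib

namespace HypConj

/-! ### Words -/

section Words

variable {G : Type*} [Group G] {X : Finset G}

/-- The element `τ(w)` of `G` defined by a word `w` over `X`. -/
def evalWord (w : List X) : G := (w.map Subtype.val).prod

/-- `|g|_G`: the least length of a word over `X` that defines `g`. -/
noncomputable def wordLength (X : Finset G) (g : G) : ℕ :=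
  sInf {n : ℕ | ∃ w : List X, w.length = n ∧ evalWord w = g}

/-- The word `w ^ n`, i.e. `n` copies of `w` written one after the other. -/
def wordPow (w : List X) (n : ℕ) : List X := (List.replicate n w).flatten

/-- `w` is straight: `|w ^ n|_G = |w ^ n|` for all positive integers `n`. -/
def IsStraight (w : List X) : Prop :=
  ∀ n : ℕ, 0 < n → wordLength X (evalWord (wordPow w n)) = (wordPow w n).length

/-- `u ^ (y ^ j) =_G v`, where `a ^ b = b⁻¹ a b` and `j` is any integer. -/
def ConjByPow (u v y : List X) (j : ℤ) : Prop :=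
  (evalWord y ^ j)⁻¹ * evalWord u * evalWord y ^ j = evalWord v

/-- The number `V` of elements of `G` in the closed ball of radius `2 δ` around `1`. -/
noncomputable def ballCard (X : Finset G) (δ : ℝ) : ℕ :=
  Set.ncard {g : G | (wordLength X g : ℝ) ≤ 2 * δ}

end Words

/-! ### Geodesic triangles -/

section Hyperbolic

variable {S : Type*} [Dist S]

/-- `α`, restricted to `[0, l]`, is a geodesic path from `x` to `y`. -/
def IsGeodesic (α : ℝ → S) (l : ℝ) (x y : S) : Prop :=
  0 ≤ l ∧ α 0 = x ∧ α l = y ∧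
    ∀ s ∈ Set.Icc 0 l, ∀ t ∈ Set.Icc 0 l, dist (α s) (α t) = |s - t|

/-- The Gromov product `(x, y)_z`. -/
noncomputable def gromovProd (x y z : S) : ℝ := (dist x z + dist y z - dist x y) / 2

variable (S) in
/-- All geodesic triangles in `S` are `δ`-thin: whenever `α` and `β` are the sides issuing from
a corner `z` of a geodesic triangle with corners `x, y, z`, the corresponding points `α t` and
`β t`, where `0 ≤ t ≤ (x, y)_z`, are at distance at most `δ`. (The other two corners are covered
since `x, y, z` are arbitrary. The third side, which always exists in a geodesic space such as a
Cayley graph, plays no role in this condition.) -/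
def IsDeltaHyperbolic (δ : ℝ) : Prop :=
  ∀ (x y z : S) (α β : ℝ → S) (l m : ℝ), IsGeodesic α l z x → IsGeodesic β m z y →
    ∀ t : ℝ, 0 ≤ t → t ≤ gromovProd x y z → dist (α t) (β t) ≤ δ

end Hyperbolic

/-! ### The Cayley graph as a metric space -/

section Cayley

variable {G : Type*} [Group G]

/-- `{a, b}` is an edge of the Cayley graph, or a single vertex. -/
def EdgeOrVertex (X : Finset G) (a b : G) : Prop := a = b ∨ a⁻¹ * b ∈ X

/-- A point of the Cayley graph (as a metric graph), in barycentric coordinates: the point at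
distance `t` from `a` along the edge `{a, b}` has coordinate `1 - t` at `a`, coordinate `t` at `b`
and coordinate `0` at all other vertices. -/
structure CayleyPoint (X : Finset G) where
  coord : G → ℝ
  exists_edge : ∃ a b : G, EdgeOrVertex X a b ∧ ∃ t ∈ Set.Icc (0 : ℝ) 1,
    coord = fun v => Set.indicator {a} (fun _ => 1 - t) v + Set.indicator {b} (fun _ => t) v

/-- Both `p` and `q` lie on the closed edge `{a, b}`. -/
def OnEdge {X : Finset G} (a b : G) (p q : CayleyPoint X) : Prop :=
  EdgeOrVertex X a b ∧ ∀ v, v ≠ a → v ≠ b → p.coord v = 0 ∧ q.coord v = 0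

/-- The lengths of the shortest paths of each possible combinatorial kind from `p` to `q`: the
segment from `p` to `q` if both are on one edge `{a, b}`; and the paths that go from `p` straight
to an endpoint `a` of the edge of `p`, then through the graph to an endpoint `b` of the edge of
`q`, then straight to `q`. -/
def pathLengths {X : Finset G} (p q : CayleyPoint X) : Set ℝ :=
  {ℓ | ∃ a b : G, OnEdge a b p q ∧ ℓ = |p.coord a - q.coord a|} ∪
  {ℓ | ∃ a b : G, 0 < p.coord a ∧ 0 < q.coord b ∧
    ℓ = (1 - p.coord a) + (wordLength X (a⁻¹ * b) : ℝ) + (1 - q.coord b)}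

/-- The path metric of the Cayley graph in which every edge has length `1`. -/
noncomputable instance (X : Finset G) : Dist (CayleyPoint X) :=
  ⟨fun p q => sInf (pathLengths p q)⟩

end Cayley

/-! ### Random access machines

Programs of a RAM with integer registers and an integer memory with indirect addressing. Control
flow is structured (sequence, branch, loop). The arithmetic operations are addition and
subtraction of integers of any size; every elementary instruction and every test costs one unit
of time. -/

/-- RAM programs. -/
inductive Prog : Type
  | skip : Prog
  /-- `R_d := c` -/
  | const (d : ℕ) (c : ℤ) : Prog
  /-- `R_d := R_a + R_b` -/
  | add (d a b : ℕ) : Prog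
  /-- `R_d := R_a - R_b` -/
  | sub (d a b : ℕ) : Prog
  /-- `R_d := M[R_a]` -/
  | load (d a : ℕ) : Prog
  /-- `M[R_a] := R_b` -/
  | store (a b : ℕ) : Prog
  /-- first `P`, then `Q` -/
  | seq (P Q : Prog) : Prog
  /-- if `0 < R_a` then `P` else `Q` -/
  | branch (a : ℕ) (P Q : Prog) : Prog
  /-- while `0 < R_a` do `P` -/
  | loop (a : ℕ) (P : Prog) : Prog

/-- The contents of the registers and of the memory. -/
@[ext] structure State where
  reg : ℕ → ℤ
  mem : ℤ → ℤ

/-- `R_d := c` -/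
def State.setReg (s : State) (d : ℕ) (c : ℤ) : State := ⟨Function.update s.reg d c, s.mem⟩

/-- `M[i] := c` -/
def State.setMem (s : State) (i c : ℤ) : State := ⟨s.reg, Function.update s.mem i c⟩

/-- `Run P s s' T`: started in state `s`, the program `P` halts in state `s'` after exactly `T`
units of time. -/
inductive Run : Prog → State → State → ℕ → Prop
  | skip (s : State) : Run .skip s s 1
  | const (s : State) (d : ℕ) (c : ℤ) : Run (.const d c) s (s.setReg d c) 1
  | add (s : State) (d a b : ℕ) : Run (.add d a b) s (s.setReg d (s.reg a + s.reg b)) 1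
  | sub (s : State) (d a b : ℕ) : Run (.sub d a b) s (s.setReg d (s.reg a - s.reg b)) 1
  | load (s : State) (d a : ℕ) : Run (.load d a) s (s.setReg d (s.mem (s.reg a))) 1
  | store (s : State) (a b : ℕ) : Run (.store a b) s (s.setMem (s.reg a) (s.reg b)) 1
  | seq {P Q : Prog} {s s' s'' : State} {T T' : ℕ} :
      Run P s s' T → Run Q s' s'' T' → Run (.seq P Q) s s'' (T + T')
  | branch_pos {a : ℕ} {P Q : Prog} {s s' : State} {T : ℕ} :
      0 < s.reg a → Run P s s' T → Run (.branch a P Q) s s' (T + 1)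
  | branch_neg {a : ℕ} {P Q : Prog} {s s' : State} {T : ℕ} :
      ¬ 0 < s.reg a → Run Q s s' T → Run (.branch a P Q) s s' (T + 1)
  | loop_stop {a : ℕ} {P : Prog} {s : State} :
      ¬ 0 < s.reg a → Run (.loop a P) s s 1
  | loop_step {a : ℕ} {P : Prog} {s s' s'' : State} {T T' : ℕ} :
      0 < s.reg a → Run P s s' T → Run (.loop a P) s' s'' T' →
      Run (.loop a P) s s'' (T + T' + 1)

/-- The machine is deterministic: final state and running time are determined by the input. -/
theorem Run.unique {P : Prog} {s s₁ s₂ : State} {T₁ T₂ : ℕ}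
    (h₁ : Run P s s₁ T₁) (h₂ : Run P s s₂ T₂) : s₁ = s₂ ∧ T₁ = T₂ := by
  induction h₁ generalizing s₂ T₂ with
  | skip | const | add | sub | load | store => cases h₂; exact ⟨rfl, rfl⟩
  | seq _ _ ih ih' =>
    cases h₂ with
    | seq k k' =>
      obtain ⟨rfl, rfl⟩ := ih k
      obtain ⟨rfl, rfl⟩ := ih' k'
      exact ⟨rfl, rfl⟩
  | branch_pos hp _ ih =>
    cases h₂ with
    | branch_pos _ k => obtain ⟨rfl, rfl⟩ := ih k; exact ⟨rfl, rfl⟩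
    | branch_neg hn _ => exact absurd hp hn
  | branch_neg hn _ ih =>
    cases h₂ with
    | branch_pos hp _ => exact absurd hp hn
    | branch_neg _ k => obtain ⟨rfl, rfl⟩ := ih k; exact ⟨rfl, rfl⟩
  | loop_stop hn =>
    cases h₂ with
    | loop_stop _ => exact ⟨rfl, rfl⟩
    | loop_step hp _ _ => exact absurd hp hn
  | loop_step hp _ _ ih ih' =>
    cases h₂ with
    | loop_stop hn => exact absurd hp hn
    | loop_step _ k k' =>
      obtain ⟨rfl, rfl⟩ := ih k
      obtain ⟨rfl, rfl⟩ := ih' k'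
      exact ⟨rfl, rfl⟩

/-- The initial state for the input words `u, v, y`, where the letters of the alphabet are numbered
`0, 1, …, k - 1` by `e`: registers `0, 1, 2` hold the lengths `|u|, |v|, |y|`, the numbers of the
letters of `u`, then `v`, then `y` are in consecutive memory cells starting with cell `0`, and
everything else is `0`. -/
def inputState {A : Type*} {k : ℕ} (e : A ≃ Fin k) (u v y : List A) : State where
  reg i := if i = 0 then u.length else if i = 1 then v.length else if i = 2 then y.length else 0
  mem i := if 0 ≤ i then ((u ++ v ++ y).map fun x => ((e x : ℕ) : ℤ)).getD i.toNat 0 else 0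

/-- Output of an element of `ℤ ∪ {∞}`: a register holding a flag, which is `0` exactly for finite
elements, and a register holding the value if it is finite. -/
def State.readExt (s : State) (flag val : ℕ) : WithTop ℤ :=
  if s.reg flag = 0 then WithTop.some (s.reg val) else ⊤

/-- First output `r ∈ ℤ ∪ {∞}`. -/
def State.outR (s : State) : WithTop ℤ := s.readExt 0 1

/-- Second output `t ∈ ℤ ∪ {∞}`. -/
def State.outT (s : State) : WithTop ℤ := s.readExt 2 3

end HypConj

/-! Let `Y` be the element given by the straight word `y`, and let `l = |y|`. If `u` is conjugated
to `v` by `Y ^ j`, then the solutions are exactly `j + H`, where `H` is the group of all `d` such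
that `Y ^ d` commutes with `u`. It therefore suffices to find one solution and the least positive
element of `H`.

Straightness makes the powers of `Y` points of a geodesic axis. If the axis and its translate by `u`
run close together for long enough, then `V + 1` pairs of corresponding points are joined by
elements of the ball of radius `2 * D`, where `D = ⌊δ⌋`. Two of these elements agree, so some `Y ^
t` with `1 ≤ t ≤ V` commutes with `u` (`exists_period`). Hence `H` is trivial or has a generator at
most `V`, and finitely many tests find it (`solution_cases`).

If `H` is trivial, the unique possible `j` is confined to boundedly many candidates. Multiplying `u`
and `v` by powers of `Y` on both sides makes each almost shortest in its double coset of the cyclic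
group of `Y` (`double_coset_min`). A relation `Y ^ (-i) * u * Y ^ i' = v` between almost shortest
elements forces `i` or `i + i'` to be bounded, or yields a short period (`exponent_cases`). Thus `j`
is within a constant of one of two computable numbers (`exponent_near`). The multipliers are
approximate projections to the axis, and the difference of the distances to two far points of the
axis gives such a projection up to a bounded error (`near_of_diff`). No search through the powers is
needed, so boundedly many lengths of elements suffice.

Lengths are computed in linear time as follows. A finite table rewrites a word to a word whose
subwords of length at most `8 * D + 2` are geodesic. Such a local geodesic stays within `2 * D` of a
geodesic (`local_geodesic_near`), so the change of the exact length when a letter is appended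
depends only on a finite profile of the last part of the word (`profile_step`). Keeping profile and
length on a stack, a machine needs constant time per rewriting step, and a potential bounds the
number of steps (`reduceProg_spec`). The tables are constants of the program; only their existence
is needed. The empty word `y` is harmless, since then `1` is a period. -/

namespace HypConj

/-! ### Thin triangles for a length function on a group -/

section Geometry

variable {G : Type*} [Group G]

/-- A geodesic `ℕ`-valued length function on a group. -/
structure GeodesicLength (L : G → ℕ) : Prop where
  one : L 1 = 0
  eq_one : ∀ g, L g = 0 → g = 1
  inv : ∀ g, L g⁻¹ = L g
  mul_le : ∀ g h, L (g * h) ≤ L g + L h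
  split : ∀ g n, n ≤ L g → ∃ h, L h = n ∧ L h + L (h⁻¹ * g) = L g

/-- A geodesic length function with `D`-thin triangles. -/
structure ThinLength (L : G → ℕ) (D : ℕ) : Prop extends GeodesicLength L where
  thin : ∀ b c g h, L g + L (g⁻¹ * b) = L b → L h + L (h⁻¹ * c) = L c → L g = L h →
    2 * L g + L (b⁻¹ * c) ≤ L b + L c → L (g⁻¹ * h) ≤ D

/-- The left-invariant distance of a length function. -/
def gdist (L : G → ℕ) (a b : G) : ℕ := L (a⁻¹ * b)

/-- `x` lies on a geodesic from `a` to `b`. -/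
def Btw (L : G → ℕ) (a x b : G) : Prop := gdist L a x + gdist L x b = gdist L a b

namespace GeodesicLength

variable {L : G → ℕ} (hL : GeodesicLength L)

include hL

theorem dist_self (a : G) : gdist L a a = 0 := by simp [gdist, hL.one]

theorem dist_comm (a b : G) : gdist L a b = gdist L b a := by
  unfold gdist; rw [← hL.inv]; simp

theorem dist_tri (a b c : G) : gdist L a c ≤ gdist L a b + gdist L b c := by
  unfold gdist
  have := hL.mul_le (a⁻¹ * b) (b⁻¹ * c)
  simpa [mul_assoc] using this

theorem btw_symm {a x b : G} (h : Btw L a x b) : Btw L b x a := by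
  unfold Btw at *
  rw [hL.dist_comm b x, hL.dist_comm x a, hL.dist_comm b a]; omega

theorem exists_btw (a b : G) (n : ℕ) (hn : n ≤ gdist L a b) :
    ∃ x, gdist L a x = n ∧ Btw L a x b := by
  obtain ⟨h, h1, h2⟩ := hL.split _ n hn
  refine ⟨a * h, by simpa [gdist] using h1, ?_⟩
  simpa [Btw, gdist, mul_assoc] using h2

/-- A sequence of points along a geodesic. -/
theorem exists_geodesic (a b : G) : ∃ γ : ℕ → G, γ 0 = a ∧ γ (gdist L a b) = b ∧
    ∀ i j, i ≤ j → j ≤ gdist L a b → gdist L (γ i) (γ j) = j - i := by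
  induction hn : gdist L a b generalizing a with
  | zero =>
    obtain rfl : a = b := by simpa [inv_mul_eq_one] using hL.eq_one _ hn
    refine ⟨fun _ => a, rfl, rfl, fun i j _ hj => ?_⟩
    rw [hL.dist_self]; omega
  | succ n ih =>
    obtain ⟨x, hx1, hx2⟩ := hL.exists_btw a b 1 (by omega)
    unfold Btw at hx2
    obtain ⟨γ, g0, g1, g2⟩ := ih x (by omega)
    refine ⟨fun i => if i = 0 then a else γ (i - 1), by simp, by simp [g1], ?_⟩
    intro i j hij hj
    rcases Nat.eq_zero_or_pos i with rfl | hi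
    · rcases Nat.eq_zero_or_pos j with rfl | hj'
      · simp [hL.dist_self]
      · simp only [↓reduceIte, hj'.ne']
        have h1 := hL.dist_tri a x (γ (j - 1))
        have h2 := g2 0 (j - 1) (by omega) (by omega)
        rw [g0] at h2
        have h3 := hL.dist_tri a (γ (j - 1)) b
        have h4 := g2 (j - 1) n (by omega) le_rfl
        rw [g1] at h4
        omega
    · have hj0 : j ≠ 0 := by omega
      simp only [hi.ne', hj0, ↓reduceIte]
      rw [g2 _ _ (by omega) (by omega)]; omega

end GeodesicLength

namespace ThinLength

variable {L : G → ℕ} {D : ℕ} (hL : ThinLength L D)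

include hL

theorem thin_at {a b c x z : G} (hx : Btw L a x b) (hz : Btw L a z c)
    (hxz : gdist L a x = gdist L a z)
    (ht : 2 * gdist L a x + gdist L b c ≤ gdist L a b + gdist L a c) : gdist L x z ≤ D := by
  have := hL.thin (a⁻¹ * b) (a⁻¹ * c) (a⁻¹ * x) (a⁻¹ * z)
  simp only [mul_inv_rev, inv_inv, mul_assoc, mul_inv_cancel_left] at this
  exact this hx hz hxz ht

/-- A point on one side of a triangle is close to a corresponding point of another side. -/
theorem thin_cases {a b x : G} (hx : Btw L a x b) (c : G) :
    (2 * gdist L a x + gdist L b c ≤ gdist L a b + gdist L a c ∧ gdist L a x ≤ gdist L a c ∧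
      ∀ z, Btw L a z c → gdist L a x = gdist L a z → gdist L x z ≤ D) ∨
    (2 * gdist L b x + gdist L a c ≤ gdist L b a + gdist L b c ∧ gdist L b x ≤ gdist L b c ∧
      ∀ z, Btw L b z c → gdist L b x = gdist L b z → gdist L x z ≤ D) := by
  have h1 := hL.dist_tri a c b
  have h2 := hL.dist_comm c b
  have h3 := hL.dist_comm a b
  have h4 := hL.dist_comm x b
  have h5 := hL.dist_comm c a
  have h6 := hL.dist_tri b a c
  have h7 := hL.dist_tri a b c
  have hx' := hx
  unfold Btw at hx'
  -- The Gromov products at `a` and `b` add up to the length of the side, so a point beyond the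
  -- first of them is within the second when seen from `b`.
  by_cases h : 2 * gdist L a x + gdist L b c ≤ gdist L a b + gdist L a c
  · exact .inl ⟨h, by omega, fun z hz he => hL.thin_at hx hz he h⟩
  · have h' : 2 * gdist L b x + gdist L a c ≤ gdist L b a + gdist L b c := by omega
    exact .inr ⟨h', by omega, fun z hz he => hL.thin_at (hL.btw_symm hx) hz he h'⟩

/-- Crossing from `x` to the corresponding point of another side costs at most `D`, and that side
then leads straight to `c`. So up to `D` the point `x` is on the way to `c` from one of the two
ends. -/
theorem dist_le_of_btw {a b x : G} (hx : Btw L a x b) (c : G) :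
    gdist L x c + gdist L a x ≤ gdist L a c + D ∨ gdist L x c + gdist L b x ≤ gdist L b c + D := by
  rcases hL.thin_cases hx c with ⟨-, h2, h3⟩ | ⟨-, h2, h3⟩
  · obtain ⟨z, hz1, hz2⟩ := hL.exists_btw a c _ h2
    have := h3 z hz2 hz1.symm
    have := hL.dist_tri x z c
    unfold Btw at hz2
    left; omega
  · obtain ⟨z, hz1, hz2⟩ := hL.exists_btw b c _ h2
    have := h3 z hz2 hz1.symm
    have := hL.dist_tri x z c
    unfold Btw at hz2
    right; omega

/-! ### Local geodesics -/

/-- Local geodesics stay close to geodesics with the same end points. -/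
theorem local_geodesic_near {c γ : ℕ → G} {n l : ℕ}
    (hc : ∀ i j, i ≤ j → j ≤ n → j ≤ i + (8 * D + 2) → gdist L (c i) (c j) = j - i)
    (hγ : ∀ i j, i ≤ j → j ≤ l → gdist L (γ i) (γ j) = j - i)
    (h0 : γ 0 = c 0) (h1 : γ l = c n) : ∀ t ≤ n, ∃ s ≤ l, gdist L (c t) (γ s) ≤ 2 * D := by
  have hne : ∀ x, ∃ s ≤ l, ∀ s' ≤ l, gdist L x (γ s) ≤ gdist L x (γ s') := fun x => by
    obtain ⟨s, hs, h⟩ := Finset.exists_min_image (Finset.range (l + 1)) (fun s => gdist L x (γ s))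
      ⟨0, by simp⟩
    exact ⟨s, by simpa [Nat.lt_succ_iff] using hs,
      fun s' hs' => h s' (by simpa [Nat.lt_succ_iff] using hs')⟩
  choose σ hσl hσ using hne
  -- A point of the path farthest from the geodesic; it is enough to bound its distance.
  obtain ⟨t, ht, hmax⟩ := Finset.exists_max_image (Finset.range (n + 1))
    (fun t => gdist L (c t) (γ (σ (c t)))) ⟨0, by simp⟩
  simp only [Finset.mem_range, Nat.lt_succ_iff] at ht hmax
  suffices H : gdist L (c t) (γ (σ (c t))) ≤ 2 * D from
    fun t' ht' => ⟨_, hσl _, (hmax t' ht').trans H⟩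
  -- the two ends of a subarc around `c t`, and points of the geodesic close to them
  have key : ∀ e, e ≤ n → gdist L (c t) (c e) = 4 * D + 1 ∨ (e = 0 ∨ e = n) →
      ∃ s ≤ l, ∀ q, Btw L (c e) q (γ s) → gdist L (c t) q ≤ 2 * D →
        gdist L (c t) (γ (σ (c t))) ≤ 2 * D := by
    intro e he h
    rcases h with h | h
    · refine ⟨σ (c e), hσl _, fun q hq hd => ?_⟩
      -- A point `q` within `2 * D` of `c t` is at least `2 * D + 1` away from `c e`. The route
      -- through `q` would then lead from `c t` to the geodesic in less than the maximal distance.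
      by_contra hcon
      have := hmax e he
      have h2 := hσ (c t) _ (hσl (c e))
      have h3 := hL.dist_tri (c t) q (γ (σ (c e)))
      have h4 := hL.dist_tri (c t) q (c e)
      have h5 := hL.dist_comm q (c e)
      unfold Btw at hq
      omega
    -- A truncated subarc stops at a common end point of both paths, and this side of the
    -- quadrilateral is a single point.
    · have : ∃ s ≤ l, γ s = c e := by
        rcases h with rfl | rfl
        · exact ⟨0, by omega, h0⟩
        · exact ⟨l, le_rfl, h1⟩
      obtain ⟨s, hs, hse⟩ := this
      refine ⟨s, hs, fun q hq hd => ?_⟩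
      have h2 := hσ (c t) s hs
      have h3 := hL.dist_tri (c t) q (γ s)
      unfold Btw at hq
      rw [hse, hL.dist_self] at hq
      rw [hse] at h2 h3
      have := hL.dist_comm q (c e)
      omega
  obtain ⟨s, hs, Hs⟩ := key (t - (4 * D + 1)) (by omega) (by
    by_cases h : 4 * D + 1 ≤ t
    · left; rw [hL.dist_comm, hc _ _ (by omega) ht (by omega)]; omega
    · right; left; omega)
  obtain ⟨s', hs', Hs'⟩ := key (min n (t + (4 * D + 1))) (by omega) (by
    by_cases h : t + (4 * D + 1) ≤ n
    · left; rw [hc _ _ (by omega) (by omega) (by omega)]; omega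
    · right; right; omega)
  set y := c (t - (4 * D + 1)) with hy
  set z := c (min n (t + (4 * D + 1))) with hz
  have hx : Btw L y (c t) z := by
    unfold Btw
    rw [hy, hz, hc _ _ (by omega) (by omega) (by omega), hc _ _ (by omega) (by omega) (by omega),
      hc _ _ (by omega) (by omega) (by omega)]
    omega
  -- A diagonal cuts the quadrilateral with corners `y`, `z`, `γ s'`, `γ s` into two triangles, so
  -- `c t` is within `2 * D` of one of the other three sides. The last case is a point of the
  -- geodesic itself.
  rcases hL.thin_cases hx (γ s) with ⟨-, h2, h3⟩ | ⟨-, h2, h3⟩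
  · obtain ⟨q, hq1, hq2⟩ := hL.exists_btw y (γ s) _ h2
    exact Hs q hq2 ((h3 q hq2 hq1.symm).trans (by omega))
  · obtain ⟨q, hq1, hq2⟩ := hL.exists_btw z (γ s) _ h2
    have hxq := h3 q hq2 hq1.symm
    rcases hL.thin_cases hq2 (γ s') with ⟨-, h5, h6⟩ | ⟨-, h5, h6⟩
    · obtain ⟨q', hq1', hq2'⟩ := hL.exists_btw z (γ s') _ h5
      have := h6 q' hq2' hq1'.symm
      have := hL.dist_tri (c t) q q'
      exact Hs' q' hq2' (by omega)
    · have : ∃ r ≤ l, gdist L (γ s) q = gdist L (γ s) (γ r) ∧ Btw L (γ s) (γ r) (γ s') := by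
        rcases le_total s s' with h | h
        · rw [hγ s s' h hs'] at h5
          refine ⟨s + gdist L (γ s) q, by omega, ?_, ?_⟩
          · rw [hγ _ _ (by omega) (by omega)]; omega
          · unfold Btw
            rw [hγ _ _ (by omega) (by omega), hγ _ _ (by omega) (by omega),
              hγ _ _ (by omega) (by omega)]; omega
        · rw [hL.dist_comm (γ s) (γ s'), hγ s' s h hs] at h5
          refine ⟨s - gdist L (γ s) q, by omega, ?_, ?_⟩
          · rw [hL.dist_comm (γ s) (γ _), hγ _ _ (by omega) (by omega)]; omega
          · apply hL.btw_symm
            unfold Btw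
            rw [hγ _ _ (by omega) (by omega), hγ _ _ (by omega) (by omega),
              hγ _ _ (by omega) (by omega)]; omega
      obtain ⟨r, hr, hr1, hr2⟩ := this
      have := h6 _ hr2 hr1
      have := hL.dist_tri (c t) q (γ r)
      exact (hσ (c t) r hr).trans (by omega)

/-- The distances from the origin around the end point of a local geodesic are determined by those
around an earlier point. -/
theorem local_geodesic_step {c : ℕ → G} {n : ℕ}
    (hc : ∀ i j, i ≤ j → j ≤ n → j ≤ i + (8 * D + 2) → gdist L (c i) (c j) = j - i)
    (h0 : c 0 = 1) {m : ℕ} (hm : m + (8 * D + 2) = n) {g : G} (hg : L g ≤ 3 * D) :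
    ∃ b, L b ≤ 3 * D ∧ L (c n * g) = L (c m * b) + L (b⁻¹ * (c m)⁻¹ * c n * g) := by
  have one_dist : ∀ a, gdist L 1 a = L a := fun a => by simp [gdist]
  obtain ⟨γ, γ0, γ1, hγ⟩ := hL.exists_geodesic (c 0) (c n)
  obtain ⟨s, hs, hms⟩ := hL.local_geodesic_near hc hγ γ0 γ1 m (by omega)
  have hz : Btw L (c 0) (γ s) (c n) := by
    unfold Btw
    conv_lhs => rw [← γ0, ← γ1]
    rw [hγ _ _ (by omega) hs, hγ _ _ hs le_rfl]; omega
  have hmn := hc m n (by omega) le_rfl (by omega)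
  have h1 := hL.dist_tri (c m) (γ s) (c n)
  have hgd : gdist L (c n) (c n * g) = L g := by simp [gdist]
  have h2 := hL.dist_tri (c 0) (c n * g) (c n)
  have h3 := hL.dist_comm (c n * g) (c n)
  -- The corner `c n` cannot occur: `γ s` is at least `(8 * D + 2) - 2 * D` away from it, but the
  -- Gromov product there is at most `L g ≤ 3 * D`. So a geodesic to `c n * g` passes within `D` of
  -- `γ s`, hence within `3 * D` of `c m`.
  rcases hL.thin_cases hz (c n * g) with ⟨-, h5, h6⟩ | ⟨h4, h5, -⟩
  · obtain ⟨z, hz1, hz2⟩ := hL.exists_btw _ _ _ h5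
    have h7 := h6 z hz2 hz1.symm
    have h8 := hL.dist_tri (c m) (γ s) z
    refine ⟨(c m)⁻¹ * z, by unfold gdist at *; omega, ?_⟩
    unfold Btw at hz2
    rw [h0, one_dist, one_dist] at hz2
    simp only [mul_inv_rev, inv_inv, mul_assoc, mul_inv_cancel_left]
    rw [← hz2]; simp [gdist]
  · have h7 := hL.dist_comm (c n) (γ s)
    omega

end ThinLength
end Geometry
-- Projections to the axis, and axes that run close together
section Axis

variable {G : Type*} [Group G]

namespace ThinLength

variable {L : G → ℕ} {D : ℕ} (hL : ThinLength L D) {Y : G} {l : ℕ}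
  (hY : ∀ n : ℤ, (L (Y ^ n) : ℤ) = |n| * l)

include hL

include hY

omit hL in
theorem dist_zpow (g : G) (i j : ℤ) : (gdist L (g * Y ^ i) (g * Y ^ j) : ℤ) = |j - i| * l := by
  rw [← hY]; unfold gdist
  congr 2
  rw [sub_eq_neg_add, zpow_add, zpow_neg]; group

omit hL in
theorem dist_zpow_one (i j : ℤ) : (gdist L (Y ^ i) (Y ^ j) : ℤ) = |j - i| * l := by
  simpa using dist_zpow hY 1 i j

omit hL in
theorem btw_zpow (g : G) {i j k : ℤ} (h : i ≤ j ∧ j ≤ k ∨ k ≤ j ∧ j ≤ i) :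
    Btw L (g * Y ^ i) (g * Y ^ j) (g * Y ^ k) := by
  unfold Btw
  zify
  rw [dist_zpow hY, dist_zpow hY, dist_zpow hY, ← add_mul]
  congr 1
  rcases h with h | h
  · rw [abs_of_nonneg, abs_of_nonneg, abs_of_nonneg] <;> linarith
  · rw [abs_of_nonpos, abs_of_nonpos, abs_of_nonpos] <;> linarith

omit hL in
theorem btw_zpow_one {i j k : ℤ} (h : i ≤ j ∧ j ≤ k ∨ k ≤ j ∧ j ≤ i) :
    Btw L (Y ^ i) (Y ^ j) (Y ^ k) := by
  simpa using btw_zpow hY 1 h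

/-- The difference of the distances to two far away points of an axis finds an almost nearest
point of the axis. -/
theorem near_of_diff (hl : 1 ≤ l) {u : G} {N a : ℤ} (hN : 2 * (L u : ℤ) ≤ N * l)
    (ha : a = ((L (Y ^ N * u) : ℤ) - L (Y ^ (-N) * u)) / (2 * l)) (i : ℤ) :
    gdist L (Y ^ a) u ≤ gdist L (Y ^ i) u + (D + l) := by
  have hl' : (1 : ℤ) ≤ l := by exact_mod_cast hl
  have hN0 : 0 ≤ N := by
    by_contra h
    have : N * l ≤ -1 * 1 := by nlinarith
    omega
  have eP : L (Y ^ N * u) = gdist L (Y ^ (-N)) u := by simp [gdist]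
  have eM : L (Y ^ (-N) * u) = gdist L (Y ^ N) u := by simp [gdist]
  rw [eP, eM] at ha
  set P : ℤ := ((gdist L (Y ^ (-N)) u : ℕ) : ℤ)
  set Q : ℤ := ((gdist L (Y ^ N) u : ℕ) : ℤ)
  have h1 : a * (2 * l) ≤ P - Q := by
    rw [ha]; exact Int.ediv_mul_le _ (by omega)
  have h2 : P - Q < a * (2 * l) + 2 * l := by
    have := Int.lt_ediv_add_one_mul_self (P - Q) (b := 2 * l) (by omega)
    rw [← ha] at this; linarith
  have tri : ∀ j k : ℤ, (gdist L (Y ^ j) u : ℤ) ≤ |k - j| * l + gdist L (Y ^ k) u := fun j k => by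
    rw [← dist_zpow_one hY j k]; exact_mod_cast hL.dist_tri _ _ _
  have e0 : gdist L (Y ^ (0 : ℤ)) u = L u := by simp [gdist]
  have t1 := tri (-N) 0
  have t2 := tri N 0
  have t3 := tri 0 N
  have t4 := tri 0 (-N)
  rw [e0] at t1 t2 t3 t4
  simp only [sub_neg_eq_add, zero_add, zero_sub, abs_neg, sub_zero, abs_of_nonneg hN0] at t1 t2 t3 t4
  have haN : a ≤ N := by
    by_contra h
    have : (N + 1) * l ≤ a * l := by
      apply mul_le_mul_of_nonneg_right <;> omega
    linarith
  have haN' : -N ≤ a := by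
    by_contra h
    have : (a + 1) * l ≤ -N * l := by
      apply mul_le_mul_of_nonneg_right <;> omega
    linarith
  -- For `|i| ≤ N` this is the triangle inequality. Farther out, `N * l ≥ 2 * L u` makes `Y ^ i` at
  -- least as far from `u` as `1` is.
  have hi : P + Q ≤ 2 * (N * l) + 2 * gdist L (Y ^ i) u := by
    by_cases h : |i| ≤ N
    · obtain ⟨h3, h4⟩ := abs_le.1 h
      have h5 := tri (-N) i
      have h6 := tri N i
      rw [abs_of_nonneg (by omega)] at h5
      rw [abs_of_nonpos (by omega)] at h6
      linarith
    · have h5 : (|i| : ℤ) * l ≤ L u + gdist L (Y ^ i) u := by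
        rw [← hY]
        have := hL.dist_tri 1 u (Y ^ i)
        rw [hL.dist_comm u] at this
        simp only [gdist, inv_one, one_mul] at this ⊢
        exact_mod_cast this
      have : N * l ≤ |i| * l := by apply mul_le_mul_of_nonneg_right <;> omega
      linarith
  have d1 := dist_zpow_one hY (-N) a
  have d2 := dist_zpow_one hY N a
  rw [abs_of_nonneg (by omega)] at d1
  rw [abs_of_nonpos (by omega)] at d2
  -- In a tree, `P - Q` would be `2 * l` times the position of the projection of `u`. Here both
  -- cases bound the distance from `Y ^ a` to `u` by `(P + Q) / 2 - N * l`, up to `D` from thinness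
  -- and `l` from rounding.
  rcases hL.dist_le_of_btw (btw_zpow_one hY (.inl ⟨haN', haN⟩)) u with h | h
  · zify at h ⊢
    rw [d1] at h
    linarith
  · zify at h ⊢
    rw [d2] at h
    linarith

/-- Almost nearest points, chosen one after the other, give an almost shortest element of a double
coset. -/
theorem double_coset_min (hl : 1 ≤ l) {u : G} {a b : ℤ}
    (ha : ∀ i : ℤ, gdist L (Y ^ a) u ≤ gdist L (Y ^ i) u + (D + l))
    (hb : ∀ i : ℤ, L (Y ^ (-a) * u * Y ^ b) ≤ L (Y ^ (-a) * u * Y ^ i) + (D + l)) (i i' : ℤ) :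
    L (Y ^ (-a) * u * Y ^ b) ≤ L (Y ^ (-i) * u * Y ^ i') + (7 * D + 6 * l) := by
  have hl' : (1 : ℤ) ≤ l := by exact_mod_cast hl
  have e : ∀ i i' : ℤ, L (Y ^ (-i) * u * Y ^ i') = gdist L (Y ^ i) (u * Y ^ i') := fun i i' => by
    simp [gdist, mul_assoc]
  simp only [e] at hb ⊢
  -- The bound `7 * D + 6 * l` includes the error `D + l` in the choice of `b`.
  suffices H : ∃ k : ℤ, gdist L (Y ^ a) (u * Y ^ k) ≤
      gdist L (Y ^ i) (u * Y ^ i') + (6 * D + 5 * l) by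
    obtain ⟨k, hk⟩ := H
    exact (hb k).trans (by omega)
  -- This bounds twice the Gromov product at `Y ^ a`. If it were larger, the axis towards `Y ^ i`
  -- would follow the geodesic to `u` so long that moving `k` steps along it brings a gain of more
  -- than `D + l`, against the choice of `a`.
  have gp : gdist L (Y ^ a) (Y ^ i) + gdist L (Y ^ a) u ≤ gdist L (Y ^ i) u + (4 * D + 4 * l) := by
    by_contra hcon
    push Not at hcon
    set s : ℤ := if a ≤ i then 1 else -1 with hs
    set k : ℤ := ((gdist L (Y ^ a) (Y ^ i) : ℤ) + gdist L (Y ^ a) u - gdist L (Y ^ i) u) / (2 * l)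
      with hk
    have h1 := Int.ediv_mul_le ((gdist L (Y ^ a) (Y ^ i) : ℤ) + gdist L (Y ^ a) u
      - gdist L (Y ^ i) u) (b := 2 * l) (by omega)
    have h2 := Int.lt_ediv_add_one_mul_self ((gdist L (Y ^ a) (Y ^ i) : ℤ) + gdist L (Y ^ a) u
      - gdist L (Y ^ i) u) (b := 2 * l) (by omega)
    rw [← hk] at h1 h2
    have hk0 : 0 ≤ k := Int.ediv_nonneg (by omega) (by omega)
    have hki : k ≤ |i - a| := by
      have := hL.dist_tri (Y ^ a) (Y ^ i) u
      have h3 := dist_zpow_one hY a i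
      by_contra h
      have : |i - a| * l + l ≤ k * l := by
        have : (|i - a| + 1) * l ≤ k * l := by apply mul_le_mul_of_nonneg_right <;> omega
        linarith
      zify at *
      linarith
    have hbt : Btw L (Y ^ a) (Y ^ (a + s * k)) (Y ^ i) := by
      apply btw_zpow_one hY
      by_cases h : a ≤ i
      · rw [abs_of_nonneg (by omega)] at hki
        simp only [hs, h, ↓reduceIte]; omega
      · rw [abs_of_nonpos (by omega)] at hki
        simp only [hs, h, ↓reduceIte]; omega
    have hd := dist_zpow_one hY a (a + s * k)
    have hs1 : |a + s * k - a| = k := by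
      by_cases h : a ≤ i
      · simp [hs, h, abs_of_nonneg hk0]
      · simp [hs, h, abs_of_nonneg hk0]
    rw [hs1] at hd
    have hle : 2 * gdist L (Y ^ a) (Y ^ (a + s * k)) + gdist L (Y ^ i) u ≤
        gdist L (Y ^ a) (Y ^ i) + gdist L (Y ^ a) u := by
      zify; rw [hd]; linarith
    have htri := hL.dist_tri (Y ^ a) u (Y ^ i)
    have hcm := hL.dist_comm u (Y ^ i)
    have htri' := hL.dist_tri (Y ^ a) (Y ^ i) u
    obtain ⟨z, hz1, hz2⟩ := hL.exists_btw (Y ^ a) u (gdist L (Y ^ a) (Y ^ (a + s * k))) (by omega)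
    have h3 := hL.thin_at hbt hz2 hz1.symm hle
    have h4 := hL.dist_tri (Y ^ (a + s * k)) z u
    have h5 := ha (a + s * k)
    unfold Btw at hz2
    zify at *
    linarith
  -- a point near `Y ^ a` on a geodesic from `Y ^ i` to `u`
  have ht1 := hL.dist_tri (Y ^ a) u (Y ^ i)
  have ht2 := hL.dist_tri (Y ^ a) (Y ^ i) u
  have ht3 := hL.dist_comm u (Y ^ i)
  have ht4 := hL.dist_comm (Y ^ a) (Y ^ i)
  have ht5 := hL.dist_tri (Y ^ i) (Y ^ a) u
  obtain ⟨x, hx1, hx2⟩ := hL.exists_btw (Y ^ i) u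
    ((gdist L (Y ^ i) (Y ^ a) + gdist L (Y ^ i) u - gdist L (Y ^ a) u) / 2) (by omega)
  obtain ⟨x', hx1', hx2'⟩ := hL.exists_btw (Y ^ i) (Y ^ a)
    ((gdist L (Y ^ i) (Y ^ a) + gdist L (Y ^ i) u - gdist L (Y ^ a) u) / 2) (by omega)
  have hxx' := hL.thin_at hx2 hx2' (by omega) (by rw [hL.dist_comm u]; omega)
  have hax : gdist L (Y ^ a) x ≤ 3 * D + 2 * l + 1 := by
    have := hL.dist_tri (Y ^ a) x' x
    have := hL.dist_comm (Y ^ a) x'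
    have := hL.dist_comm x x'
    unfold Btw at hx2'
    omega
  -- Either the geodesic to `u * Y ^ i'` passes near `x`, and then `k = i'` will do, or `x` is near
  -- the translated axis, where rounding to a power of `Y` costs at most `l`.
  rcases hL.thin_cases hx2 (u * Y ^ i') with ⟨-, h2, h3⟩ | ⟨h2', h2, h3⟩
  · obtain ⟨z, hz1, hz2⟩ := hL.exists_btw _ _ _ h2
    have := h3 z hz2 hz1.symm
    have h4 := hL.dist_tri x z (u * Y ^ i')
    have h5 := hL.dist_tri (Y ^ a) x (u * Y ^ i')
    unfold Btw at hz2
    exact ⟨i', by omega⟩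
  · set k : ℤ := (gdist L u x : ℤ) / l with hk
    have h1 := Int.ediv_mul_le (gdist L u x : ℤ) (b := l) (by omega)
    have h4 := Int.lt_ediv_add_one_mul_self (gdist L u x : ℤ) (b := l) (by omega)
    rw [← hk] at h1 h4
    have hk0 : 0 ≤ k := Int.ediv_nonneg (by omega) (by omega)
    have hui := dist_zpow hY u 0 i'
    simp only [zpow_zero, mul_one, sub_zero] at hui
    have hki : k ≤ |i'| := by
      by_contra h
      have : |i'| * l + l ≤ k * l := by
        have : (|i'| + 1) * l ≤ k * l := by apply mul_le_mul_of_nonneg_right <;> omega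
        linarith
      zify at *
      linarith
    obtain ⟨x2, hx3, hx4⟩ := hL.exists_btw u x (k * l).toNat (by omega)
    set s : ℤ := if 0 ≤ i' then 1 else -1 with hs
    have hbt : Btw L u (u * Y ^ (s * k)) (u * Y ^ i') := by
      have := btw_zpow (L := L) hY u (i := 0) (j := s * k) (k := i') (by
        by_cases h : 0 ≤ i'
        · rw [abs_of_nonneg (by omega)] at hki
          simp only [hs, h, ↓reduceIte]; omega
        · rw [abs_of_nonpos (by omega)] at hki
          simp only [hs, h, ↓reduceIte]; omega)
      simpa using this
    have hd := dist_zpow hY u 0 (s * k)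
    have hs1 : |s * k - 0| = k := by
      by_cases h : 0 ≤ i'
      · simp [hs, h, abs_of_nonneg hk0]
      · simp [hs, h, abs_of_nonneg hk0]
    rw [hs1] at hd
    simp only [zpow_zero, mul_one] at hd
    have hkl : 0 ≤ k * l := by positivity
    have hx5 : Btw L u x2 (Y ^ i) := by
      have h6 := hL.dist_tri u x2 (Y ^ i)
      have h7 := hL.dist_tri x2 x (Y ^ i)
      have h8 := hL.btw_symm hx2
      unfold Btw at *
      omega
    have h6 := hL.thin_at hx5 hbt (by omega) (by omega)
    refine ⟨s * k, ?_⟩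
    have h7 := hL.dist_tri (Y ^ a) x (u * Y ^ (s * k))
    have h8 := hL.dist_tri x x2 (u * Y ^ (s * k))
    have h9 := hL.dist_comm x2 x
    unfold Btw at hx4
    have : gdist L x2 x ≤ l := by
      zify at *; linarith [Int.toNat_of_nonneg hkl]
    omega

-- The pigeonhole principle yields equal connecting elements at two parameters; cancelling the
-- common parts turns them into a commutation relation.
omit hL hY in
theorem zpow_comm_of_eq {u ζ : G} {p q : ℤ} {τ τ' : ℤ}
    (h : Y ^ (-(p + τ)) * u * Y ^ (q + τ) * ζ = Y ^ (-(p + τ')) * u * Y ^ (q + τ') * ζ) :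
    u * Y ^ (τ' - τ) = Y ^ (τ' - τ) * u := by
  have h := mul_right_cancel h
  have e1 : Y ^ (-(p + τ')) = Y ^ (-(p + τ)) * Y ^ (-(τ' - τ)) := by rw [← zpow_add]; congr 1; ring
  have e2 : Y ^ (q + τ') = Y ^ (τ' - τ) * Y ^ (q + τ) := by rw [← zpow_add]; congr 1; ring
  rw [e1, e2] at h
  simp only [← mul_assoc] at h
  have h := mul_right_cancel h
  simp only [mul_assoc] at h
  have h := mul_left_cancel h
  rw [zpow_neg, eq_inv_mul_iff_mul_eq] at h
  exact h.symm

/-- If two translates of an axis are close for a long time, then a short power commutes. -/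
theorem exists_period (hl : 1 ≤ l) {u v : G} {i i' : ℤ} (hi' : 0 ≤ i')
    (h : Y ^ (-i) * u * Y ^ i' = v) {k : ℤ} {V : ℕ} (hk : (L u : ℤ) ≤ k * l)
    (hv : (L v : ℤ) ≤ (i - k - V) * l) (hfin : {g | L g ≤ 2 * D}.Finite)
    (hV : {g | L g ≤ 2 * D}.ncard ≤ V) :
    ∃ t : ℕ, 1 ≤ t ∧ t ≤ V ∧ u * Y ^ (t : ℤ) = Y ^ (t : ℤ) * u := by
  have hl' : (1 : ℤ) ≤ l := by exact_mod_cast hl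
  have one_dist : ∀ a, gdist L 1 a = L a := fun a => by simp [gdist]
  have hk0 : 0 ≤ k := by
    by_contra h
    have : k * l ≤ -1 * 1 := by nlinarith
    omega
  have hik : 0 ≤ i - k - V := by
    by_contra h
    have : (i - k - V) * l ≤ -1 * 1 := by nlinarith
    omega
  have hB : gdist L (u * Y ^ i') (Y ^ i) = L v := by
    rw [hL.dist_comm, ← h]; simp [gdist, mul_assoc]
  set Q := L (u * Y ^ i') with hQ
  have hAB := dist_zpow_one hY 0 i
  have hAB' := dist_zpow hY u 0 i'
  rw [abs_of_nonneg (by omega)] at hAB hAB'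
  simp only [zpow_zero, mul_one, sub_zero] at hAB hAB'
  have hQ1 : gdist L 1 (u * Y ^ i') = Q := one_dist _
  have hu1' : gdist L u 1 = L u := by rw [hL.dist_comm, one_dist]
  have q1 := hL.dist_tri 1 u (u * Y ^ i')
  have q2 := hL.dist_tri 1 (u * Y ^ i') (Y ^ i)
  rw [hQ1, one_dist] at q1
  rw [hQ1, one_dist, hB] at q2
  rw [one_dist] at hAB
  have hc0 : 0 ≤ i' * l - Q + k * l := by omega
  -- Corresponding points of the diagonal from `1` to `u * Y ^ i'` and of the translated axis have
  -- the same distance to `u * Y ^ i'`. So the partner of `Y ^ k` is at distance `i' * l - Q + k *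
  -- l` from `u`. The remainder `r` modulo `l` is realised by an initial piece `ζ` of `Y`, which is
  -- the same for all later partners.
  set σ := (i' * l - Q + k * l) / l with hσ
  set r := (i' * l - Q + k * l) % l with hr
  have hσ0 : 0 ≤ σ := Int.ediv_nonneg hc0 (by omega)
  have hr0 : 0 ≤ r := Int.emod_nonneg _ (by omega)
  have hrl : r < l := Int.emod_lt_of_pos _ (by omega)
  have hσr : l * σ + r = i' * l - Q + k * l := Int.mul_ediv_add_emod _ _
  have hYl : (L Y : ℤ) = l := by simpa using hY 1
  obtain ⟨ζ, hζ1, hζ2⟩ := hL.split Y r.toNat (by omega)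
  have hζ3 : ∀ p : ℤ, 0 ≤ p → r ≤ p * l → (L (ζ⁻¹ * Y ^ p) : ℤ) ≤ p * l - r := by
    intro p hp hrp
    rcases hp.eq_or_lt with rfl | hp
    · have : ζ = 1 := hL.eq_one _ (by omega)
      subst this
      simp only [inv_one, zpow_zero, mul_one, hL.one]; omega
    · have h1 := hL.mul_le (ζ⁻¹ * Y) (Y ^ (p - 1))
      have h2 := hY (p - 1)
      rw [abs_of_nonneg (by omega)] at h2
      rw [mul_assoc, mul_self_zpow, sub_add_cancel] at h1
      zify at *
      have : (p - 1) * l = p * l - l := by ring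
      omega
  -- Two uses of thinness, one on each side of the diagonal. The bounds on `L u` and `L v` keep all
  -- these points within the relevant Gromov products.
  have hclose : ∀ τ : ℕ, τ ≤ V → L (Y ^ (-(k + τ)) * u * Y ^ (σ + τ) * ζ) ≤ 2 * D := by
    intro τ hτ
    have hx : Btw L 1 (Y ^ (k + τ)) (Y ^ i) := by
      simpa using btw_zpow (L := L) hY 1 (i := 0) (j := k + τ) (k := i) (by omega)
    have hdx := hY (k + τ)
    rw [abs_of_nonneg (by omega)] at hdx
    have hti : (k + τ) * l ≤ i * l - L v := by
      have : (k + τ) * l ≤ (i - (i - k - V)) * l := by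
        apply mul_le_mul_of_nonneg_right <;> omega
      linarith
    have htk : k * l ≤ (k + τ) * l := by apply mul_le_mul_of_nonneg_right <;> omega
    set t := (k + τ) * l with ht
    obtain ⟨z, hz1, hz2⟩ := hL.exists_btw 1 (u * Y ^ i') t.toNat (by omega)
    have hxz := hL.thin_at hx hz2 (by rw [hz1, one_dist]; omega) (by
      rw [hL.dist_comm (Y ^ i), hB, one_dist, one_dist, hQ1]; omega)
    have hu1 : (L (Y ^ (σ + τ)) : ℤ) = (σ + τ) * l := by
      rw [hY, abs_of_nonneg (by omega)]
    have hst : (σ + τ) * l + r = i' * l - Q + t := by rw [ht]; linarith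
    have hd1 : (gdist L u (u * Y ^ (σ + τ) * ζ) : ℤ) ≤ i' * l - Q + t := by
      have := hL.mul_le (Y ^ (σ + τ)) ζ
      have e : gdist L u (u * Y ^ (σ + τ) * ζ) = L (Y ^ (σ + τ) * ζ) := by simp [gdist, mul_assoc]
      rw [e]; omega
    have hp : (i' - σ - τ) * l = i' * l - (σ + τ) * l := by ring
    have hd2 : (gdist L (u * Y ^ (σ + τ) * ζ) (u * Y ^ i') : ℤ) ≤ Q - t := by
      have e : gdist L (u * Y ^ (σ + τ) * ζ) (u * Y ^ i') = L (ζ⁻¹ * Y ^ (i' - σ - τ)) := by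
        unfold gdist; congr 1
        rw [show i' - σ - τ = -(σ + τ) + i' by ring, zpow_add Y (-(σ + τ)), zpow_neg]
        simp [mul_assoc]
      rw [e]
      have := hζ3 (i' - σ - τ) (by
        by_contra hneg
        have : (i' - σ - τ) * l ≤ -1 * l := by apply mul_le_mul_of_nonneg_right <;> omega
        omega) (by omega)
      omega
    have htri := hL.dist_tri u (u * Y ^ (σ + τ) * ζ) (u * Y ^ i')
    have hz' : Btw L u (u * Y ^ (σ + τ) * ζ) (u * Y ^ i') := by unfold Btw; omega
    have hz3 := hL.btw_symm hz2
    have c1 := hL.dist_comm (u * Y ^ i') z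
    have c2 := hL.dist_comm (u * Y ^ i') (u * Y ^ (σ + τ) * ζ)
    have c3 := hL.dist_comm (u * Y ^ i') 1
    have c4 := hL.dist_comm (u * Y ^ i') u
    have c5 := hL.dist_comm 1 u
    have hzz := hL.thin_at hz3 (hL.btw_symm hz')
      (by unfold Btw at *; omega)
      (by unfold Btw at *; omega)
    have := hL.dist_tri (Y ^ (k + τ)) z (u * Y ^ (σ + τ) * ζ)
    have e : gdist L (Y ^ (k + τ)) (u * Y ^ (σ + τ) * ζ) =
      L (Y ^ (-(k + τ)) * u * Y ^ (σ + τ) * ζ) := by simp only [gdist, zpow_neg, mul_assoc]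
    omega
  -- There are `V + 1` parameters, but at most `V` elements in the ball.
  obtain ⟨τ, hτ, τ', hτ', hne, heq⟩ := Finset.exists_ne_map_eq_of_card_lt_of_maps_to
    (s := Finset.range (V + 1)) (t := hfin.toFinset)
    (f := fun τ : ℕ => Y ^ (-(k + τ)) * u * Y ^ (σ + τ) * ζ)
    (by rw [← Set.ncard_eq_toFinset_card _ hfin, Finset.card_range]; omega)
    (fun τ hτ => by simpa using hclose τ (by simpa [Nat.lt_succ_iff] using hτ))
  simp only [Finset.mem_range] at hτ hτ'
  rcases lt_or_gt_of_ne hne with h1 | h1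
  · refine ⟨τ' - τ, by omega, by omega, ?_⟩
    rw [Nat.cast_sub h1.le]; exact zpow_comm_of_eq heq
  · refine ⟨τ - τ', by omega, by omega, ?_⟩
    rw [Nat.cast_sub h1.le]; exact zpow_comm_of_eq heq.symm

end ThinLength
end Axis
-- Exponents relating almost shortest elements of a double coset
section Axis

variable {G : Type*} [Group G]

namespace ThinLength

variable {L : G → ℕ} {D : ℕ} (hL : ThinLength L D) {Y : G} {l : ℕ}
  (hY : ∀ n : ℤ, (L (Y ^ n) : ℤ) = |n| * l)

include hL hY

/-- Consider the quadrilateral with corners `1`, `Y ^ i`, `u * Y ^ i'`, `u`. If `i` is large, almost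
minimality keeps an inner point of the axis away from the sides of lengths `L u` and `L v`, so it is
near the translated axis and both elements are short. The two axes then run side by side. In
parallel directions this gives a period; in opposite directions the exponents nearly cancel. -/
theorem exponent_of_nonneg (hl : 1 ≤ l) {u v : G} {i i' : ℤ} {V : ℕ}
    (hu : ∀ i i' : ℤ, L u ≤ L (Y ^ (-i) * u * Y ^ i') + (7 * D + 6 * l))
    (hv : ∀ i i' : ℤ, L v ≤ L (Y ^ (-i) * u * Y ^ i') + (7 * D + 6 * l))
    (h : Y ^ (-i) * u * Y ^ i' = v) (hfin : {g | L g ≤ 2 * D}.Finite)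
    (hV : {g | L g ≤ 2 * D}.ncard ≤ V) (hi : 0 ≤ i) :
    |i| ≤ 2 * (9 * D + 7) + V + 1 ∨ |i + i'| ≤ 2 * (9 * D + 7) + V + 1 ∨
    ∃ t : ℕ, 1 ≤ t ∧ t ≤ V ∧ u * Y ^ (t : ℤ) = Y ^ (t : ℤ) * u := by
  have hl' : (1 : ℤ) ≤ l := by exact_mod_cast hl
  have one_dist : ∀ a, gdist L 1 a = L a := fun a => by simp [gdist]
  rw [or_iff_not_imp_left]
  intro hiK
  rw [abs_of_nonneg hi, not_le] at hiK
  have e : ∀ i i' : ℤ, L (Y ^ (-i) * u * Y ^ i') = gdist L (Y ^ i) (u * Y ^ i') := fun i i' => by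
    simp [gdist, mul_assoc]
  simp only [e] at hu hv
  obtain ⟨κ, hκ⟩ : ∃ κ : ℤ, κ = 9 * D + 7 := ⟨_, rfl⟩
  have hκl : 7 * (D : ℤ) + 6 * l + 2 * D + l ≤ κ * l := by
    have : (9 * D : ℤ) * 1 ≤ 9 * D * l := by apply mul_le_mul_of_nonneg_left <;> omega
    rw [hκ]; linarith
  have hx : Btw L 1 (Y ^ κ) (Y ^ i) := by
    simpa using btw_zpow (L := L) hY 1 (i := 0) (j := κ) (k := i) (by omega)
  have hx1 := hY κ
  rw [abs_of_nonneg (by omega)] at hx1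
  have hx2 := dist_zpow_one hY i κ
  rw [abs_of_nonpos (by omega)] at hx2
  have hxi : κ * l ≤ -(κ - i) * l := by apply mul_le_mul_of_nonneg_right <;> omega
  have hBB : gdist L (Y ^ i) (u * Y ^ i') = L v := by rw [← h, e]
  have hAB := hY i
  -- both elements are short
  have hshort : L u ≤ κ * l ∧ L v ≤ κ * l := by
    suffices H : ∃ j : ℤ, gdist L (Y ^ κ) (u * Y ^ j) ≤ 2 * D + l by
      obtain ⟨j, hj⟩ := H
      have h1 := hu κ j
      have h2 := hv κ j
      omega
    have hu0 := hu κ 0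
    have hvi := hv κ i'
    rw [zpow_zero, mul_one] at hu0
    -- If `Y ^ κ` were near the side from `1` to `u` or the side from `Y ^ i` to `u * Y ^ i'`,
    -- starting at `Y ^ κ` would shorten that side by at least `κ * l - 2 * D`, more than almost
    -- minimality allows.
    rcases hL.thin_cases hx u with ⟨-, h2, h3⟩ | ⟨-, h2, h3⟩
    · obtain ⟨z, hz1, hz2⟩ := hL.exists_btw _ _ _ h2
      have h4 := h3 z hz2 hz1.symm
      have h5 := hL.dist_tri (Y ^ κ) z u
      have h6 := one_dist (Y ^ κ)
      have h7 := one_dist u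
      unfold Btw at hz2
      omega
    · obtain ⟨z, hz1, hz2⟩ := hL.exists_btw _ _ _ h2
      have h4 := h3 z hz2 hz1.symm
      rcases hL.thin_cases hz2 (u * Y ^ i') with ⟨-, h5, h6⟩ | ⟨h5', h5, h6⟩
      · obtain ⟨z', hz1', hz2'⟩ := hL.exists_btw _ _ _ h5
        have h7 := h6 z' hz2' hz1'.symm
        have h8 := hL.dist_tri (Y ^ κ) z (u * Y ^ i')
        have h9 := hL.dist_tri z z' (u * Y ^ i')
        unfold Btw at hz2'
        omega
      · obtain ⟨k, hk⟩ : ∃ k : ℤ, k = (gdist L u z : ℤ) / l := ⟨_, rfl⟩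
        have h1 := Int.ediv_mul_le (gdist L u z : ℤ) (b := l) (by omega)
        have h7 := Int.lt_ediv_add_one_mul_self (gdist L u z : ℤ) (b := l) (by omega)
        rw [← hk] at h1 h7
        have hk0 : 0 ≤ k := hk ▸ Int.ediv_nonneg (by omega) (by omega)
        have hui := dist_zpow hY u 0 i'
        simp only [zpow_zero, mul_one, sub_zero] at hui
        have hki : k ≤ |i'| := by
          by_contra h
          have : (|i'| + 1) * l ≤ k * l := by apply mul_le_mul_of_nonneg_right <;> omega
          rw [add_mul] at this
          omega
        obtain ⟨z2, hz3, hz4⟩ := hL.exists_btw u z (k * l).toNat (by omega)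
        obtain ⟨s, hs⟩ : ∃ s : ℤ, s = if 0 ≤ i' then 1 else -1 := ⟨_, rfl⟩
        have hbt : Btw L u (u * Y ^ (s * k)) (u * Y ^ i') := by
          have := btw_zpow (L := L) hY u (i := 0) (j := s * k) (k := i') (by
            by_cases h : 0 ≤ i'
            · rw [abs_of_nonneg (by omega)] at hki
              simp only [hs, h, ↓reduceIte]; omega
            · rw [abs_of_nonpos (by omega)] at hki
              simp only [hs, h, ↓reduceIte]; omega)
          simpa using this
        have hd := dist_zpow hY u 0 (s * k)
        have hs1 : |s * k - 0| = k := by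
          by_cases h : 0 ≤ i'
          · simp [hs, h, abs_of_nonneg hk0]
          · simp [hs, h, abs_of_nonneg hk0]
        rw [hs1] at hd
        simp only [zpow_zero, mul_one] at hd
        have hkl : 0 ≤ k * l := by positivity
        have hzs := hL.btw_symm hz2
        have hz5 : Btw L u z2 (Y ^ i) := by
          have h8 := hL.dist_tri u z2 (Y ^ i)
          have h9 := hL.dist_tri z2 z (Y ^ i)
          unfold Btw at *
          omega
        have h10 := hL.thin_at hz5 hbt (by omega) (by omega)
        refine ⟨s * k, ?_⟩
        have h11 := hL.dist_tri (Y ^ κ) z (u * Y ^ (s * k))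
        have h12 := hL.dist_tri z z2 (u * Y ^ (s * k))
        have h13 := hL.dist_comm z2 z
        unfold Btw at hz4
        rw [add_mul] at h7
        omega
  obtain ⟨hu1, hv1⟩ := hshort
  by_cases hi' : 0 ≤ i'
  · right
    refine hL.exists_period hY hl hi' h (k := κ) hu1 (hv1.trans ?_) hfin hV
    apply mul_le_mul_of_nonneg_right <;> omega
  · left
    -- Around the quadrilateral, `i * l` and `-i' * l` differ by at most `L u + L v ≤ 2 * κ * l`.
    have hAB' := dist_zpow hY u 0 i'
    simp only [zpow_zero, mul_one, sub_zero] at hAB'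
    have t1 := hL.dist_tri 1 u (u * Y ^ i')
    have t2 := hL.dist_tri 1 (u * Y ^ i') (Y ^ i)
    have t3 := hL.dist_tri 1 (Y ^ i) (u * Y ^ i')
    have t4 := hL.dist_tri u 1 (u * Y ^ i')
    have t5 := hL.dist_comm u 1
    have t6 := hL.dist_comm (u * Y ^ i') (Y ^ i)
    simp only [one_dist] at *
    rw [abs_of_nonneg hi] at hAB
    rw [abs_of_neg (by omega)] at hAB'
    have b1 : (i + i') * l ≤ 2 * κ * l := by linarith
    have b2 : -(2 * κ) * l ≤ (i + i') * l := by linarith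
    have b3 := le_of_mul_le_mul_right b1 (by omega)
    have b4 := le_of_mul_le_mul_right b2 (by omega)
    rw [abs_le]; omega

/-- The exponents that conjugate one almost shortest double coset representative to another one
are bounded, or balanced, or there is a short period. -/
theorem exponent_cases (hl : 1 ≤ l) {u v : G} {i i' : ℤ} {V : ℕ}
    (hu : ∀ i i' : ℤ, L u ≤ L (Y ^ (-i) * u * Y ^ i') + (7 * D + 6 * l))
    (hv : ∀ i i' : ℤ, L v ≤ L (Y ^ (-i) * u * Y ^ i') + (7 * D + 6 * l))
    (h : Y ^ (-i) * u * Y ^ i' = v) (hfin : {g | L g ≤ 2 * D}.Finite)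
    (hV : {g | L g ≤ 2 * D}.ncard ≤ V) :
    |i| ≤ 2 * (9 * D + 7) + V + 1 ∨ |i + i'| ≤ 2 * (9 * D + 7) + V + 1 ∨
    ∃ t : ℕ, 1 ≤ t ∧ t ≤ V ∧ u * Y ^ (t : ℤ) = Y ^ (t : ℤ) * u := by
  rcases le_total 0 i with hi | hi
  · exact hL.exponent_of_nonneg hY hl hu hv h hfin hV hi
  · have hY' : ∀ n : ℤ, (L (Y⁻¹ ^ n) : ℤ) = |n| * l := fun n => by
      rw [inv_zpow', hY, abs_neg]
    rcases hL.exponent_of_nonneg hY' hl (u := u) (v := v) (i := -i) (i' := -i')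
      (fun i i' => by simpa only [inv_zpow'] using hu (-i) (-i'))
      (fun i i' => by simpa only [inv_zpow'] using hv (-i) (-i'))
      (by simpa only [inv_zpow', neg_neg] using h) hfin hV (by omega) with h1 | h1 | ⟨t, h1, h2, h3⟩
    · left; rwa [abs_neg] at h1
    · right; left; rwa [← neg_add, abs_neg] at h1
    · refine .inr (.inr ⟨t, h1, h2, ?_⟩)
      rw [inv_zpow, eq_inv_mul_iff_mul_eq, ← mul_assoc, mul_inv_eq_iff_eq_mul] at h3
      exact h3.symm

/-- If a nontrivial power of `Y` commutes with `u`, then so does a short one. -/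
theorem exists_short_period (hl : 1 ≤ l) {u : G} {d : ℤ} {V : ℕ} (hd : 0 < d)
    (h : u * Y ^ d = Y ^ d * u) (hfin : {g | L g ≤ 2 * D}.Finite)
    (hV : {g | L g ≤ 2 * D}.ncard ≤ V) :
    ∃ t : ℕ, 1 ≤ t ∧ t ≤ V ∧ u * Y ^ (t : ℤ) = Y ^ (t : ℤ) * u := by
  have hn : ∀ n : ℕ, u * Y ^ (d * n) = Y ^ (d * n) * u := fun n => by
    rw [zpow_mul, zpow_natCast]; exact ((show Commute u (Y ^ d) from h).pow_right n).eq
  -- The multiple of `d` is large enough to leave length `L u` at both ends and `V` steps in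
  -- between.
  refine hL.exists_period hY hl (u := u) (v := u) (i := d * (2 * L u + V : ℕ))
    (i' := d * (2 * L u + V : ℕ)) (k := L u) (by positivity) ?_ ?_ ?_ hfin hV
  · rw [mul_assoc, hn, ← mul_assoc, ← zpow_add]; simp
  · have : (L u : ℤ) * 1 ≤ L u * l := by apply mul_le_mul_of_nonneg_left <;> omega
    linarith
  · have h1 : (1 : ℤ) * (2 * L u + V : ℕ) ≤ d * (2 * L u + V : ℕ) := by
      apply mul_le_mul_of_nonneg_right <;> omega
    have h2 : (L u : ℤ) * 1 ≤ (d * (2 * L u + V : ℕ) - L u - V) * l := by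
      apply mul_le_mul <;> push_cast at * <;> omega
    linarith

end ThinLength
end Axis
-- The word length as a geodesic length function
section Words

variable {G : Type*} [Group G] {X : Finset G}

theorem evalWord_nil : evalWord ([] : List X) = 1 := rfl

theorem evalWord_cons (x : X) (w : List X) : evalWord (x :: w) = x * evalWord w := by
  simp [evalWord]

theorem evalWord_append (v w : List X) : evalWord (v ++ w) = evalWord v * evalWord w := by
  simp [evalWord]

theorem wordLength_le (w : List X) : wordLength X (evalWord w) ≤ w.length :=
  Nat.sInf_le ⟨w, rfl, rfl⟩

theorem wordLength_one : wordLength X (1 : G) = 0 :=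
  Nat.le_zero.1 (wordLength_le ([] : List X))

variable (hinv : ∀ x ∈ X, x⁻¹ ∈ X) (hgen : Subgroup.closure (X : Set G) = ⊤)

include hinv

theorem exists_evalWord_inv (w : List X) : ∃ w' : List X, w'.length = w.length ∧
    evalWord w' = (evalWord w)⁻¹ := by
  induction w with
  | nil => exact ⟨[], rfl, by simp [evalWord]⟩
  | cons x w ih =>
    obtain ⟨w', h1, h2⟩ := ih
    exact ⟨w' ++ [⟨x⁻¹, hinv x x.2⟩], by simp [h1],
      by rw [evalWord_append, h2, evalWord_cons, evalWord_cons, evalWord_nil]; simp⟩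

include hgen

theorem evalWord_surjective : Function.Surjective (evalWord : List X → G) := by
  intro g
  have hg : g ∈ Subgroup.closure (X : Set G) := by rw [hgen]; trivial
  induction hg using Subgroup.closure_induction with
  | mem x hx => exact ⟨[⟨x, hx⟩], by simp [evalWord]⟩
  | one => exact ⟨[], rfl⟩
  | mul x y _ _ hx hy =>
    obtain ⟨v, rfl⟩ := hx
    obtain ⟨w, rfl⟩ := hy
    exact ⟨v ++ w, evalWord_append _ _⟩
  | inv x _ hx =>
    obtain ⟨v, rfl⟩ := hx
    obtain ⟨w, -, hw⟩ := exists_evalWord_inv hinv v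
    exact ⟨w, hw⟩

theorem exists_geodesic_word (g : G) : ∃ w : List X, w.length = wordLength X g ∧ evalWord w = g := by
  obtain ⟨w, hw⟩ := evalWord_surjective hinv hgen g
  exact Nat.sInf_mem (s := {n : ℕ | ∃ w : List X, w.length = n ∧ evalWord w = g}) ⟨_, w, rfl, hw⟩

theorem geodesicLength_wordLength : GeodesicLength (wordLength X) := by
  have hle : ∀ g : G, wordLength X g⁻¹ ≤ wordLength X g := fun g => by
    obtain ⟨w, h1, h2⟩ := exists_geodesic_word hinv hgen g
    obtain ⟨w', h3, h4⟩ := exists_evalWord_inv hinv w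
    rw [← h1, ← h3, ← h2, ← h4]; exact wordLength_le _
  have hmul : ∀ g h : G, wordLength X (g * h) ≤ wordLength X g + wordLength X h := fun g h => by
    obtain ⟨v, h1, rfl⟩ := exists_geodesic_word hinv hgen g
    obtain ⟨w, h2, rfl⟩ := exists_geodesic_word hinv hgen h
    rw [← h1, ← h2, ← evalWord_append, ← List.length_append]; exact wordLength_le _
  refine ⟨wordLength_one, fun g hg => ?_, fun g => (hle g).antisymm (by simpa using hle g⁻¹),
    hmul, fun g n hn => ?_⟩
  · obtain ⟨w, h1, rfl⟩ := exists_geodesic_word hinv hgen g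
    rw [hg, List.length_eq_zero_iff] at h1
    rw [h1, evalWord_nil]
  · obtain ⟨w, h1, rfl⟩ := exists_geodesic_word hinv hgen g
    have h2 : evalWord w = evalWord (w.take n) * evalWord (w.drop n) := by
      rw [← evalWord_append, List.take_append_drop]
    have h3 := wordLength_le (w.take n)
    have h4 := wordLength_le (w.drop n)
    rw [List.length_take] at h3
    rw [List.length_drop] at h4
    have h5 := hmul (evalWord (w.take n)) (evalWord (w.drop n))
    rw [← h2] at h5
    refine ⟨evalWord (w.take n), by omega, ?_⟩
    rw [h2, inv_mul_cancel_left, ← h2]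
    omega

end Words

/-! ### From triangles in the Cayley graph to triangles of vertices -/

section Cayley

variable {G : Type*} [Group G] {X : Finset G}

/-- The point at parameter `s` of an edge path. -/
noncomputable def pathPoint (P : ℕ → G) (hP : ∀ i, EdgeOrVertex X (P i) (P (i + 1))) (s : ℝ) :
    CayleyPoint X where
  coord := fun v => Set.indicator {P ⌊s⌋₊} (fun _ => 1 - Int.fract s) v +
    Set.indicator {P (⌊s⌋₊ + 1)} (fun _ => Int.fract s) v
  exists_edge := ⟨_, _, hP _, Int.fract s, ⟨Int.fract_nonneg s, (Int.fract_lt_one s).le⟩, rfl⟩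

variable {P : ℕ → G} {hP : ∀ i, EdgeOrVertex X (P i) (P (i + 1))} {l : ℕ}

theorem pathPoint_coord_eq_zero {s : ℝ} {v : G} (hv : ∀ i ≤ ⌊s⌋₊ + 1, v ≠ P i) :
    (pathPoint P hP s).coord v = 0 := by
  simp [pathPoint, hv ⌊s⌋₊ (by omega), hv (⌊s⌋₊ + 1) le_rfl]

variable (hd : ∀ i j, i ≤ j → j ≤ l → gdist (wordLength X) (P i) (P j) = j - i)

include hd

theorem path_injective {i j : ℕ} (hi : i ≤ l) (hj : j ≤ l) (h : P i = P j) : i = j := by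
  have h0 : ∀ g : G, gdist (wordLength X) g g = 0 := fun g => by simp [gdist, wordLength_one]
  rcases le_total i j with hij | hij
  · have := hd i j hij hj
    rw [h, h0] at this; omega
  · have := hd j i hij hi
    rw [h, h0] at this; omega

theorem pathPoint_coord {s : ℝ} (hs : s ∈ Set.Icc (0 : ℝ) l) {i : ℕ}
    (hi : i ≤ l) : (pathPoint P hP s).coord (P i) = max 0 (1 - |s - i|) := by
  classical
  obtain ⟨h0, hl⟩ := hs
  set n := ⌊s⌋₊ with hn
  have hfr : Int.fract s = s - n := by
    rw [Int.fract, ← natCast_floor_eq_intCast_floor h0]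
  have hn1 : (n : ℝ) ≤ s := Nat.floor_le h0
  have hn2 : s < n + 1 := Nat.lt_floor_add_one s
  have hnl : n ≤ l := by exact_mod_cast hn1.trans hl
  have e : (pathPoint P hP s).coord (P i) =
      (if i = n then 1 - (s - n) else 0) + (if P i = P (n + 1) then s - n else 0) := by
    simp only [pathPoint, Set.indicator_apply, Set.mem_singleton_iff, hfr, ← hn]
    congr 1
    by_cases h : i = n
    · simp [h]
    · have : P i ≠ P n := fun h' => h (path_injective hd hi hnl h')
      simp [h, this]
  rw [e]
  -- The edge after the vertex `P l` may leave the geodesic part, but at `s = l` its far end has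
  -- coordinate `0`.
  by_cases hnl' : n = l
  · have hsn : s = n := le_antisymm (by rw [hnl']; exact hl) hn1
    rw [hsn]; simp only [sub_self, sub_zero, ite_self, add_zero]
    by_cases h : i = n
    · simp [h]
    · have : (1 : ℝ) ≤ |(n : ℝ) - i| := by
        have : (1 : ℤ) ≤ |(n : ℤ) - i| := Int.one_le_abs (by omega)
        exact_mod_cast this
      simp only [h, ↓reduceIte]
      rw [max_eq_left (by linarith)]
  · have hPi : P i = P (n + 1) ↔ i = n + 1 :=
      ⟨fun h => path_injective hd hi (by omega) h, fun h => by rw [h]⟩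
    simp only [hPi]
    rcases lt_trichotomy i n with h | h | h
    · have : (i : ℝ) + 1 ≤ n := by exact_mod_cast h
      rw [if_neg (by omega), if_neg (by omega), max_eq_left]
      · ring
      · rw [abs_of_nonneg (by linarith)]; linarith
    · subst h
      simp only [↓reduceIte, show ¬ (n = n + 1) by omega]
      rw [abs_of_nonneg (by linarith), max_eq_right (by linarith)]; ring
    · by_cases h' : i = n + 1
      · subst h'
        simp only [↓reduceIte, show ¬ (n + 1 = n) by omega]
        push_cast
        rw [abs_of_nonpos (by linarith), max_eq_right (by linarith)]; ring
      · have : (n : ℝ) + 2 ≤ i := by exact_mod_cast (by omega : n + 2 ≤ i)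
        rw [if_neg (by omega), if_neg h', max_eq_left]
        · ring
        · rw [abs_of_nonpos (by linarith)]; linarith

theorem exists_of_pathPoint_coord_pos {s : ℝ} (hs : s ∈ Set.Icc (0 : ℝ) l) {v : G}
    (hv : 0 < (pathPoint P hP s).coord v) :
    ∃ i ≤ l, v = P i ∧ (pathPoint P hP s).coord v = 1 - |s - i| ∧ |s - i| < 1 := by
  have H : ∃ i ≤ l, v = P i := by
    by_contra hcon
    push Not at hcon
    have hnl : ⌊s⌋₊ ≤ l := Nat.floor_le_of_le hs.2
    by_cases h : ⌊s⌋₊ + 1 ≤ l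
    · rw [pathPoint_coord_eq_zero (fun i hi => hcon i (by omega))] at hv
      exact lt_irrefl _ hv
    · have hsl : s = l := le_antisymm hs.2 (by
        have : ⌊s⌋₊ = l := by omega
        rw [← this]; exact Nat.floor_le hs.1)
      subst hsl
      simp [pathPoint, hcon l le_rfl] at hv
  obtain ⟨i, hi, rfl⟩ := H
  rw [pathPoint_coord hd hs hi] at hv ⊢
  have h1 : 0 < 1 - |s - i| := by simpa using hv
  exact ⟨i, hi, rfl, max_eq_right h1.le, by linarith⟩

/-- The infimum of the path lengths is attained, either inside one edge or through vertices of the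
path. No other path is shorter, because all vertices with a positive coordinate lie on the geodesic
part, where the word metric is known. -/
theorem pathPoint_dist_of_le {s t : ℝ} (hs : s ∈ Set.Icc (0 : ℝ) l) (ht : t ∈ Set.Icc (0 : ℝ) l)
    (hst : s ≤ t) (hL : GeodesicLength (wordLength X)) :
    dist (pathPoint P hP s) (pathPoint P hP t) = t - s := by
  have hcs := fun i hi => pathPoint_coord (hP := hP) hd hs (i := i) hi
  have hct := fun i hi => pathPoint_coord (hP := hP) hd ht (i := i) hi
  have hs1 : (⌊s⌋₊ : ℝ) ≤ s := Nat.floor_le hs.1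
  have hs2 : s < ⌊s⌋₊ + 1 := Nat.lt_floor_add_one s
  have ht1 : (⌊t⌋₊ : ℝ) ≤ t := Nat.floor_le ht.1
  have ht2 : t < ⌊t⌋₊ + 1 := Nat.lt_floor_add_one t
  have hsl : ⌊s⌋₊ ≤ l := Nat.floor_le_of_le hs.2
  have htl : ⌊t⌋₊ ≤ l := Nat.floor_le_of_le ht.2
  have hnm : ⌊s⌋₊ ≤ ⌊t⌋₊ := Nat.floor_mono hst
  set n := ⌊s⌋₊ with hn
  set m := ⌊t⌋₊ with hm
  have hdist : ∀ i j : ℕ, i ≤ l → j ≤ l → (wordLength X ((P i)⁻¹ * P j) : ℝ) = |(i : ℝ) - j| := by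
    intro i j hi hj
    rcases le_total i j with h | h
    · have := hd i j h hj
      unfold gdist at this
      rw [this, Nat.cast_sub h, abs_sub_comm, abs_of_nonneg]
      have : (i : ℝ) ≤ j := by exact_mod_cast h
      linarith
    · have := hd j i h hi
      rw [hL.dist_comm] at this
      unfold gdist at this
      rw [this, Nat.cast_sub h, abs_of_nonneg]
      have : (j : ℝ) ≤ i := by exact_mod_cast h
      linarith
  apply le_antisymm
  · apply csInf_le
    · refine ⟨0, ?_⟩
      rintro x (⟨a, b, -, rfl⟩ | ⟨a, b, ha, hb, rfl⟩)
      · exact abs_nonneg _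
      · obtain ⟨i, -, -, h1, -⟩ := exists_of_pathPoint_coord_pos hd hs ha
        obtain ⟨j, -, -, h2, -⟩ := exists_of_pathPoint_coord_pos hd ht hb
        rw [h1, h2]
        have := abs_nonneg (s - i)
        have := abs_nonneg (t - j)
        have : (0 : ℝ) ≤ (wordLength X (a⁻¹ * b) : ℝ) := by positivity
        linarith
    · rcases hst.eq_or_lt with rfl | hlt
      · left
        refine ⟨P n, P (n + 1), ⟨hP n, fun v h1 h2 => ?_⟩, by simp⟩
        simp [pathPoint, ← hn, h1, h2]
      by_cases htn : t ≤ n + 1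
      · have hn1 : n + 1 ≤ l := by
          have : (n : ℝ) < l := by linarith [ht.2]
          exact_mod_cast this
        left
        have hz : ∀ r ∈ Set.Icc (0 : ℝ) l, n ≤ r → r ≤ n + 1 → ∀ v, v ≠ P n → v ≠ P (n + 1) →
            (pathPoint P hP r).coord v = 0 := by
          intro r hr h1 h2 v h3 h4
          by_contra h0
          have hpos : 0 < (pathPoint P hP r).coord v := by
            refine lt_of_le_of_ne ?_ (Ne.symm h0)
            have := Int.fract_nonneg r
            have := (Int.fract_lt_one r).le
            classical
            simp only [pathPoint, Set.indicator_apply]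
            split_ifs <;> linarith
          obtain ⟨i, hi, rfl, -, hi'⟩ := exists_of_pathPoint_coord_pos hd hr hpos
          rw [abs_lt] at hi'
          have a1 : (i : ℝ) < n + 2 := by linarith
          have a2 : (n : ℝ) < i + 1 := by linarith
          have a1' : i < n + 2 := by exact_mod_cast a1
          have a2' : n < i + 1 := by exact_mod_cast a2
          rcases (by omega : i = n ∨ i = n + 1) with rfl | rfl
          · exact h3 rfl
          · exact h4 rfl
        refine ⟨P n, P (n + 1), ⟨hP n, fun v h1 h2 => ⟨hz s hs hs1 hs2.le v h1 h2,
          hz t ht (by linarith) htn v h1 h2⟩⟩, ?_⟩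
        rw [hcs n hsl, hct n hsl, abs_of_nonneg (a := s - n) (by linarith),
          abs_of_nonneg (a := t - n) (by linarith), max_eq_right (by linarith),
          max_eq_right (by linarith), abs_of_nonneg (by linarith)]
        ring
      · push Not at htn
        have hnm1 : n + 1 ≤ m := Nat.le_floor (by push_cast; exact htn.le)
        have hnm2 : (n : ℝ) + 1 ≤ m := by exact_mod_cast hnm1
        right
        have hqm : (pathPoint P hP t).coord (P m) = 1 - (t - m) := by
          rw [hct m htl, abs_of_nonneg (by linarith), max_eq_right (by linarith)]
        by_cases hsn : s = n
        · have hpn : (pathPoint P hP s).coord (P n) = 1 := by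
            rw [hcs n hsl, ← hsn]; simp
          refine ⟨P n, P m, by rw [hpn]; norm_num, by rw [hqm]; linarith, ?_⟩
          rw [hpn, hqm, hdist n m hsl htl, abs_of_nonpos (by linarith), hsn]; ring
        · have hsn' : (n : ℝ) < s := lt_of_le_of_ne hs1 (Ne.symm hsn)
          have hpn : (pathPoint P hP s).coord (P (n + 1)) = s - n := by
            rw [hcs (n + 1) (by omega)]
            push_cast
            rw [abs_of_nonpos (by linarith), max_eq_right (by linarith)]; ring
          refine ⟨P (n + 1), P m, by rw [hpn]; linarith, by rw [hqm]; linarith, ?_⟩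
          rw [hpn, hqm, hdist (n + 1) m (by omega) htl]
          push_cast
          rw [abs_of_nonpos (by linarith)]; ring
  · apply le_csInf
    · refine ⟨_, .inr ⟨P n, P m, ?_, ?_, rfl⟩⟩
      · rw [hcs n hsl, abs_of_nonneg (by linarith)]
        exact lt_max_of_lt_right (by linarith)
      · rw [hct m htl, abs_of_nonneg (by linarith)]
        exact lt_max_of_lt_right (by linarith)
    rintro x (⟨a, b, ⟨hab, hon⟩, rfl⟩ | ⟨a, b, ha, hb, rfl⟩)
    · have hmem : ∀ i ≤ l, |s - i| < 1 ∨ |t - i| < 1 → P i = a ∨ P i = b := by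
        intro i hi h
        by_contra hcon
        push Not at hcon
        obtain ⟨h1, h2⟩ := hon (P i) hcon.1 hcon.2
        rw [hcs i hi] at h1
        rw [hct i hi] at h2
        have h1' := le_max_right 0 (1 - |s - i|)
        have h2' := le_max_right 0 (1 - |t - i|)
        rcases h with h | h <;> linarith
      have hadj : ∀ i ≤ l, ∀ j ≤ l, (P i = a ∨ P i = b) → (P j = a ∨ P j = b) → i ≤ j → j ≤ i + 1 := by
        intro i hi j hj h1 h2 hij
        have h3 : gdist (wordLength X) a b ≤ 1 := by
          rcases hab with rfl | hab
          · simp [gdist, wordLength_one]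
          · have := wordLength_le [(⟨_, hab⟩ : X)]
            simpa [evalWord, gdist] using this
        have h4 := hd i j hij hj
        have h5 := hL.dist_comm a b
        have h6 := hL.dist_self a
        have h7 := hL.dist_self b
        rcases h1 with h1 | h1 <;> rcases h2 with h2 | h2 <;> rw [h1, h2] at h4 <;> omega
      have hPn := hmem n hsl (.inl (by rw [abs_lt]; constructor <;> linarith))
      have hPm := hmem m htl (.inr (by rw [abs_lt]; constructor <;> linarith))
      -- Vertices of the path near either point must be ends of the common edge, so their indices
      -- differ by at most one. This puts `s` and `t` between `n` and `n + 1`.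
      have key : s = t ∨ (n + 1 ≤ l ∧ t ≤ n + 1 ∧ (P (n + 1) = a ∨ P (n + 1) = b)) := by
        have hmn := hadj n hsl m htl hPn hPm hnm
        rcases (by omega : m = n ∨ m = n + 1) with h | h
        · by_cases htn : t = n
          · left; linarith
          · right
            rw [h] at ht1 ht2
            have : (n : ℝ) < t := lt_of_le_of_ne ht1 (Ne.symm htn)
            have hn1 : n + 1 ≤ l := by
              have : (n : ℝ) < l := by linarith [ht.2]
              exact_mod_cast this
            refine ⟨hn1, ht2.le, hmem _ hn1 (.inr ?_)⟩
            push_cast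
            rw [abs_lt]; constructor <;> linarith
        · right
          rw [h] at htl hPm
          refine ⟨htl, ?_, hPm⟩
          by_contra htn
          push Not at htn
          rw [h] at ht1 ht2
          push_cast at ht1 ht2
          have hn1 : n + 2 ≤ l := by
            have : ((n + 1 : ℕ) : ℝ) < l := by push_cast; linarith [ht.2]
            exact_mod_cast this
          have := hadj n hsl _ hn1 hPn (hmem _ hn1 (.inr (by
            push_cast
            rw [abs_lt]; constructor <;> linarith))) (by omega)
          omega
      rcases key with rfl | ⟨hn1, htn, hPn1⟩
      · simp
      · have ea : a = P n ∨ a = P (n + 1) := by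
          rcases hPn with h | h
          · exact .inl h.symm
          · rcases hPn1 with h' | h'
            · exact .inr h'.symm
            · have := path_injective hd hsl hn1 (h.trans h'.symm)
              omega
        rcases ea with rfl | rfl
        · rw [hcs n hsl, hct n hsl, abs_of_nonneg (a := s - n) (by linarith),
            abs_of_nonneg (a := t - n) (by linarith), max_eq_right (by linarith),
            max_eq_right (by linarith)]
          refine le_trans ?_ (le_abs_self _)
          linarith
        · rw [hcs _ hn1, hct _ hn1]
          push_cast
          rw [abs_of_nonpos (a := s - (n + 1)) (by linarith),
            abs_of_nonpos (a := t - (n + 1)) (by linarith), max_eq_right (by linarith),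
            max_eq_right (by linarith)]
          refine le_trans ?_ (neg_le_abs _)
          linarith
    · obtain ⟨i, hi, rfl, h1, -⟩ := exists_of_pathPoint_coord_pos hd hs ha
      obtain ⟨j, hj, rfl, h2, -⟩ := exists_of_pathPoint_coord_pos hd ht hb
      rw [h1, h2, hdist i j hi hj]
      have := neg_le_abs (s - i)
      have := neg_le_abs ((i : ℝ) - j)
      have := le_abs_self (t - j)
      linarith

omit hd in
theorem CayleyPoint.dist_comm' (hL : GeodesicLength (wordLength X)) (p q : CayleyPoint X) :
    dist p q = dist q p := by
  have : ∀ p q : CayleyPoint X, pathLengths p q ⊆ pathLengths q p := by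
    rintro p q x (⟨a, b, ⟨h1, h2⟩, rfl⟩ | ⟨a, b, ha, hb, rfl⟩)
    · exact .inl ⟨a, b, ⟨h1, fun v h3 h4 => (h2 v h3 h4).symm⟩, abs_sub_comm _ _⟩
    · refine .inr ⟨b, a, hb, ha, ?_⟩
      have := hL.dist_comm a b
      unfold gdist at this
      rw [this]; ring
  exact congrArg sInf ((this p q).antisymm (this q p))

theorem isGeodesic_pathPoint (hL : GeodesicLength (wordLength X)) :
    IsGeodesic (pathPoint P hP) l (pathPoint P hP 0) (pathPoint P hP l) := by
  refine ⟨by positivity, rfl, rfl, fun s hs t ht => ?_⟩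
  rcases le_total s t with h | h
  · rw [pathPoint_dist_of_le hd hs ht h hL, abs_sub_comm, abs_of_nonneg (by linarith)]
  · rw [CayleyPoint.dist_comm' hL, pathPoint_dist_of_le hd ht hs h hL, abs_of_nonneg (by linarith)]

omit hd in
/-- A geodesic edge path through a given point between two vertices. -/
theorem exists_path (hL : GeodesicLength (wordLength X)) {a x b : G}
    (hx : Btw (wordLength X) a x b) :
    ∃ P : ℕ → G, (∀ i, EdgeOrVertex X (P i) (P (i + 1))) ∧
      (∀ i j, i ≤ j → j ≤ gdist (wordLength X) a b → gdist (wordLength X) (P i) (P j) = j - i) ∧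
      P 0 = a ∧ P (gdist (wordLength X) a x) = x ∧ P (gdist (wordLength X) a b) = b := by
  obtain ⟨γ, h0, h1, h2⟩ := hL.exists_geodesic a x
  obtain ⟨γ', h0', h1', h2'⟩ := hL.exists_geodesic x b
  set k := gdist (wordLength X) a x
  set k' := gdist (wordLength X) x b
  have hx : k + k' = gdist (wordLength X) a b := hx
  rw [← hx]
  -- Two geodesics joined at `x`. After its end the path waits at `b`, using the degenerate edges of
  -- `EdgeOrVertex`.
  set P : ℕ → G := fun i => if i ≤ k then γ i else γ' (min (i - k) k') with hP
  have hd : ∀ i j, i ≤ j → j ≤ k + k' → gdist (wordLength X) (P i) (P j) = j - i := by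
    intro i j hij hj
    simp only [hP]
    split_ifs with h3 h4 h4
    · exact h2 i j hij h4
    · have e1 := h2' 0 (min (j - k) k') (by omega) (by omega)
      have e2 := h2' (min (j - k) k') k' (by omega) (by omega)
      have e3 := h2 i k h3 le_rfl
      have e4 := h2 0 i (by omega) h3
      have t1 := hL.dist_tri (γ i) x (γ' (min (j - k) k'))
      have t2 := hL.dist_tri a (γ i) b
      have t3 := hL.dist_tri (γ i) (γ' (min (j - k) k')) b
      rw [h0'] at e1
      rw [h1'] at e2
      rw [h1] at e3
      rw [h0] at e4
      omega
    · omega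
    · rw [h2' _ _ (by omega) (by omega)]; omega
  have hPl : P (k + k') = b := by
    simp only [hP]
    split_ifs with h
    · have hk' : k' = 0 := by omega
      rw [hk'] at h1' ⊢
      rw [add_zero, h1, ← h0', h1']
    · rw [add_tsub_cancel_left, min_self, h1']
  refine ⟨P, fun i => ?_, hd, by simp [hP, h0], by simp [hP, h1], hPl⟩
  by_cases hi : i + 1 ≤ k + k'
  · right
    have h3 := hd i (i + 1) (by omega) hi
    have h4 : wordLength X ((P i)⁻¹ * P (i + 1)) = 1 := by
      unfold gdist at h3; omega
    -- The value `1` excludes the default value `0` of the infimum of the empty set.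
    have hne : {n : ℕ | ∃ w : List X, w.length = n ∧ evalWord w = (P i)⁻¹ * P (i + 1)}.Nonempty := by
      by_contra hcon
      rw [Set.not_nonempty_iff_eq_empty] at hcon
      rw [wordLength, hcon] at h4
      simp at h4
    obtain ⟨w, hw1, hw2⟩ := Nat.sInf_mem hne
    change w.length = wordLength X _ at hw1
    rw [h4] at hw1
    obtain ⟨x, rfl⟩ := List.length_eq_one_iff.1 hw1
    rw [← hw2]
    simp [evalWord]
  · left
    have e : ∀ j, k + k' ≤ j → P j = b := by
      intro j hj
      rcases hj.eq_or_lt with rfl | hj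
      · exact hPl
      · simp only [hP]
        rw [if_neg (by omega), min_eq_right (by omega), h1']
    rw [e i (by omega), e (i + 1) (by omega)]

omit hd in
theorem CayleyPoint.ext' {p q : CayleyPoint X} (h : p.coord = q.coord) : p = q := by
  cases p; cases q; congr

omit hd in
/-- Thinness of triangles in the Cayley graph, expressed by the word metric. -/
theorem thinLength_wordLength (hL : GeodesicLength (wordLength X)) {δ : ℝ}
    (hhyp : IsDeltaHyperbolic (CayleyPoint X) δ) : ThinLength (wordLength X) ⌊δ⌋₊ := by
  refine ⟨hL, fun b c g h hg hh hgh ht => ?_⟩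
  have one_dist : ∀ a, gdist (wordLength X) 1 a = wordLength X a := fun a => by simp [gdist]
  have hgb : Btw (wordLength X) 1 g b := by unfold Btw; rw [one_dist, one_dist]; exact hg
  have hhc : Btw (wordLength X) 1 h c := by unfold Btw; rw [one_dist, one_dist]; exact hh
  obtain ⟨P, P1, P2, P3, P4, P5⟩ := exists_path hL hgb
  obtain ⟨Q, Q1, Q2, Q3, Q4, Q5⟩ := exists_path hL hhc
  obtain ⟨R, R1, R2, R3, -, R5⟩ := exists_path hL (a := b) (x := b) (b := c) (by
    unfold Btw; rw [hL.dist_self, zero_add])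
  have vert : ∀ (P Q : ℕ → G) (hP hQ) (i j : ℕ), P i = Q j →
      pathPoint (X := X) P hP i = pathPoint Q hQ j := fun P Q hP hQ i j h =>
    CayleyPoint.ext' (by simp [pathPoint, h])
  have gP := isGeodesic_pathPoint (hP := P1) P2 hL
  have gQ := isGeodesic_pathPoint (hP := Q1) Q2 hL
  have gR := isGeodesic_pathPoint (hP := R1) R2 hL
  have e1 : pathPoint Q Q1 0 = pathPoint P P1 0 := by
    simpa using vert Q P Q1 P1 0 0 (Q3.trans P3.symm)
  have e2 : pathPoint R R1 0 = pathPoint P P1 (gdist (wordLength X) 1 b : ℕ) := by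
    simpa using vert R P R1 P1 0 _ (R3.trans P5.symm)
  have e3 := vert R Q R1 Q1 _ _ (R5.trans Q5.symm)
  have lenDist : ∀ {α : ℝ → CayleyPoint X} {l : ℝ} {x y : CayleyPoint X}, IsGeodesic α l x y →
      dist x y = l := by
    rintro α l x y ⟨h1, rfl, rfl, h2⟩
    rw [h2 0 ⟨le_rfl, h1⟩ l ⟨h1, le_rfl⟩, zero_sub, abs_neg, abs_of_nonneg h1]
  have dP := lenDist gP
  have dQ := lenDist gQ
  have dR := lenDist gR
  rw [e1] at gQ dQ
  rw [e2, e3] at dR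
  have key := hhyp _ _ _ _ _ _ _ gP gQ (wordLength X g) (by positivity) (by
    unfold gromovProd
    rw [CayleyPoint.dist_comm' hL _ (pathPoint P P1 0), dP, CayleyPoint.dist_comm' hL _ (pathPoint P P1 0), dQ, dR, one_dist, one_dist]
    unfold gdist
    have : (2 * wordLength X g + wordLength X (b⁻¹ * c) : ℝ) ≤ wordLength X b + wordLength X c := by
      exact_mod_cast ht
    linarith)
  -- A further geodesic path identifies the distance of the two vertices in the graph with their
  -- word distance. Being an integer at most `δ`, this is at most `⌊δ⌋₊`.
  obtain ⟨S, S1, S2, S3, -, S5⟩ := exists_path hL (a := g) (x := g) (b := h) (by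
    unfold Btw; rw [hL.dist_self, zero_add])
  have gS := lenDist (isGeodesic_pathPoint (hP := S1) S2 hL)
  rw [one_dist] at P4 Q4
  rw [show pathPoint S S1 0 = pathPoint P P1 (wordLength X g : ℕ) by
      simpa using vert S P S1 P1 0 _ (S3.trans P4.symm),
    show pathPoint S S1 (gdist (wordLength X) g h : ℕ) = pathPoint Q Q1 (wordLength X g : ℕ) by
      exact vert S Q S1 Q1 _ _ (S5.trans (by rw [hgh, Q4]))] at gS
  rw [gS] at key
  exact Nat.le_floor key

end Cayley
-- Local geodesics and their finitely many profiles
section Reduction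

variable {G : Type*} [Group G] {X : Finset G}

/-- The group element of a stack of letters (head = top = last letter). -/
def stackVal (S : List X) : G := evalWord S.reverse

theorem stackVal_nil : stackVal ([] : List X) = 1 := rfl

theorem stackVal_append (S T : List X) : stackVal (S ++ T) = stackVal T * stackVal S := by
  simp [stackVal, evalWord_append]

theorem stackVal_cons (x : X) (S : List X) : stackVal (x :: S) = stackVal S * x := by
  simp [stackVal, evalWord_append, evalWord_cons, evalWord_nil]

theorem stackVal_take_drop (S : List X) (m : ℕ) :
    stackVal (S.drop m) * stackVal (S.take m) = stackVal S := by
  rw [← stackVal_append, List.take_append_drop]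

theorem wordLength_stackVal_le (S : List X) : wordLength X (stackVal S) ≤ S.length :=
  (wordLength_le S.reverse).trans (by simp)

/-- All subwords of length at most `K + 1` of the word on the stack are geodesic. -/
def LocGeo (K : ℕ) : List X → Prop
  | [] => True
  | x :: S => LocGeo K S ∧
      wordLength X (stackVal ((x :: S).take (K + 1))) = ((x :: S).take (K + 1)).length

theorem LocGeo.drop {K : ℕ} {S : List X} (h : LocGeo K S) (m : ℕ) : LocGeo K (S.drop m) := by
  induction m generalizing S with
  | zero => simpa using h
  | succ m ih =>
    cases S with
    | nil => simp [LocGeo]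
    | cons x S => exact ih h.1

theorem LocGeo.take (hL : GeodesicLength (wordLength X)) {K : ℕ} {S : List X} (h : LocGeo K S)
    {m : ℕ} (hm : m ≤ K + 1) (hmS : m ≤ S.length) : wordLength X (stackVal (S.take m)) = m := by
  cases S with
  | nil =>
    obtain rfl : m = 0 := by simpa using hmS
    simpa [stackVal_nil] using wordLength_one
  | cons x S =>
    have h1 := h.2
    have h2 := stackVal_take_drop ((x :: S).take (K + 1)) m
    have h3 := hL.mul_le (stackVal (((x :: S).take (K + 1)).drop m))
      (stackVal (((x :: S).take (K + 1)).take m))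
    have h4 := wordLength_stackVal_le (((x :: S).take (K + 1)).drop m)
    have h5 := wordLength_stackVal_le ((x :: S).take m)
    rw [h2] at h3
    rw [List.take_take, min_eq_left hm] at h3
    simp only [List.length_take, List.length_drop, List.length_cons] at *
    omega

variable {D : ℕ} (hL : ThinLength (wordLength X) D)

include hL

/-- The prefixes of the word on the stack form a local geodesic path from `1`, to which
`local_geodesic_step` applies; the prefix of length `i` is what remains after dropping all but `i`
letters. -/
theorem LocGeo.step {S : List X} (h : LocGeo (8 * D + 1) S) (hS : 8 * D + 2 ≤ S.length) {g : G}
    (hg : wordLength X g ≤ 3 * D) :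
    ∃ b, wordLength X b ≤ 3 * D ∧ wordLength X (stackVal S * g) =
      wordLength X (stackVal (S.drop (8 * D + 2)) * b) +
        wordLength X (b⁻¹ * stackVal (S.take (8 * D + 2)) * g) := by
  obtain ⟨b, h1, h2⟩ := hL.local_geodesic_step (c := fun i => stackVal (S.drop (S.length - i)))
    (n := S.length) (m := S.length - (8 * D + 2)) (g := g) (fun i j hij hj hk => by
      have h1 := stackVal_take_drop (S.drop (S.length - j)) (j - i)
      rw [List.drop_drop, show S.length - j + (j - i) = S.length - i by omega] at h1
      unfold gdist
      rw [← h1, inv_mul_cancel_left]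
      exact (h.drop _).take hL.toGeodesicLength (by omega) (by simp; omega))
    (by simp [stackVal_nil]) (by omega) hg
  refine ⟨b, h1, ?_⟩
  simp only [Nat.sub_self, List.drop_zero, show S.length - (S.length - (8 * D + 2)) = 8 * D + 2 by
    omega] at h2
  rw [h2]
  congr 2
  rw [← stackVal_take_drop S (8 * D + 2)]
  simp [mul_assoc]

omit hL in
/-- The lengths of the elements near the top part of the path described by the stack, relative
to the length of the stack. -/
noncomputable def profile (D : ℕ) (S : List X) :
    List X × (Fin (8 * D + 2) → {g : G // wordLength X g ≤ 3 * D} → ℤ) :=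
  (S.take (8 * D + 1), fun i g =>
    (wordLength X (stackVal (S.drop i) * g) : ℤ) - wordLength X (stackVal S))

/-- A geodesic to `stackVal (x :: S) * g` passes through a point `b` near the prefix that lacks the
last `8 * D + 2` letters. The profile records the relative length of that point, and the rest of the
way uses letters common to both stacks. The corresponding route for `T` gives an upper bound. -/
theorem profile_step_aux {S T : List X} {x : X} (h : profile D S = profile D T)
    (hS : LocGeo (8 * D + 1) (x :: S)) (hlen : 8 * D + 1 ≤ S.length)
    {g : G} (hg : wordLength X g ≤ 3 * D) :
    (wordLength X (stackVal (x :: T) * g) : ℤ) - wordLength X (stackVal T) ≤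
      wordLength X (stackVal (x :: S) * g) - wordLength X (stackVal S) := by
  obtain ⟨b, h1, h2⟩ := hS.step hL (by simp; omega) hg
  have h3 := congrFun (congrFun (congrArg Prod.snd h) ⟨8 * D + 1, by omega⟩) ⟨b, h1⟩
  have h4 : S.take (8 * D + 1) = T.take (8 * D + 1) := congrArg Prod.fst h
  simp only [profile] at h3
  have h5 : stackVal (x :: T) * g = stackVal (T.drop (8 * D + 1)) * b *
      (b⁻¹ * stackVal ((x :: S).take (8 * D + 2)) * g) := by
    rw [show (x :: S).take (8 * D + 2) = x :: S.take (8 * D + 1) by simp, h4, stackVal_cons,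
      stackVal_cons, ← stackVal_take_drop T (8 * D + 1)]
    simp [mul_assoc]
  have h6 := hL.mul_le (stackVal (T.drop (8 * D + 1)) * b)
    (b⁻¹ * stackVal ((x :: S).take (8 * D + 2)) * g)
  rw [← h5] at h6
  rw [show (x :: S).drop (8 * D + 2) = S.drop (8 * D + 1) by simp] at h2
  omega

/-- The inequality of `profile_step_aux` holds in both directions. The new profile consists of these
values and of shifted old ones, all corrected by the common change of length. -/
theorem profile_step {S T : List X} {x : X} (h : profile D S = profile D T)
    (hS : LocGeo (8 * D + 1) (x :: S)) (hT : LocGeo (8 * D + 1) (x :: T)) :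
    profile D (x :: S) = profile D (x :: T) ∧
      (wordLength X (stackVal (x :: S)) : ℤ) - wordLength X (stackVal S) =
        wordLength X (stackVal (x :: T)) - wordLength X (stackVal T) := by
  have h4 : S.take (8 * D + 1) = T.take (8 * D + 1) := congrArg Prod.fst h
  -- A window that is not full shows the entire stack.
  have hlen : S.length < 8 * D + 1 ∨ T.length < 8 * D + 1 → S = T := by
    intro h5
    have h6 := congrArg List.length h4
    simp only [List.length_take] at h6
    rwa [List.take_of_length_le (by omega), List.take_of_length_le (by omega)] at h4
  by_cases hST : S.length < 8 * D + 1 ∨ T.length < 8 * D + 1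
  · rw [hlen hST]; exact ⟨rfl, rfl⟩
  push Not at hST
  have key : ∀ g : G, wordLength X g ≤ 3 * D →
      (wordLength X (stackVal (x :: S) * g) : ℤ) - wordLength X (stackVal S) =
        wordLength X (stackVal (x :: T) * g) - wordLength X (stackVal T) := fun g hg =>
    (profile_step_aux hL h.symm hT hST.2 hg).antisymm
      (profile_step_aux hL h hS hST.1 hg)
  have key1 := key 1 (by rw [hL.one]; omega)
  rw [mul_one, mul_one] at key1
  refine ⟨Prod.ext ?_ ?_, key1⟩
  · have := congrArg (List.take (8 * D)) h4
    simpa [profile, List.take_take] using this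
  · funext i g
    simp only [profile]
    obtain ⟨i, hi⟩ := i
    cases i with
    | zero =>
      have := key g g.2
      simp only [List.drop_zero]
      omega
    | succ i =>
      have h3 := congrFun (congrFun (congrArg Prod.snd h) ⟨i, by omega⟩) g
      simp only [profile] at h3
      simp only [List.drop_succ_cons]
      omega

/-- Each entry compares the lengths of two elements at distance at most `(8 * D + 1) + 3 * D`, and
the window is a word of bounded length. -/
theorem profile_finite (hfin : ∀ n, {g : G | wordLength X g ≤ n}.Finite) :
    (Set.range (profile (X := X) D)).Finite := by
  have hfin3 : Finite {g : G // wordLength X g ≤ 3 * D} := (hfin (3 * D)).to_subtype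
  refine ((List.finite_length_le X (8 * D + 1)).prod
    (Set.Finite.pi' (t := fun _ : Fin (8 * D + 2) => {f : {g : G // wordLength X g ≤ 3 * D} → ℤ |
      ∀ g, f g ∈ Set.Icc (-(11 * D + 1 : ℤ)) (11 * D + 1)}) fun _ =>
      Set.Finite.pi' fun _ => Set.finite_Icc _ _)).subset ?_
  rintro _ ⟨S, rfl⟩
  refine ⟨by simp [profile], fun i g => ?_⟩
  have h1 := stackVal_take_drop S i
  have h2 := wordLength_stackVal_le (S.take i)
  have h3 := hL.mul_le (stackVal (S.drop i)) (stackVal (S.take i))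
  have h4 := hL.mul_le (stackVal S) (stackVal (S.take i))⁻¹
  have h5 := hL.mul_le (stackVal (S.drop i)) g
  have h6 := hL.mul_le (stackVal (S.drop i) * g) (g : G)⁻¹
  rw [mul_inv_cancel_right] at h6
  rw [h1] at h3
  rw [← h1, mul_inv_cancel_right, h1] at h4
  rw [hL.inv] at h4 h6
  rw [List.length_take] at h2
  have := g.2
  have := i.2
  simp only [profile, Set.mem_Icc]
  omega

end Reduction

/-! ### A finite table that reduces words to local geodesics -/

section Reducer

variable {G : Type*} [Group G]

/-- A finite table that drives the reduction of words to local geodesics, and that computes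
lengths along the way. -/
structure Reducer (X : Finset G) where
  good : List X → Prop
  stateCount : ℕ
  code : List X → ℕ
  ok : ℕ → X → Prop
  next : ℕ → X → ℕ
  inc : ℕ → X → ℤ
  pops : ℕ → X → ℕ
  back : ℕ → X → List X
  maxPop : ℕ
  code_lt : ∀ S, code S < stateCount
  good_nil : good []
  good_drop : ∀ S n, good S → good (S.drop n)
  push : ∀ S x, good S → ok (code S) x → good (x :: S) ∧ code (x :: S) = next (code S) x ∧
    (wordLength X (stackVal (x :: S)) : ℤ) = wordLength X (stackVal S) + inc (code S) x
  pop : ∀ S x, good S → ¬ ok (code S) x → pops (code S) x ≤ S.length ∧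
    stackVal (S.drop (pops (code S) x)) * evalWord (back (code S) x) = stackVal S * x
  back_le : ∀ q x, (back q x).length ≤ pops q x
  pops_le : ∀ q x, pops q x ≤ maxPop

/-- The states are numbers of profiles. A letter is accepted if it keeps the window geodesic, and
`profile_step` makes the next state and the change of length well defined. Otherwise the whole
window is popped, and a geodesic word for window and letter, with no more letters than the window
had, goes back to the input. -/
theorem exists_reducer {X : Finset G} {D : ℕ} (hinv : ∀ x ∈ X, x⁻¹ ∈ X)
    (hgen : Subgroup.closure (X : Set G) = ⊤) (hL : ThinLength (wordLength X) D)
    (hfin : ∀ n, {g : G | wordLength X g ≤ n}.Finite) : Nonempty (Reducer X) := by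
  classical
  have hfinite := profile_finite hL hfin
  obtain ⟨N, f, hf⟩ : ∃ N : ℕ, ∃ f : List X × (Fin (8 * D + 2) →
      {g : G // wordLength X g ≤ 3 * D} → ℤ) → ℕ, (∀ S, f (profile D S) < N) ∧
      ∀ S T, f (profile D S) = f (profile D T) → profile D S = profile D T := by
    obtain ⟨f, hf⟩ := Set.countable_iff_exists_injOn.1 hfinite.countable
    obtain ⟨N, hN⟩ := (hfinite.image f).bddAbove
    exact ⟨N + 1, f, fun S => Nat.lt_succ_of_le (hN ⟨_, ⟨S, rfl⟩, rfl⟩),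
      fun S T h => hf ⟨S, rfl⟩ ⟨T, rfl⟩ h⟩
  obtain ⟨hf1, hf2⟩ := hf
  -- the window belonging to a state
  have hwin : ∀ q : ℕ, ∃ w : List X, w.length ≤ 8 * D + 1 ∧
      ∀ S, f (profile D S) = q → S.take (8 * D + 1) = w := by
    intro q
    by_cases h : ∃ S, f (profile D S) = q
    · obtain ⟨S, rfl⟩ := h
      exact ⟨S.take (8 * D + 1), by simp, fun T hT => congrArg Prod.fst (hf2 T S hT)⟩
    · exact ⟨[], by simp, fun S hS => absurd ⟨S, hS⟩ h⟩
  choose w hw1 hw2 using hwin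
  have hback : ∀ (q : ℕ) (x : X), ∃ z : List X, z.length ≤ (w q).length ∧
      (wordLength X (stackVal (x :: w q)) ≠ (w q).length + 1 →
        evalWord z = stackVal (w q) * x) := by
    intro q x
    by_cases h : wordLength X (stackVal (x :: w q)) = (w q).length + 1
    · exact ⟨[], by simp, fun h' => absurd h h'⟩
    · obtain ⟨z, hz1, hz2⟩ := exists_geodesic_word hinv hgen (stackVal (x :: w q))
      have := wordLength_stackVal_le (x :: w q)
      simp only [List.length_cons] at this
      exact ⟨z, by omega, fun _ => by rw [hz2, stackVal_cons]⟩
  choose z hz1 hz2 using hback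
  have hnext : ∀ (q : ℕ) (x : X), ∃ p : ℕ × ℤ, ∀ S, f (profile D S) = q →
      LocGeo (8 * D + 1) (x :: S) → f (profile D (x :: S)) = p.1 ∧
        (wordLength X (stackVal (x :: S)) : ℤ) = wordLength X (stackVal S) + p.2 := by
    intro q x
    by_cases h : ∃ S, f (profile D S) = q ∧ LocGeo (8 * D + 1) (x :: S)
    · obtain ⟨T, rfl, hT⟩ := h
      refine ⟨(f (profile D (x :: T)),
        (wordLength X (stackVal (x :: T)) : ℤ) - wordLength X (stackVal T)), fun S h1 h2 => ?_⟩
      obtain ⟨h3, h4⟩ := profile_step hL (hf2 S T h1) h2 hT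
      exact ⟨by rw [h3], by simp only; omega⟩
    · exact ⟨0, fun S h1 h2 => absurd ⟨S, h1, h2⟩ h⟩
  choose p hp using hnext
  refine ⟨{
    good := LocGeo (8 * D + 1)
    stateCount := N
    code := fun S => f (profile D S)
    ok := fun q x => wordLength X (stackVal (x :: w q)) = (w q).length + 1
    next := fun q x => (p q x).1
    inc := fun q x => (p q x).2
    pops := fun q _ => (w q).length
    back := z
    maxPop := 8 * D + 1
    code_lt := hf1
    good_nil := trivial
    good_drop := fun S n h => h.drop n
    push := fun S x hS hok => ?_
    pop := fun S x hS hok => ?_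
    back_le := hz1
    pops_le := fun q _ => hw1 q }⟩
  · have hS' : LocGeo (8 * D + 1) (x :: S) := by
      refine ⟨hS, ?_⟩
      rw [List.take_succ_cons, hw2 _ S rfl]; simpa using hok
    exact ⟨hS', hp _ x S rfl hS'⟩
  · have h1 := hw2 _ S rfl
    have h2 := stackVal_take_drop S (8 * D + 1)
    have h3 := congrArg List.length h1
    rw [List.length_take] at h3
    refine ⟨by omega, ?_⟩
    rw [hz2 _ x hok, ← mul_assoc]
    congr 1
    have h4 : S.drop (w (f (profile D S))).length = S.drop (8 * D + 1) := by
      rcases le_total (8 * D + 1) S.length with h | h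
      · rw [← h3, min_eq_left h]
      · rw [List.drop_of_length_le h, List.drop_of_length_le (by omega)]
    rw [h4, ← h1, h2]

end Reducer
section Machine

/-! ### Running programs -/

@[simp] theorem State.setReg_reg (s : State) (d : ℕ) (c : ℤ) (i : ℕ) :
    (s.setReg d c).reg i = if i = d then c else s.reg i := by
  simp [State.setReg, Function.update_apply]

@[simp] theorem State.setReg_mem (s : State) (d : ℕ) (c : ℤ) : (s.setReg d c).mem = s.mem := rfl

@[simp] theorem State.setMem_reg (s : State) (i c : ℤ) : (s.setMem i c).reg = s.reg := rfl

@[simp] theorem State.setMem_mem (s : State) (i c : ℤ) (j : ℤ) :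
    (s.setMem i c).mem j = if j = i then c else s.mem j := by
  simp [State.setMem, Function.update_apply]

/-- Started in `s`, the program halts within time `T` in a state with the property `Q`. -/
def Steps (P : Prog) (s : State) (T : ℕ) (Q : State → Prop) : Prop :=
  ∃ s' T', Run P s s' T' ∧ T' ≤ T ∧ Q s'

theorem Steps.mono {P : Prog} {s : State} {T T' : ℕ} {Q Q' : State → Prop} (h : Steps P s T Q)
    (hT : T ≤ T') (hQ : ∀ s', Q s' → Q' s') : Steps P s T' Q' := by
  obtain ⟨s', t, h1, h2, h3⟩ := h
  exact ⟨s', t, h1, h2.trans hT, hQ _ h3⟩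

theorem Steps.seq {P P' : Prog} {s : State} {T T' : ℕ} {Q Q' : State → Prop} (h : Steps P s T Q)
    (h' : ∀ s', Q s' → Steps P' s' T' Q') : Steps (.seq P P') s (T + T') Q' := by
  obtain ⟨s', t, h1, h2, h3⟩ := h
  obtain ⟨s'', t', h4, h5, h6⟩ := h' s' h3
  exact ⟨s'', t + t', .seq h1 h4, by omega, h6⟩

/-- Loops, with an invariant `I` that includes a potential that pays for the time. -/
theorem Steps.loop {a : ℕ} {P : Prog} (I : ℕ → State → Prop)
    (body : ∀ n s, I n s → 0 < s.reg a →
      ∃ t, Steps P s t fun s' => ∃ m, I m s' ∧ m + t + 1 ≤ n)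
    {n : ℕ} {s : State} (hs : I n s) :
    Steps (.loop a P) s (n + 1) fun s' => (∃ m, I m s') ∧ ¬ 0 < s'.reg a := by
  induction n using Nat.strong_induction_on generalizing s with
  | _ n ih =>
    by_cases h : 0 < s.reg a
    · obtain ⟨t, s', t', h1, h2, m, h3, h4⟩ := body n s hs h
      obtain ⟨s'', t'', h5, h6, h7⟩ := ih m (by omega) h3
      exact ⟨s'', t' + t'' + 1, .loop_step h h1 h5, by omega, h7⟩
    · exact ⟨s, 1, by constructor; exact h, by omega, ⟨n, hs⟩, h⟩

/-- The effect of a program without loops. -/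
def Prog.exec : Prog → State → State
  | .skip, s => s
  | .const d c, s => s.setReg d c
  | .add d a b, s => s.setReg d (s.reg a + s.reg b)
  | .sub d a b, s => s.setReg d (s.reg a - s.reg b)
  | .load d a, s => s.setReg d (s.mem (s.reg a))
  | .store a b, s => s.setMem (s.reg a) (s.reg b)
  | .seq P Q, s => Q.exec (P.exec s)
  | .branch a P Q, s => if 0 < s.reg a then P.exec s else Q.exec s
  | .loop _ _, s => s

/-- The program has no loops. -/
def Prog.LoopFree : Prog → Prop
  | .seq P Q => P.LoopFree ∧ Q.LoopFree
  | .branch _ P Q => P.LoopFree ∧ Q.LoopFree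
  | .loop _ _ => False
  | _ => True

/-- The number of instructions and tests. -/
def Prog.size : Prog → ℕ
  | .seq P Q => P.size + Q.size
  | .branch _ P Q => P.size + Q.size + 1
  | .loop _ P => P.size + 1
  | _ => 1

theorem Steps.exec {P : Prog} (hP : P.LoopFree) {s : State} {Q : State → Prop} (h : Q (P.exec s)) :
    Steps P s P.size Q := by
  suffices H : ∀ s, Steps P s P.size fun s' => s' = P.exec s from
    (H s).mono le_rfl fun s' hs' => hs' ▸ h
  clear h
  induction P with
  | skip => exact fun s => ⟨_, _, .skip s, le_rfl, rfl⟩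
  | const d c => exact fun s => ⟨_, _, .const s d c, le_rfl, rfl⟩
  | add d a b => exact fun s => ⟨_, _, .add s d a b, le_rfl, rfl⟩
  | sub d a b => exact fun s => ⟨_, _, .sub s d a b, le_rfl, rfl⟩
  | load d a => exact fun s => ⟨_, _, .load s d a, le_rfl, rfl⟩
  | store a b => exact fun s => ⟨_, _, .store s a b, le_rfl, rfl⟩
  | seq P Q ihP ihQ =>
    exact fun s => (ihP hP.1 s).seq fun s' hs' => by
      subst hs'; exact ihQ hP.2 _
  | branch a P Q ihP ihQ =>
    intro s
    by_cases h : 0 < s.reg a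
    · obtain ⟨s', t, h1, h2, rfl⟩ := ihP hP.1 s
      exact ⟨_, _, .branch_pos h h1, by simp only [Prog.size]; omega, by simp [Prog.exec, h]⟩
    · obtain ⟨s', t, h1, h2, rfl⟩ := ihQ hP.2 s
      exact ⟨_, _, .branch_neg h h1, by simp only [Prog.size]; omega, by simp [Prog.exec, h]⟩
  | loop a P => exact hP.elim

/-- Branch on the value of register `r`, which is destroyed. Register `4` has to hold `1`. -/
def Prog.switch (r : ℕ) : ℕ → (ℕ → Prog) → Prog
  | 0, P => P 0
  | n + 1, P => .branch r (.seq (.sub r r 4) (Prog.switch r n fun i => P (i + 1))) (P 0)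

theorem Prog.switch_loopFree {r n : ℕ} {P : ℕ → Prog} (h : ∀ i, (P i).LoopFree) :
    (Prog.switch r n P).LoopFree := by
  induction n generalizing P with
  | zero => exact h 0
  | succ n ih => exact ⟨⟨trivial, ih fun i => h (i + 1)⟩, h 0⟩

theorem Prog.switch_exec {r n : ℕ} (hr : r ≠ 4) {P : ℕ → Prog} {s : State} (h4 : s.reg 4 = 1)
    {v : ℕ} (hv : s.reg r = v) (hvn : v ≤ n) :
    (Prog.switch r n P).exec s = (P v).exec (s.setReg r 0) := by
  induction n generalizing P s v with
  | zero =>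
    obtain rfl : v = 0 := by omega
    have : s.setReg r 0 = s := by
      ext i
      · by_cases h : i = r
        · subst h; simpa using hv.symm
        · simp [h]
      · rfl
    rw [this]; rfl
  | succ n ih =>
    cases v with
    | zero =>
      have : s.setReg r 0 = s := by
        ext i
        · by_cases h : i = r
          · subst h; simpa using hv.symm
          · simp [h]
        · rfl
      rw [this]
      simp [Prog.switch, Prog.exec, hv]
    | succ v =>
      have h1 : 0 < s.reg r := by rw [hv]; positivity
      simp only [Prog.switch, Prog.exec, h1, if_true]
      rw [ih (v := v) (by simp [hr.symm, h4]) (by simp [hv, h4]) (by omega)]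
      congr 1
      ext i
      · simp only [State.setReg_reg]; split_ifs <;> rfl
      · rfl

/-- Straight line programs. -/
def Prog.block : List Prog → Prog
  | [] => .skip
  | P :: l => .seq P (Prog.block l)

/-- The registers `4`, `8`, …, `16` and those from `m` on, and the memory cells from `0` to `b - 1`
are the same in both states. -/
def Keep (m : ℕ) (b : ℤ) (s s' : State) : Prop :=
  (∀ i, (i = 4 ∨ 8 ≤ i ∧ i ≤ 16 ∨ m ≤ i) → s'.reg i = s.reg i) ∧
    ∀ j, 0 ≤ j → j < b → s'.mem j = s.mem j

theorem Keep.refl (m : ℕ) (b : ℤ) (s : State) : Keep m b s s := ⟨fun _ _ => rfl, fun _ _ _ => rfl⟩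

theorem Keep.trans {m : ℕ} {b : ℤ} {s s' s'' : State} (h : Keep m b s s') (h' : Keep m b s' s'') :
    Keep m b s s'' :=
  ⟨fun i hi => (h'.1 i hi).trans (h.1 i hi), fun j h0 hb => (h'.2 j h0 hb).trans (h.2 j h0 hb)⟩

theorem Keep.mono {m m' : ℕ} {b : ℤ} {s s' : State} (h : Keep m b s s') (hm : m ≤ m') :
    Keep m' b s s' :=
  ⟨fun i hi => h.1 i (by omega), h.2⟩

end Machine

/-! ### The reduction as a machine program -/

section Stacks

variable {G : Type*} {X : Finset G} (e : X ≃ Fin X.card)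

/-- The letters of `I` are on a stack in the memory that starts with cell `b`; register `6` points
to the next free cell, and register `7` holds the height of the stack. -/
def HasInput (b : ℤ) (I : List X) (s : State) : Prop :=
  s.reg 6 = b + I.length ∧ s.reg 7 = I.length ∧
    ∀ x T, x :: T <:+ I → s.mem (b + T.length) = (e x : ℕ)

variable {e}

theorem HasInput.congr {b : ℤ} {I : List X} {s s' : State} (h : HasInput e b I s)
    (h6 : s'.reg 6 = s.reg 6) (h7 : s'.reg 7 = s.reg 7)
    (hm : ∀ j, b ≤ j → j < b + I.length → s'.mem j = s.mem j) : HasInput e b I s' := by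
  refine ⟨h6.trans h.1, h7.trans h.2.1, fun x T hT => ?_⟩
  have := hT.length_le
  simp only [List.length_cons] at this
  rw [hm _ (by omega) (by omega)]
  exact h.2.2 x T hT

variable (e)

/-- Push a letter on the input stack. -/
def pushLetter (x : X) : Prog :=
  Prog.block [.const 20 (e x : ℕ), .store 6 20, .add 6 6 4, .add 7 7 4]

theorem pushLetter_exec {b : ℤ} (I : List X) {s : State} (h4 : s.reg 4 = 1)
    (h : HasInput e b I s) (x : X) :
    HasInput e b (x :: I) ((pushLetter e x).exec s) ∧
      (∀ i, i ≠ 6 → i ≠ 7 → i ≠ 20 → ((pushLetter e x).exec s).reg i = s.reg i) ∧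
      ∀ j, j < b → ((pushLetter e x).exec s).mem j = s.mem j := by
  obtain ⟨h6, h7, hm⟩ := h
  refine ⟨⟨?_, ?_, fun z T hT => ?_⟩, fun i h1 h2 h3 => ?_, fun j hj => ?_⟩
  · simp [pushLetter, Prog.block, Prog.exec, h4, h6, add_assoc]
  · simp [pushLetter, Prog.block, Prog.exec, h4, h7]
  · rcases List.suffix_cons_iff.1 hT with h | h
    · obtain ⟨rfl, rfl⟩ := List.cons.inj h
      simp [pushLetter, Prog.block, Prog.exec, h6]
    · have := h.length_le
      simp only [List.length_cons] at this
      have hne : b + (T.length : ℤ) ≠ b + I.length := by omega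
      simpa [pushLetter, Prog.block, Prog.exec, h6, hne] using hm z T h
  · simp [pushLetter, Prog.block, Prog.exec, h1, h2, h3]
  · have hne : j ≠ b + I.length := by omega
    simp [pushLetter, Prog.block, Prog.exec, h6, hne]

/-- Push the letters of a fixed word on the input stack. -/
def pushFixed : List X → Prog
  | [] => .skip
  | x :: l => .seq (pushFixed l) (pushLetter e x)

theorem pushFixed_loopFree (l : List X) : (pushFixed e l).LoopFree := by
  induction l with
  | nil => trivial
  | cons x l ih => exact ⟨ih, by simp [pushLetter, Prog.block, Prog.LoopFree]⟩

theorem pushFixed_exec {b : ℤ} (I : List X) {s : State} (h4 : s.reg 4 = 1)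
    (h : HasInput e b I s) (l : List X) :
    HasInput e b (l ++ I) ((pushFixed e l).exec s) ∧
      (∀ i, i ≠ 6 → i ≠ 7 → i ≠ 20 → ((pushFixed e l).exec s).reg i = s.reg i) ∧
      ∀ j, j < b → ((pushFixed e l).exec s).mem j = s.mem j := by
  induction l with
  | nil => exact ⟨h, fun _ _ _ _ => rfl, fun _ _ => rfl⟩
  | cons x l ih =>
    obtain ⟨h1, h2, h3⟩ := ih
    obtain ⟨h5, h6, h7⟩ := pushLetter_exec e (l ++ I) (s := (pushFixed e l).exec s)
      (by rw [h2 4 (by omega) (by omega) (by omega), h4]) h1 x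
    exact ⟨h5, fun i a b c => (h6 i a b c).trans (h2 i a b c), fun j hj => (h7 j hj).trans (h3 j hj)⟩

/-- Branch on a letter held by register `18`. -/
def switchLetter (P : X → Prog) : Prog :=
  Prog.switch 18 X.card fun i => if h : i < X.card then P (e.symm ⟨i, h⟩) else .skip

theorem switchLetter_loopFree {P : X → Prog} (h : ∀ x, (P x).LoopFree) :
    (switchLetter e P).LoopFree := by
  apply Prog.switch_loopFree
  intro i
  split_ifs
  · exact h _
  · trivial

theorem switchLetter_exec {P : X → Prog} {s : State} (h4 : s.reg 4 = 1) {x : X}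
    (hx : s.reg 18 = (e x : ℕ)) : (switchLetter e P).exec s = (P x).exec (s.setReg 18 0) := by
  rw [switchLetter, Prog.switch_exec (by norm_num) h4 hx (e x).2.le]
  simp

variable [Group G] (R : Reducer X)

/-- The states and lengths belonging to the parts of the stack `S` are stored in the negative memory
cells; register `17` points to the last of them. -/
def HasStack (S : List X) (s : State) : Prop :=
  s.reg 17 = -(2 * S.length + 2) ∧ ∀ T, T <:+ S →
    s.mem (-(2 * T.length + 1)) = R.code T ∧
      s.mem (-(2 * T.length + 2)) = wordLength X (stackVal T)

open Classical in
/-- The reaction to the letter `x` in state `q`. -/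
noncomputable def reduceAction (q : ℕ) (x : X) : Prog :=
  if R.ok q x then
    Prog.block [.load 21 17, .const 20 (R.inc q x), .add 21 21 20, .const 20 2, .sub 17 17 20,
      .store 17 21, .add 20 17 4, .const 21 (R.next q x), .store 20 21]
  else
    .seq (Prog.block [.const 20 (2 * R.pops q x : ℕ), .add 17 17 20]) (pushFixed e (R.back q x))

/-- Treat the next letter of the input. -/
noncomputable def reduceStep : Prog :=
  .seq (Prog.block [.sub 6 6 4, .sub 7 7 4, .load 18 6, .add 20 17 4, .load 19 20])
    (Prog.switch 19 R.stateCount fun q => switchLetter e (reduceAction e R q))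

theorem reduceStep_loopFree : (reduceStep e R).LoopFree := by
  refine ⟨by simp [Prog.block, Prog.LoopFree], Prog.switch_loopFree fun q =>
    switchLetter_loopFree e fun x => ?_⟩
  unfold reduceAction
  split_ifs
  · simp [Prog.block, Prog.LoopFree]
  · exact ⟨by simp [Prog.block, Prog.LoopFree], pushFixed_loopFree e _⟩

/-- The potential that bounds the number of reduction steps. -/
def potential (S I : List X) : ℕ := R.maxPop * (S.length + I.length) + I.length

/-- An accepted letter moves from input to stack, which lowers the second term of `potential`. A
rejected letter lowers the total number of letters by at least one; the factor `maxPop` pays for the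
letters that return to the input. -/
theorem reduceStep_spec {b : ℤ} (hb : 0 ≤ b) {S I : List X} {x : X} {s : State} (h4 : s.reg 4 = 1)
    (hI : HasInput e b (x :: I) s) (hS : HasStack R S s) (hgood : R.good S) :
    ∃ S' I', HasInput e b I' ((reduceStep e R).exec s) ∧ HasStack R S' ((reduceStep e R).exec s) ∧
      R.good S' ∧ stackVal S' * evalWord I' = stackVal S * evalWord (x :: I) ∧
      potential R S' I' < potential R S (x :: I) ∧ Keep 26 b s ((reduceStep e R).exec s) := by
  obtain ⟨h17, hmS⟩ := hS
  obtain ⟨h6, h7, hmI⟩ := hI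
  have hcode := hmS S List.suffix_rfl
  have hx := hmI x I List.suffix_rfl
  set s1 := (Prog.block [.sub 6 6 4, .sub 7 7 4, .load 18 6, .add 20 17 4, .load 19 20]).exec s
    with hs1
  have e6 : s1.reg 6 = b + I.length := by
    simp [hs1, Prog.block, Prog.exec, h4, h6]; ring
  have e7 : s1.reg 7 = I.length := by
    simp [hs1, Prog.block, Prog.exec, h4, h7]
  have e17 : s1.reg 17 = -(2 * S.length + 2) := by
    simp [hs1, Prog.block, Prog.exec, h17]
  have e18 : s1.reg 18 = (e x : ℕ) := by
    simp only [hs1, Prog.block, Prog.exec, State.setReg_reg, State.setReg_mem]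
    simp only [Nat.reduceEqDiff, if_true, if_false]
    rw [← hx]; congr 1
  have e19 : s1.reg 19 = R.code S := by
    simp only [hs1, Prog.block, Prog.exec, State.setReg_reg, State.setReg_mem]
    simp only [Nat.reduceEqDiff, if_true, if_false]
    rw [← hcode.1]; congr 1; rw [h17, h4]; ring
  have emem : s1.mem = s.mem := by simp [hs1, Prog.block, Prog.exec]
  have ereg : ∀ i, i ≠ 6 → i ≠ 7 → i ≠ 18 → i ≠ 19 → i ≠ 20 → s1.reg i = s.reg i := by
    intro i a1 a2 a3 a4 a5
    simp [hs1, Prog.block, Prog.exec, a1, a2, a3, a4, a5]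
  have e4 : s1.reg 4 = 1 := by rw [ereg 4] <;> simp [h4]
  have hexec : (reduceStep e R).exec s =
      (reduceAction e R (R.code S) x).exec ((s1.setReg 19 0).setReg 18 0) := by
    change (Prog.switch 19 R.stateCount _).exec s1 = _
    rw [Prog.switch_exec (by norm_num) e4 e19 (R.code_lt S).le,
      switchLetter_exec e (by simp [e4]) (x := x) (by simp [e18])]
  rw [hexec]
  set s2 := (s1.setReg 19 0).setReg 18 0 with hs2
  have f6 : s2.reg 6 = b + I.length := by simp [hs2, e6]
  have f7 : s2.reg 7 = I.length := by simp [hs2, e7]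
  have f17 : s2.reg 17 = -(2 * S.length + 2) := by simp [hs2, e17]
  have f4 : s2.reg 4 = 1 := by simp [hs2, e4]
  have fmem : s2.mem = s.mem := by simp [hs2, emem]
  have freg : ∀ i, i ≠ 6 → i ≠ 7 → i ≠ 18 → i ≠ 19 → i ≠ 20 → s2.reg i = s.reg i := by
    intro i a1 a2 a3 a4 a5
    simp [hs2, a3, a4, ereg i a1 a2 a3 a4 a5]
  have fI : HasInput e b I s2 := ⟨f6, f7, fun z T hT => by
    rw [fmem]; exact hmI z T (hT.trans (List.suffix_cons _ _))⟩
  clear_value s1 s2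
  by_cases hok : R.ok (R.code S) x
  · obtain ⟨p1, p2, p3⟩ := R.push S x hgood hok
    refine ⟨x :: S, I, ?_, ?_, p1, by rw [stackVal_cons, evalWord_cons, mul_assoc], ?_, ?_⟩
    · refine fI.congr ?_ ?_ ?_
      · simp [reduceAction, hok, Prog.block, Prog.exec]
      · simp [reduceAction, hok, Prog.block, Prog.exec]
      · intro j hj _
        have a1 : j ≠ s2.reg 17 - 2 := by rw [f17]; omega
        have a2 : j ≠ s2.reg 17 - 2 + s2.reg 4 := by rw [f17, f4]; omega
        simp [reduceAction, hok, Prog.block, Prog.exec, a1, a2]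
    · refine ⟨?_, fun T hT => ?_⟩
      · simp [reduceAction, hok, Prog.block, Prog.exec, f17]; ring
      · rcases List.suffix_cons_iff.1 hT with rfl | hT
        · constructor
          · have a1 : (-(2 * ((x :: S).length : ℤ) + 1)) = s2.reg 17 - 2 + s2.reg 4 := by
              rw [f17, f4]; push_cast [List.length_cons]; ring
            rw [a1, p2]
            simp [reduceAction, hok, Prog.block, Prog.exec]
          · have a1 : (-(2 * ((x :: S).length : ℤ) + 2)) = s2.reg 17 - 2 := by
              rw [f17]; push_cast [List.length_cons]; ring
            rw [a1, p3, ← hcode.2, ← fmem, ← f17]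
            simp [reduceAction, hok, Prog.block, Prog.exec, f4]
        · have := hT.length_le
          rw [← (hmS T hT).1, ← (hmS T hT).2, ← fmem]
          have a1 : (-(2 * (T.length : ℤ) + 1)) ≠ s2.reg 17 - 2 := by rw [f17]; omega
          have a2 : (-(2 * (T.length : ℤ) + 1)) ≠ s2.reg 17 - 2 + s2.reg 4 := by
            rw [f17, f4]; omega
          have a3 : (-(2 * (T.length : ℤ) + 2)) ≠ s2.reg 17 - 2 := by rw [f17]; omega
          have a4 : (-(2 * (T.length : ℤ) + 2)) ≠ s2.reg 17 - 2 + s2.reg 4 := by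
            rw [f17, f4]; omega
          simp only [reduceAction, hok, Prog.block, Prog.exec, State.setReg_reg, State.setReg_mem,
            State.setMem_reg, State.setMem_mem, if_true, if_false,
            Nat.reduceEqDiff, a1, a2, a3, a4, and_self]
    · simp only [potential, List.length_cons]
      rw [show S.length + 1 + I.length = S.length + (I.length + 1) by omega]; omega
    · constructor
      · intro i hi
        rw [← freg i (by omega) (by omega) (by omega) (by omega) (by omega)]
        have a1 : i ≠ 17 := by omega
        have a2 : i ≠ 20 := by omega
        have a3 : i ≠ 21 := by omega
        simp [reduceAction, hok, Prog.block, Prog.exec, a1, a2, a3]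
      · intro j hj _
        have a1 : j ≠ s2.reg 17 - 2 := by rw [f17]; omega
        have a2 : j ≠ s2.reg 17 - 2 + s2.reg 4 := by rw [f17, f4]; omega
        simp [reduceAction, hok, Prog.block, Prog.exec, a1, a2, fmem]
  · obtain ⟨p1, p2⟩ := R.pop S x hgood hok
    set d := R.pops (R.code S) x with hd
    set z := R.back (R.code S) x with hz
    have hzd : z.length ≤ d := R.back_le _ _
    have hdm : d ≤ R.maxPop := R.pops_le _ _
    set s3 := (Prog.block [.const 20 (2 * d : ℕ), .add 17 17 20]).exec s2 with hs3
    have g17 : s3.reg 17 = -(2 * S.length + 2) + 2 * d := by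
      simp [hs3, Prog.block, Prog.exec, f17]
    have gmem : s3.mem = s.mem := by simp [hs3, Prog.block, Prog.exec, fmem]
    have greg : ∀ i, i ≠ 17 → i ≠ 20 → s3.reg i = s2.reg i := by
      intro i a1 a2
      simp [hs3, Prog.block, Prog.exec, a1, a2]
    have hact : (reduceAction e R (R.code S) x).exec s2 = (pushFixed e z).exec s3 := by
      rw [reduceAction, if_neg hok]; rfl
    have gI : HasInput e b I s3 := fI.congr (greg _ (by norm_num) (by norm_num))
      (greg _ (by norm_num) (by norm_num)) fun j _ _ => by rw [gmem, fmem]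
    obtain ⟨k1, k2, k3⟩ := pushFixed_exec e I (by rw [greg 4 (by norm_num) (by norm_num), f4]) gI z
    rw [hact]
    -- Popping only moves the pointer, since the entries for all shorter parts of the stack are
    -- still in memory.
    refine ⟨S.drop d, z ++ I, k1, ⟨?_, fun T hT => ?_⟩, R.good_drop S d hgood, ?_, ?_, ?_, ?_⟩
    · rw [k2 17 (by norm_num) (by norm_num) (by norm_num), g17, List.length_drop,
        Nat.cast_sub p1]; ring
    · rw [k3 _ (by omega), k3 _ (by omega), gmem]
      exact hmS T (hT.trans (List.drop_suffix _ _))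
    · rw [evalWord_append, ← mul_assoc, p2, evalWord_cons, mul_assoc]
    · simp only [potential, List.length_drop, List.length_append, List.length_cons]
      have h1 : S.length - d + (z.length + I.length) + 1 ≤ S.length + (I.length + 1) := by omega
      have h2 := Nat.mul_le_mul_left R.maxPop h1
      rw [mul_add, mul_one] at h2
      omega
    · intro i hi
      rw [k2 i (by omega) (by omega) (by omega), greg i (by omega) (by omega),
        freg i (by omega) (by omega) (by omega) (by omega) (by omega)]
    · intro j _ hj
      rw [k3 j hj, gmem]

/-- Compute the length of the element that is represented by the input; the result is left in
register `25`. -/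
noncomputable def reduceProg : Prog :=
  .seq (Prog.block [.const 17 (-1), .const 20 (R.code []), .store 17 20, .const 17 (-2),
    .const 20 0, .store 17 20])
  (.seq (.loop 7 (reduceStep e R)) (.load 25 17))

/-- The product of stack and input is invariant, so once the input is empty the length stored at the
top of the stack is the one sought. The initial potential is `(maxPop + 1) * I.length`. -/
theorem reduceProg_spec {b : ℤ} (hb : 0 ≤ b) {I : List X} {s : State} (h4 : s.reg 4 = 1)
    (hI : HasInput e b I s) :
    Steps (reduceProg e R) s (((reduceStep e R).size + 1) * ((R.maxPop + 1) * I.length) + 9)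
      fun s' => s'.reg 25 = wordLength X (evalWord I) ∧ Keep 26 b s s' := by
  set s1 := (Prog.block [.const 17 (-1), .const 20 (R.code []), .store 17 20, .const 17 (-2),
    .const 20 0, .store 17 20]).exec s with hs1
  have hm : ∀ j, 0 ≤ j → s1.mem j = s.mem j := fun j hj => by
    have a1 : j ≠ -1 := by omega
    have a2 : j ≠ -2 := by omega
    simp [hs1, Prog.block, Prog.exec, a1, a2]
  have c1 : Keep 26 b s s1 := by
    refine ⟨fun i hi => ?_, fun j h0 _ => hm j h0⟩
    have a1 : i ≠ 17 := by omega
    have a2 : i ≠ 20 := by omega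
    simp [hs1, Prog.block, Prog.exec, a1, a2]
  have c2 : HasInput e b I s1 := hI.congr (by simp [hs1, Prog.block, Prog.exec])
    (by simp [hs1, Prog.block, Prog.exec]) fun j hj _ => hm j (by omega)
  have c3 : HasStack R [] s1 := by
    refine ⟨by simp [hs1, Prog.block, Prog.exec], fun T hT => ?_⟩
    obtain rfl := List.suffix_nil.1 hT
    simp [hs1, Prog.block, Prog.exec, stackVal_nil, wordLength_one]
  refine Steps.mono (T := 7 + (((reduceStep e R).size + 1) * ((R.maxPop + 1) * I.length) + 1 + 1))
    ?_ (by omega) fun s' h => h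
  refine Steps.seq (Q := fun s' => s' = s1) (Steps.exec (by simp [Prog.block, Prog.LoopFree]) rfl)
    fun s' hs' => ?_
  subst hs'
  refine Steps.seq (Steps.loop (fun n s' => ∃ S I', HasInput e b I' s' ∧ HasStack R S s' ∧
    R.good S ∧ stackVal S * evalWord I' = evalWord I ∧
    ((reduceStep e R).size + 1) * potential R S I' ≤ n ∧ Keep 26 b s s') ?_ ?_) ?_
  · rintro n s' ⟨S, I', h1, h2, h3, h5, h6, h7⟩ hpos
    have h4' : s'.reg 4 = 1 := by rw [h7.1 4 (by omega), h4]
    cases I' with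
    | nil => rw [h1.2.1] at hpos; simp at hpos
    | cons x I' =>
      obtain ⟨S', J, k1, k2, k3, k4, k5, k6⟩ := reduceStep_spec e R hb h4' h1 h2 h3
      refine ⟨(reduceStep e R).size, Steps.exec (reduceStep_loopFree e R)
        ⟨((reduceStep e R).size + 1) * potential R S' J,
          ⟨S', J, k1, k2, k3, k4.trans h5, le_rfl, h7.trans k6⟩, ?_⟩⟩
      have := Nat.mul_le_mul_left ((reduceStep e R).size + 1) (Nat.succ_le_of_lt k5)
      rw [Nat.succ_eq_add_one, mul_add, mul_one] at this
      omega
  · refine ⟨[], I, c2, c3, R.good_nil, by rw [stackVal_nil, one_mul], le_of_eq ?_, c1⟩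
    simp only [potential, List.length_nil]
    ring
  · rintro s' ⟨⟨n, S, I', h1, h2, -, h5, -, h7⟩, hpos⟩
    refine Steps.exec (P := .load 25 17) trivial ?_
    cases I' with
    | nil =>
      rw [evalWord_nil, mul_one] at h5
      refine ⟨?_, h7.trans ⟨fun i hi => ?_, fun _ _ _ => rfl⟩⟩
      · have := (h2.2 S List.suffix_rfl).2
        simp only [Prog.exec, State.setReg_reg, if_true]
        rw [h2.1, this, h5]
      · have a1 : i ≠ 25 := by omega
        simp [Prog.exec, a1]
    | cons x I' => rw [h1.2.1] at hpos; simp at hpos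

end Stacks
-- Writing the product to be measured on the input stack
section Pushing

variable {G : Type*} {X : Finset G} {e : X ≃ Fin X.card}

theorem HasInput.push {b : ℤ} {I : List X} {s s' : State} (h : HasInput e b I s) {x : X}
    (h6 : s'.reg 6 = s.reg 6 + 1) (h7 : s'.reg 7 = s.reg 7 + 1)
    (hx : s'.mem (s.reg 6) = (e x : ℕ)) (hm : ∀ j, j ≠ s.reg 6 → s'.mem j = s.mem j) :
    HasInput e b (x :: I) s' := by
  obtain ⟨k6, k7, km⟩ := h
  refine ⟨?_, ?_, fun z T hT => ?_⟩
  · rw [h6, k6]; push_cast [List.length_cons]; ring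
  · rw [h7, k7]; push_cast [List.length_cons]; ring
  · rcases List.suffix_cons_iff.1 hT with h | h
    · obtain ⟨rfl, rfl⟩ := List.cons.inj h
      rw [← k6, hx]
    · have := h.length_le
      simp only [List.length_cons] at this
      rw [hm _ (by omega)]
      exact km z T h

variable (e)

/-- The letters of `w` are in the memory cells from `off` on. -/
def WordAt (mem : ℤ → ℤ) (off : ℤ) (w : List X) : Prop :=
  ∀ w₁ x w₂, w = w₁ ++ x :: w₂ → mem (off + w₁.length) = (e x : ℕ)

/-- The memory cells below `b` hold four words `W i`; their positions and lengths are in the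
registers `8`, …, `15`. Register `4` holds `1`, and register `16` holds `b`. -/
structure Env (W : Fin 4 → List X) (b : ℤ) (s : State) : Prop where
  one : s.reg 4 = 1
  base : s.reg 16 = b
  nonneg : 0 ≤ b
  word : ∀ i : Fin 4, ∃ off, 0 ≤ off ∧ off + (W i).length ≤ b ∧ s.reg (8 + 2 * i) = off ∧
    s.reg (9 + 2 * i) = (W i).length ∧ WordAt e s.mem off (W i)

variable {e} {W : Fin 4 → List X} {b : ℤ}

theorem Env.keep {s s' : State} (h : Env e W b s) {m : ℕ} (hk : Keep m b s s') : Env e W b s' := by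
  refine ⟨by rw [hk.1 4 (by omega), h.one], by rw [hk.1 16 (by omega), h.base], h.nonneg,
    fun i => ?_⟩
  obtain ⟨off, h1, h2, h3, h4, h5⟩ := h.word i
  have := i.2
  refine ⟨off, h1, h2, by rw [hk.1 _ (by omega), h3], by rw [hk.1 _ (by omega), h4], ?_⟩
  intro w₁ x w₂ hw
  have hlen := congrArg List.length hw
  simp only [List.length_append, List.length_cons] at hlen
  rw [hk.2 _ (by omega) (by omega)]
  exact h5 w₁ x w₂ hw

/-- Push the word number `i` on the input stack. -/
def pushWord (i : ℕ) : Prog :=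
  .seq (Prog.block [.add 22 (8 + 2 * i) (9 + 2 * i), .const 20 0, .add 23 (9 + 2 * i) 20])
    (.loop 23 (Prog.block [.sub 22 22 4, .load 18 22, .store 6 18, .add 6 6 4, .add 7 7 4,
      .sub 23 23 4]))

theorem pushWord_spec (i : Fin 4) {I : List X} {s : State} (hs : Env e W b s)
    (hI : HasInput e b I s) :
    Steps (pushWord i) s (8 * (W i).length + 5) fun s' =>
      HasInput e b (W i ++ I) s' ∧ Keep 24 b s s' := by
  obtain ⟨off, h1, h2, h3, h4, h5⟩ := hs.word i
  have hi := i.2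
  set s1 := (Prog.block [.add 22 (8 + 2 * i) (9 + 2 * i), .const 20 0,
    .add 23 (9 + 2 * i) 20]).exec s with hs1
  have c0 : s1.mem = s.mem := by simp [hs1, Prog.block, Prog.exec]
  have cr : ∀ r, r ≠ 20 → r ≠ 22 → r ≠ 23 → s1.reg r = s.reg r := fun r a1 a2 a3 => by
    simp [hs1, Prog.block, Prog.exec, a1, a2, a3]
  have c1 : Keep 24 b s s1 := by
    refine ⟨fun r hr => cr r (by omega) (by omega) (by omega), fun j h0 _ => by rw [c0]⟩
  have c22 : s1.reg 22 = off + (W i).length := by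
    simp [hs1, Prog.block, Prog.exec, h3, h4]
  have c23 : s1.reg 23 = (W i).length := by
    have a1 : 9 + 2 * (i : ℕ) ≠ 20 := by omega
    have a2 : 9 + 2 * (i : ℕ) ≠ 22 := by omega
    simp [hs1, Prog.block, Prog.exec, h4, a1, a2]
  have c2 : HasInput e b I s1 := hI.congr (cr 6 (by omega) (by omega) (by omega))
    (cr 7 (by omega) (by omega) (by omega)) fun j _ _ => by rw [c0]
  refine Steps.mono (T := 4 + (8 * (W i).length + 1)) ?_ (by omega) fun _ h => h
  refine Steps.seq (Q := fun s' => s' = s1) (Steps.exec (by simp [Prog.block, Prog.LoopFree]) rfl)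
    fun s' hs' => ?_
  subst hs'
  refine Steps.mono (Steps.loop (fun n s' => ∃ w₁ w₂, W i = w₁ ++ w₂ ∧
    s'.reg 22 = off + w₁.length ∧ s'.reg 23 = w₁.length ∧ HasInput e b (w₂ ++ I) s' ∧
    8 * w₁.length ≤ n ∧ Keep 24 b s s') ?_ (n := 8 * (W i).length)
    ⟨W i, [], by simp, c22, c23, c2, le_rfl, c1⟩) le_rfl ?_
  · rintro n t ⟨w₁, w₂, k1, k2, k3, k4, k5, k6⟩ hpos
    rcases List.eq_nil_or_concat w₁ with rfl | ⟨w, x, rfl⟩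
    · rw [k3] at hpos; simp at hpos
    have e4 : t.reg 4 = 1 := (hs.keep k6).one
    have hx := h5 w x w₂ (by rw [k1]; simp)
    have hlen := congrArg List.length k1
    simp only [List.concat_eq_append, List.length_append, List.length_singleton] at *
    have h22 : t.reg 22 - t.reg 4 = off + w.length := by rw [k2, e4]; push_cast; ring
    have hmx : t.mem (off + w.length) = (e x : ℕ) := by
      rw [← hx]; exact k6.2 _ (by omega) (by omega)
    have h6 : t.reg 6 = b + (w₂ ++ I).length := k4.1
    refine ⟨7, Steps.exec (P := Prog.block [.sub 22 22 4, .load 18 22, .store 6 18, .add 6 6 4,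
      .add 7 7 4, .sub 23 23 4]) (by simp [Prog.block, Prog.LoopFree])
      ⟨8 * w.length, ⟨w, x :: w₂, by rw [k1]; simp, ?_, ?_, ?_, le_rfl, k6.trans ?_⟩, by omega⟩⟩
    · simp only [Prog.block, Prog.exec, State.setReg_reg, State.setMem_reg, Nat.reduceEqDiff,
        if_true, if_false]
      exact h22
    · simp only [Prog.block, Prog.exec, State.setReg_reg, State.setMem_reg, Nat.reduceEqDiff,
        if_true, if_false]
      rw [k3, e4]; push_cast; ring
    · refine k4.push (x := x) ?_ ?_ ?_ ?_
      · simp [Prog.block, Prog.exec, e4]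
      · simp [Prog.block, Prog.exec, e4]
      · simp only [Prog.block, Prog.exec, State.setReg_reg, State.setReg_mem, State.setMem_reg,
          State.setMem_mem, Nat.reduceEqDiff, if_true, if_false]
        rw [h22, hmx]
      · intro j hj
        simp [Prog.block, Prog.exec, hj]
    · refine ⟨fun r hr => ?_, fun j h0 hb => ?_⟩
      · have a1 : r ≠ 6 := by omega
        have a2 : r ≠ 7 := by omega
        have a3 : r ≠ 18 := by omega
        have a4 : r ≠ 22 := by omega
        have a5 : r ≠ 23 := by omega
        simp [Prog.block, Prog.exec, a1, a2, a3, a4, a5]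
      · have a1 : j ≠ t.reg 6 := by omega
        simp [Prog.block, Prog.exec, a1]
  · rintro t ⟨⟨n, w₁, w₂, k1, k2, k3, k4, k5, k6⟩, hpos⟩
    rw [k3] at hpos
    obtain rfl : w₁ = [] := List.length_eq_zero_iff.1 (by omega)
    rw [k1]
    exact ⟨k4, k6⟩

variable [Group G] (hinv : ∀ x ∈ X, x⁻¹ ∈ X)

variable (e) in
/-- Push the inverse of the word number `i` on the input stack. -/
def pushWordInv (i : ℕ) : Prog :=
  .seq (Prog.block [.const 20 0, .add 22 (8 + 2 * i) 20, .add 23 (9 + 2 * i) 20])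
    (.loop 23 (.seq (.load 18 22) (.seq
      (switchLetter e fun x => pushLetter e ⟨(x : G)⁻¹, hinv x x.2⟩)
      (Prog.block [.add 22 22 4, .sub 23 23 4]))))

/-- Reading the word from its front while the stack grows at its head reverses the order of the
letters, as inversion requires. -/
theorem pushWordInv_spec (i : Fin 4) {I : List X} {s : State} (hs : Env e W b s)
    (hI : HasInput e b I s) :
    Steps (pushWordInv e hinv i) s ((pushWordInv e hinv i).size * ((W i).length + 1)) fun s' =>
      ∃ J, J.length = (W i).length ∧ evalWord J = (evalWord (W i))⁻¹ ∧
        HasInput e b (J ++ I) s' ∧ Keep 24 b s s' := by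
  obtain ⟨off, h1, h2, h3, h4, h5⟩ := hs.word i
  have hi := i.2
  set s1 := (Prog.block [.const 20 0, .add 22 (8 + 2 * i) 20,
    .add 23 (9 + 2 * i) 20]).exec s with hs1
  have c0 : s1.mem = s.mem := by simp [hs1, Prog.block, Prog.exec]
  have cr : ∀ r, r ≠ 20 → r ≠ 22 → r ≠ 23 → s1.reg r = s.reg r := fun r a1 a2 a3 => by
    simp [hs1, Prog.block, Prog.exec, a1, a2, a3]
  have c1 : Keep 24 b s s1 := by
    refine ⟨fun r hr => cr r (by omega) (by omega) (by omega), fun j h0 _ => by rw [c0]⟩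
  have c22 : s1.reg 22 = off := by
    have a1 : 8 + 2 * (i : ℕ) ≠ 20 := by omega
    simp [hs1, Prog.block, Prog.exec, h3, a1]
  have c23 : s1.reg 23 = (W i).length := by
    have a1 : 9 + 2 * (i : ℕ) ≠ 20 := by omega
    have a2 : 9 + 2 * (i : ℕ) ≠ 22 := by omega
    simp [hs1, Prog.block, Prog.exec, h4, a1, a2]
  have c2 : HasInput e b I s1 := hI.congr (cr 6 (by omega) (by omega) (by omega))
    (cr 7 (by omega) (by omega) (by omega)) fun j _ _ => by rw [c0]
  set step : Prog := .seq (.load 18 22) (.seq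
      (switchLetter e fun x => pushLetter e ⟨(x : G)⁻¹, hinv x x.2⟩)
      (Prog.block [.add 22 22 4, .sub 23 23 4])) with hstep
  have hfree : step.LoopFree := ⟨trivial, switchLetter_loopFree e fun x => by
    simp [pushLetter, Prog.block, Prog.LoopFree], by simp [Prog.block, Prog.LoopFree]⟩
  have hsize : (pushWordInv e hinv i).size = 4 + (step.size + 1) := rfl
  refine Steps.mono (T := 4 + ((step.size + 1) * (W i).length + 1)) ?_ (by
    have := Nat.mul_le_mul_right (W i).length (show step.size + 1 ≤ 4 + (step.size + 1) by omega)
    rw [hsize, mul_add, mul_one]; omega) fun _ h => h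
  refine Steps.seq (Q := fun s' => s' = s1) (Steps.exec (by simp [Prog.block, Prog.LoopFree]) rfl)
    fun s' hs' => ?_
  subst hs'
  refine Steps.mono (Steps.loop (fun n s' => ∃ w₁ w₂ J, W i = w₁ ++ w₂ ∧
    s'.reg 22 = off + w₁.length ∧ s'.reg 23 = w₂.length ∧ HasInput e b (J ++ I) s' ∧
    J.length = w₁.length ∧ evalWord J = (evalWord w₁)⁻¹ ∧
    (step.size + 1) * w₂.length ≤ n ∧ Keep 24 b s s') ?_ (n := (step.size + 1) * (W i).length)
    ⟨[], W i, [], by simp, by simpa using c22, c23, c2, rfl, by simp [evalWord_nil], le_rfl, c1⟩)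
    le_rfl ?_
  · rintro n t ⟨w₁, w₂, J, k1, k2, k3, k4, k5, k6, k7, k8⟩ hpos
    cases w₂ with
    | nil => rw [k3] at hpos; simp at hpos
    | cons x w₂ =>
    have e4 : t.reg 4 = 1 := (hs.keep k8).one
    have hx := h5 w₁ x w₂ k1
    have hlen := congrArg List.length k1
    simp only [List.length_append, List.length_cons] at *
    have hmx : t.mem (t.reg 22) = (e x : ℕ) := by
      rw [← hx, k2]; exact k8.2 _ (by omega) (by omega)
    set t1 := (t.setReg 18 (t.mem (t.reg 22))).setReg 18 0 with ht1
    have r1 : ∀ r, r ≠ 18 → t1.reg r = t.reg r := fun r hr => by simp [ht1, hr]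
    have hI1 : HasInput e b (J ++ I) t1 := k4.congr (r1 6 (by omega)) (r1 7 (by omega))
      fun _ _ _ => rfl
    obtain ⟨l1, l2, l3⟩ := pushLetter_exec e (J ++ I) (by rw [r1 4 (by omega), e4]) hI1
      ⟨(x : G)⁻¹, hinv x x.2⟩
    set t2 := (pushLetter e ⟨(x : G)⁻¹, hinv x x.2⟩).exec t1 with ht2
    have hexec : step.exec t = (Prog.block [.add 22 22 4, .sub 23 23 4]).exec t2 := by
      simp only [hstep, Prog.exec]
      rw [switchLetter_exec e (by simp [e4]) (x := x) (by simp [hmx])]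
    have r2 : ∀ r, r ≠ 6 → r ≠ 7 → r ≠ 18 → r ≠ 20 → t2.reg r = t.reg r := fun r a1 a2 a3 a4 =>
      (l2 r a1 a2 a4).trans (r1 r a3)
    have e4' : t2.reg 4 = 1 := by rw [r2 4, e4] <;> omega
    refine ⟨step.size, Steps.exec hfree
      ⟨(step.size + 1) * w₂.length, ⟨w₁ ++ [x], w₂, ⟨(x : G)⁻¹, hinv x x.2⟩ :: J, by simp [k1],
        ?_, ?_, ?_, by simp [k5], ?_, le_rfl, k8.trans ?_⟩, ?_⟩⟩
    · rw [hexec]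
      simp only [Prog.block, Prog.exec, State.setReg_reg, Nat.reduceEqDiff, if_true, if_false, e4']
      rw [r2 22 (by omega) (by omega) (by omega) (by omega), k2]; push_cast [List.length_append, List.length_singleton]; ring
    · rw [hexec]
      simp only [Prog.block, Prog.exec, State.setReg_reg, Nat.reduceEqDiff, if_true, if_false, e4']
      rw [r2 23 (by omega) (by omega) (by omega) (by omega), k3]; push_cast; ring
    · rw [hexec]
      exact l1.congr (by simp [Prog.block, Prog.exec]) (by simp [Prog.block, Prog.exec])
        fun _ _ _ => by simp [Prog.block, Prog.exec]
    · rw [evalWord_cons, evalWord_append, evalWord_cons, evalWord_nil, k6]; simp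
    · rw [hexec]
      refine ⟨fun r hr => ?_, fun j h0 hb => ?_⟩
      · have a4 : r ≠ 22 := by omega
        have a5 : r ≠ 23 := by omega
        simp only [Prog.block, Prog.exec, State.setReg_reg, a4, a5, if_false]
        exact r2 r (by omega) (by omega) (by omega) (by omega)
      · simp only [Prog.block, Prog.exec, State.setReg_mem]
        rw [l3 j hb]; rfl
    · rw [mul_add, mul_one] at k7; omega
  · rintro t ⟨⟨n, w₁, w₂, J, k1, k2, k3, k4, k5, k6, k7, k8⟩, hpos⟩
    rw [k3] at hpos
    obtain rfl : w₂ = [] := List.length_eq_zero_iff.1 (by omega)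
    rw [List.append_nil] at k1
    exact ⟨J, by rw [k1, k5], by rw [k1, k6], k4, k8⟩

/-- Repeat a program `B` that pushes a word. -/
theorem repeat_spec {B : Prog} {c len : ℕ} {g : G}
    (hB : ∀ s I, Env e W b s → HasInput e b I s → Steps B s c fun s' =>
      ∃ J, J.length = len ∧ evalWord J = g ∧ HasInput e b (J ++ I) s' ∧ Keep 24 b s s')
    {s : State} {I : List X} (hs : Env e W b s) (hI : HasInput e b I s) :
    Steps (.loop 27 (.seq B (.sub 27 27 4))) s ((c + 2) * (s.reg 27).toNat + 1) fun s' =>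
      ∃ J, J.length = (s.reg 27).toNat * len ∧ evalWord J = g ^ (s.reg 27).toNat ∧
        HasInput e b (J ++ I) s' ∧ Keep 28 b s s' ∧ s'.reg 26 = s.reg 26 := by
  refine Steps.mono (Steps.loop (fun n s' => ∃ (m : ℕ) (J : List X),
    (s'.reg 27).toNat + m = (s.reg 27).toNat ∧
    HasInput e b (J ++ I) s' ∧ J.length = m * len ∧ evalWord J = g ^ m ∧
    (c + 2) * (s'.reg 27).toNat ≤ n ∧ Keep 28 b s s' ∧ s'.reg 26 = s.reg 26) ?_
    ⟨0, [], by simp, hI, by simp, by simp [evalWord_nil], le_rfl, Keep.refl _ _ _, rfl⟩) le_rfl ?_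
  · rintro n t ⟨m, J, k1, k2, k3, k4, k5, k6, k7⟩ hpos
    refine ⟨c + 1, (hB t (J ++ I) (hs.keep k6) k2).seq fun t' ⟨J', l1, l2, l3, l4⟩ => ?_⟩
    have e4 : t'.reg 4 = 1 := ((hs.keep k6).keep l4).one
    refine Steps.exec (P := .sub 27 27 4) trivial
      ⟨(c + 2) * ((t.reg 27).toNat - 1), ⟨m + 1, J' ++ J, ?_, ?_, ?_, ?_, ?_, ?_, ?_⟩, ?_⟩
    · simp only [Prog.exec, State.setReg_reg, if_true, e4, l4.1 27 (by omega)]; omega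
    · rw [List.append_assoc]
      exact l3.congr (by simp [Prog.exec]) (by simp [Prog.exec]) fun _ _ _ => rfl
    · rw [List.length_append, l1, k3]; ring
    · rw [evalWord_append, l2, k4, pow_succ']
    · simp only [Prog.exec, State.setReg_reg, if_true, e4, l4.1 27 (by omega)]
      apply Nat.mul_le_mul_left; omega
    · refine k6.trans ((l4.mono (by omega)).trans ⟨fun r hr => ?_, fun _ _ _ => rfl⟩)
      have a1 : r ≠ 27 := by omega
      simp [Prog.exec, a1]
    · simp only [Prog.exec, State.setReg_reg]
      simp [l4.1 26 (by omega), k7]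
    · have : (t.reg 27).toNat = (t.reg 27).toNat - 1 + 1 := by omega
      rw [this, mul_add, mul_one] at k5
      omega
  · rintro t ⟨⟨n, m, J, k1, k2, k3, k4, k5, k6, k7⟩, hpos⟩
    obtain rfl : m = (s.reg 27).toNat := by omega
    exact ⟨J, k3, k4, k2, k6, k7⟩

variable (e) in
/-- Push a power of the word number `2`; the exponent is in register `26`. -/
def pushPow : Prog :=
  .seq (Prog.block [.const 20 0, .add 27 26 20]) (.seq (.loop 27 (.seq (pushWord 2) (.sub 27 27 4)))
    (.seq (Prog.block [.const 20 0, .sub 27 20 26])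
      (.loop 27 (.seq (pushWordInv e hinv 2) (.sub 27 27 4)))))

/-- The two loops start with the exponent and with its negative as counters. At most one of these is
positive, and the other loop stops at once. -/
theorem pushPow_spec {I : List X} {s : State} (hs : Env e W b s) (hI : HasInput e b I s) :
    Steps (pushPow e hinv) s (((pushWordInv e hinv 2).size + 20) * ((s.reg 26).natAbs *
      ((W 2).length + 1) + 1)) fun s' =>
      ∃ J, J.length = (s.reg 26).natAbs * (W 2).length ∧
        evalWord J = evalWord (W 2) ^ (s.reg 26) ∧ HasInput e b (J ++ I) s' ∧ Keep 28 b s s' := by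
  have hlast : ∀ {p q : ℕ} {l : ℕ}, p + q = (s.reg 26).natAbs → p * 1 ≤ p * (l + 1) := by
    intro p q l _; apply Nat.mul_le_mul_left; omega
  set z := (pushWordInv e hinv 2).size with hz
  refine Steps.mono (T := 3 + ((((8 * (W 2).length + 5) + 2) * (s.reg 26).toNat + 1) +
    (3 + (((z * ((W 2).length + 1)) + 2) * (-s.reg 26).toNat + 1)))) ?_ ?_ fun _ h => h
  · set s1 := (Prog.block [.const 20 0, .add 27 26 20]).exec s with hs1
    have r1 : ∀ r, r ≠ 20 → r ≠ 27 → s1.reg r = s.reg r := fun r a1 a2 => by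
      simp [hs1, Prog.block, Prog.exec, a1, a2]
    have c27 : s1.reg 27 = s.reg 26 := by simp [hs1, Prog.block, Prog.exec]
    have c1 : Keep 28 b s s1 := ⟨fun r hr => r1 r (by omega) (by omega), fun _ _ _ => rfl⟩
    refine Steps.seq (Q := fun s' => s' = s1)
      (Steps.exec (by simp [Prog.block, Prog.LoopFree]) rfl) fun s' hs' => ?_
    subst hs'
    rw [← c27]
    refine Steps.seq (repeat_spec (len := (W 2).length) (g := evalWord (W 2))
      (fun s I h1 h2 => (pushWord_spec 2 h1 h2).mono le_rfl fun s' h => ⟨_, rfl, rfl, h⟩)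
      (hs.keep c1) (hI.congr (r1 6 (by omega) (by omega)) (r1 7 (by omega) (by omega))
      fun _ _ _ => rfl)) fun s2 ⟨J, h1, h2, h3, h4, h5⟩ => ?_
    rw [c27] at h1 h2 ⊢
    set s3 := (Prog.block [.const 20 0, .sub 27 20 26]).exec s2 with hs3
    have r3 : ∀ r, r ≠ 20 → r ≠ 27 → s3.reg r = s2.reg r := fun r a1 a2 => by
      simp [hs3, Prog.block, Prog.exec, a1, a2]
    have c27' : s3.reg 27 = -s.reg 26 := by
      simp [hs3, Prog.block, Prog.exec, h5, r1]
    have c3 : Keep 28 b s2 s3 := ⟨fun r hr => r3 r (by omega) (by omega), fun _ _ _ => rfl⟩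
    refine Steps.seq (Q := fun s' => s' = s3)
      (Steps.exec (by simp [Prog.block, Prog.LoopFree]) rfl) fun s' hs' => ?_
    subst hs'
    rw [← c27']
    refine Steps.mono (repeat_spec (len := (W 2).length) (g := (evalWord (W 2))⁻¹)
      (fun s I h1 h2 => pushWordInv_spec hinv 2 h1 h2)
      (((hs.keep c1).keep h4).keep c3) (h3.congr (r3 6 (by omega) (by omega))
      (r3 7 (by omega) (by omega)) fun _ _ _ => rfl)) le_rfl fun s4 ⟨J', k1, k2, k3, k4, k5⟩ => ?_
    rw [c27'] at k1 k2
    refine ⟨J' ++ J, ?_, ?_, by rw [List.append_assoc]; exact k3, ((c1.trans h4).trans c3).trans k4⟩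
    · rw [List.length_append, h1, k1, ← add_mul]; congr 1; omega
    · rw [evalWord_append, k2, h2]
      rcases le_total 0 (s.reg 26) with h | h
      · obtain ⟨n, hn⟩ := Int.eq_ofNat_of_zero_le h
        rw [hn]; simp
      · obtain ⟨n, hn⟩ := Int.eq_ofNat_of_zero_le (neg_nonneg.2 h)
        have hn' : s.reg 26 = -(n : ℤ) := by omega
        rw [hn']; simp
  · set l := (W 2).length
    have h1 : (s.reg 26).natAbs = (s.reg 26).toNat + (-s.reg 26).toNat := by omega
    rw [h1]
    set p := (s.reg 26).toNat
    set q := (-s.reg 26).toNat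
    have h2 : 3 + (((8 * l + 5) + 2) * p + 1 + (3 + (z * (l + 1) + 2) * q + 1)) ≤
        (z + 20) * ((p + q) * (l + 1) + 1) := by
      have e1 : (z + 20) * ((p + q) * (l + 1) + 1) =
        z * p * (l + 1) + z * q * (l + 1) + z + 20 * p * l + 20 * p + 20 * q * l + 20 * q + 20 := by
        ring
      have e2 : 3 + (((8 * l + 5) + 2) * p + 1 + (3 + (z * (l + 1) + 2) * q + 1)) =
        z * q * (l + 1) + 8 * p * l + 7 * p + 2 * q + 8 := by ring
      rw [e1, e2]
      have h3 : 8 * p * l ≤ 20 * p * l := by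
        apply Nat.mul_le_mul_right; omega
      have := Nat.zero_le (z * p * (l + 1))
      have := Nat.zero_le (20 * q * l)
      omega
    omega

variable (e) (R : Reducer X)

/-- Compute the length of `Y ^ (-j) * u * Y ^ j' * v⁻¹` where `u` and `v` are the words number `i₁`
and `i₂`, the exponents are in registers, and `Y` is the word number `2`. -/
noncomputable def lengthProg (i₁ i₂ j j' d : ℕ) : Prog :=
  .seq (Prog.block [.const 7 0, .add 6 16 7]) (.seq (pushWordInv e hinv i₂)
  (.seq (Prog.block [.const 20 0, .add 26 j' 20]) (.seq (pushPow e hinv) (.seq (pushWord i₁)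
  (.seq (Prog.block [.const 20 0, .sub 26 20 j]) (.seq (pushPow e hinv)
  (.seq (reduceProg e R) (Prog.block [.const 20 0, .add d 25 20]))))))))

/-- The input is read from the head of the stack, so the factors are pushed from right to left. Each
copy of `y` costs time proportional to `|y| + 1`, as even an empty word takes a turn of the loop.
The constant depends only on the tables, not on the words. -/
theorem lengthProg_spec : ∃ C : ℕ, ∀ (i₁ i₂ : Fin 4) (j j' d : ℕ) (W : Fin 4 → List X) (b : ℤ)
    (s : State), 32 ≤ j → 32 ≤ j' → 32 ≤ d → Env e W b s →
    Steps (lengthProg e hinv R i₁ i₂ j j' d) s (C * ((W i₁).length + (W i₂).length +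
      ((s.reg j).natAbs + (s.reg j').natAbs) * ((W 2).length + 1) + 1)) fun s' =>
      s'.reg d = wordLength X (evalWord (W 2) ^ (-s.reg j) * evalWord (W i₁) *
        evalWord (W 2) ^ s.reg j' * (evalWord (W i₂))⁻¹) ∧
      Env e W b s' ∧ ∀ i, 32 ≤ i → i ≠ d → s'.reg i = s.reg i := by
  set z := (pushWordInv e hinv 2).size with hz
  set c := (reduceStep e R).size + 1 with hc
  set m := R.maxPop + 1 with hm
  refine ⟨3 + z + 3 + (z + 20) + 8 + 5 + 3 + (z + 20) + c * m + 9 + 3, ?_⟩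
  intro i₁ i₂ j j' d W b s hj hj' hd hs
  have hzi : (pushWordInv e hinv i₂).size = z := rfl
  set l := (W 2).length with hl
  set a := (s.reg j).natAbs with ha
  set a' := (s.reg j').natAbs with ha'
  refine Steps.mono (T := 3 + (z * ((W i₂).length + 1) + (3 + ((z + 20) * (a' * (l + 1) + 1) +
    ((8 * (W i₁).length + 5) + (3 + ((z + 20) * (a * (l + 1) + 1) +
    ((c * (m * ((a * l + ((W i₁).length + (a' * l + (W i₂).length))))) + 9) + 3)))))))) ?_ ?_
    fun _ h => h
  · set s1 := (Prog.block [.const 7 0, .add 6 16 7]).exec s with hs1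
    have r1 : ∀ r, r ≠ 6 → r ≠ 7 → s1.reg r = s.reg r := fun r a1 a2 => by
      simp [hs1, Prog.block, Prog.exec, a1, a2]
    have c1 : Keep 28 b s s1 := ⟨fun r hr => r1 r (by omega) (by omega), fun _ _ _ => rfl⟩
    have hI1 : HasInput e b [] s1 := by
      refine ⟨by simp [hs1, Prog.block, Prog.exec, hs.base], by simp [hs1, Prog.block, Prog.exec],
        fun x T h => ?_⟩
      simp at h
    refine Steps.seq (Q := fun s' => s' = s1)
      (Steps.exec (by simp [Prog.block, Prog.LoopFree]) rfl) fun s' hs' => ?_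
    subst hs'
    refine Steps.seq (hzi ▸ pushWordInv_spec hinv i₂ (hs.keep c1) hI1)
      fun s2 ⟨J2, p1, p2, p3, p4⟩ => ?_
    have k2 : Keep 28 b s s2 := c1.trans (p4.mono (by omega))
    set s3 := (Prog.block [.const 20 0, .add 26 j' 20]).exec s2 with hs3
    have r3 : ∀ r, r ≠ 20 → r ≠ 26 → s3.reg r = s2.reg r := fun r a1 a2 => by
      simp [hs3, Prog.block, Prog.exec, a1, a2]
    have k3 : Keep 28 b s s3 :=
      k2.trans ⟨fun r hr => r3 r (by omega) (by omega), fun _ _ _ => rfl⟩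
    have c26 : s3.reg 26 = s.reg j' := by
      have a1 : j' ≠ 20 := by omega
      simp [hs3, Prog.block, Prog.exec, a1, k2.1 j' (by omega)]
    have hI3 : HasInput e b (J2 ++ []) s3 := p3.congr (r3 6 (by omega) (by omega))
      (r3 7 (by omega) (by omega)) fun _ _ _ => rfl
    refine Steps.seq (Q := fun s' => s' = s3)
      (Steps.exec (by simp [Prog.block, Prog.LoopFree]) rfl) fun s' hs' => ?_
    subst hs'
    rw [ha', ← c26]
    refine Steps.seq (pushPow_spec hinv (hs.keep k3) hI3) fun s4 ⟨J4, q1, q2, q3, q4⟩ => ?_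
    rw [c26] at q1 q2 ⊢
    have k4 := k3.trans q4
    refine Steps.seq (pushWord_spec i₁ (hs.keep k4) q3) fun s5 ⟨q5, q6⟩ => ?_
    have k5 := k4.trans (q6.mono (by omega))
    set s6 := (Prog.block [.const 20 0, .sub 26 20 j]).exec s5 with hs6
    have r6 : ∀ r, r ≠ 20 → r ≠ 26 → s6.reg r = s5.reg r := fun r a1 a2 => by
      simp [hs6, Prog.block, Prog.exec, a1, a2]
    have k6 : Keep 28 b s s6 :=
      k5.trans ⟨fun r hr => r6 r (by omega) (by omega), fun _ _ _ => rfl⟩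
    have c26' : s6.reg 26 = -s.reg j := by
      have a1 : j ≠ 20 := by omega
      simp [hs6, Prog.block, Prog.exec, a1, k5.1 j (by omega)]
    have hI6 : HasInput e b (W i₁ ++ (J4 ++ (J2 ++ []))) s6 :=
      q5.congr (r6 6 (by omega) (by omega)) (r6 7 (by omega) (by omega)) fun _ _ _ => rfl
    refine Steps.seq (Q := fun s' => s' = s6)
      (Steps.exec (by simp [Prog.block, Prog.LoopFree]) rfl) fun s' hs' => ?_
    subst hs'
    have haj : a = (s6.reg 26).natAbs := by rw [c26', ha, Int.natAbs_neg]
    rw [haj]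
    refine Steps.seq (pushPow_spec hinv (hs.keep k6) hI6) fun s7 ⟨J7, t1, t2, t3, t4⟩ => ?_
    have k7 := k6.trans t4
    have hlen : (J7 ++ (W i₁ ++ (J4 ++ (J2 ++ [])))).length =
        (s6.reg 26).natAbs * l + ((W i₁).length + ((s.reg j').natAbs * l + (W i₂).length)) := by
      simp [t1, q1, p1]; ring
    rw [← hlen]
    refine Steps.seq (reduceProg_spec e R hs.nonneg (hs.keep k7).one t3) fun s8 ⟨v1, v2⟩ => ?_
    have k8 := k7.trans (v2.mono (by omega))
    refine Steps.exec (P := Prog.block [.const 20 0, .add d 25 20])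
      (by simp [Prog.block, Prog.LoopFree]) ⟨?_, ?_, ?_⟩
    · simp only [Prog.block, Prog.exec, State.setReg_reg, Nat.reduceEqDiff, if_true, if_false,
        add_zero, v1]
      rw [c26'] at t2
      simp only [evalWord_append, t2, q2, p2, evalWord_nil, mul_one, mul_assoc]
    · refine (hs.keep k8).keep (m := d + 1) ⟨fun r hr => ?_, fun _ _ _ => rfl⟩
      have a1 : r ≠ 20 := by omega
      have a2 : r ≠ d := by omega
      simp [Prog.block, Prog.exec, a1, a2]
    · intro i hi hid
      have a1 : i ≠ 20 := by omega
      simp only [Prog.block, Prog.exec, State.setReg_reg, a1, hid, if_false]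
      exact k8.1 i (by omega)
  · generalize (W i₁).length = p
    generalize (W i₂).length = q
    obtain ⟨T, hT⟩ : ∃ T, T = p + q + (a + a') * (l + 1) + 1 := ⟨_, rfl⟩
    rw [← hT]
    have e1 : (a + a') * (l + 1) = a * (l + 1) + a' * (l + 1) := add_mul _ _ _
    have e2 : a * (l + 1) = a * l + a := by ring
    have e3 : a' * (l + 1) = a' * l + a' := by ring
    have t1 : q + 1 ≤ T := by omega
    have t2 : a' * (l + 1) + 1 ≤ T := by omega
    have t3 : a * (l + 1) + 1 ≤ T := by omega
    have t4 : a * l + (p + (a' * l + q)) ≤ T := by omega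
    have t5 := Nat.mul_le_mul_left z t1
    have t6 := Nat.mul_le_mul_left (z + 20) t2
    have t7 := Nat.mul_le_mul_left (z + 20) t3
    have t8 := Nat.mul_le_mul_left c (Nat.mul_le_mul_left m t4)
    have t9 : p + 1 ≤ T := by omega
    calc _ ≤ 3 * T + (z * T + (3 * T + ((z + 20) * T + ((8 * T + 5 * T) + (3 * T +
          ((z + 20) * T + ((c * (m * T) + 9 * T) + 3 * T))))))) := by omega
      _ = _ := by ring

end Pushing
-- Functions computable in linear time
section LinearTime

variable {G : Type*} {X : Finset G} (e : X ≃ Fin X.card)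

/-- The input words, and the empty word. -/
def inputWords (u v y : List X) : Fin 4 → List X := ![u, v, y, []]

/-- The total length of the input. -/
def inputLength (u v y : List X) : ℕ := u.length + v.length + y.length

/-- `f` can be computed in linear time. The result is written to any given register `d`; the
registers below `d` are not changed. -/
def LinearTime (f : List X → List X → List X → ℤ) : Prop :=
  ∃ C : ℕ, ∀ d, 32 ≤ d → ∃ P : Prog, ∀ u v y s,
    Env e (inputWords u v y) (inputLength u v y) s →
    Steps P s (C * (inputLength u v y + 1)) fun s' =>
      Env e (inputWords u v y) (inputLength u v y) s' ∧ s'.reg d = f u v y ∧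
        ∀ i, 32 ≤ i → i < d → s'.reg i = s.reg i

variable {e} {f g h : List X → List X → List X → ℤ}

theorem Env.of_reg {W : Fin 4 → List X} {b : ℤ} {s s' : State} (hs : Env e W b s)
    (hr : ∀ i, i < 32 → s'.reg i = s.reg i) (hm : s'.mem = s.mem) : Env e W b s' := by
  refine ⟨by rw [hr 4 (by omega), hs.one], by rw [hr 16 (by omega), hs.base], hs.nonneg,
    fun i => ?_⟩
  obtain ⟨off, h1, h2, h3, h4, h5⟩ := hs.word i
  have := i.2
  exact ⟨off, h1, h2, by rw [hr _ (by omega), h3], by rw [hr _ (by omega), h4], by rwa [hm]⟩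

theorem LinearTime.const (c : ℤ) : LinearTime e fun _ _ _ => c := by
  refine ⟨1, fun d hd => ⟨.const d c, fun u v y s hs => ?_⟩⟩
  refine (Steps.exec (P := .const d c) trivial ⟨?_, ?_, ?_⟩).mono
    (show 1 ≤ 1 * (inputLength u v y + 1) by omega) fun _ h => h
  · refine hs.of_reg (fun i hi => ?_) rfl
    have : i ≠ d := by omega
    simp [Prog.exec, this]
  · simp [Prog.exec]
  · intro i _ hi
    have : i ≠ d := by omega
    simp [Prog.exec, this]

theorem LinearTime.length (k : Fin 4) : LinearTime e fun u v y => (inputWords u v y k).length := by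
  have hk := k.2
  refine ⟨3, fun d hd => ⟨Prog.block [.const d 0, .add d d (9 + 2 * k)], fun u v y s hs => ?_⟩⟩
  refine (Steps.exec (P := Prog.block [.const d 0, .add d d (9 + 2 * k)])
    (by simp [Prog.block, Prog.LoopFree]) ⟨?_, ?_, ?_⟩).mono
    (show 3 ≤ 3 * (inputLength u v y + 1) by omega) fun _ h => h
  · refine hs.of_reg (fun i hi => ?_) rfl
    have : i ≠ d := by omega
    simp [Prog.block, Prog.exec, this]
  · obtain ⟨off, -, -, -, h4, -⟩ := hs.word k
    have : 9 + 2 * (k : ℕ) ≠ d := by omega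
    simp [Prog.block, Prog.exec, this, h4]
  · intro i _ hi
    have : i ≠ d := by omega
    simp [Prog.block, Prog.exec, this]

/-- Compute two functions, and treat the results by a program `P d` that may use all registers from
`d` on. -/
theorem LinearTime.bind₂ (hf : LinearTime e f) (hg : LinearTime e g) {C : ℕ} {P : ℕ → Prog}
    (hP : ∀ d, 32 ≤ d → ∀ u v y s, Env e (inputWords u v y) (inputLength u v y) s →
      s.reg d = f u v y → s.reg (d + 1) = g u v y →
      Steps (P d) s (C * (inputLength u v y + 1)) fun s' =>
        Env e (inputWords u v y) (inputLength u v y) s' ∧ s'.reg d = h u v y ∧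
          ∀ i, 32 ≤ i → i < d → s'.reg i = s.reg i) : LinearTime e h := by
  obtain ⟨C1, h1⟩ := hf
  obtain ⟨C2, h2⟩ := hg
  refine ⟨C1 + (C2 + C), fun d hd => ?_⟩
  obtain ⟨P1, k1⟩ := h1 d hd
  obtain ⟨P2, k2⟩ := h2 (d + 1) (by omega)
  refine ⟨.seq P1 (.seq P2 (P d)), fun u v y s hs => ?_⟩
  rw [add_mul, add_mul]
  refine (k1 u v y s hs).seq fun s1 ⟨a1, a2, a3⟩ => (k2 u v y s1 a1).seq fun s2 ⟨b1, b2, b3⟩ => ?_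
  refine (hP d hd u v y s2 b1 (by rw [b3 d hd (by omega), a2]) b2).mono le_rfl
    fun s3 ⟨c1, c2, c3⟩ => ⟨c1, c2, fun i hi hid => ?_⟩
  rw [c3 i hi hid, b3 i hi (by omega), a3 i hi hid]

theorem LinearTime.add (hf : LinearTime e f) (hg : LinearTime e g) :
    LinearTime e fun u v y => f u v y + g u v y := by
  refine hf.bind₂ hg (C := 1) (P := fun d => .add d d (d + 1)) fun d hd u v y s hs h1 h2 => ?_
  refine (Steps.exec (P := .add d d (d + 1)) trivial ⟨?_, ?_, ?_⟩).mono
    (show 1 ≤ 1 * (inputLength u v y + 1) by omega) fun _ h => h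
  · refine hs.of_reg (fun i hi => ?_) rfl
    have : i ≠ d := by omega
    simp [Prog.exec, this]
  · simp [Prog.exec, h1, h2]
  · intro i _ hi
    have : i ≠ d := by omega
    simp [Prog.exec, this]

theorem LinearTime.sub (hf : LinearTime e f) (hg : LinearTime e g) :
    LinearTime e fun u v y => f u v y - g u v y := by
  refine hf.bind₂ hg (C := 1) (P := fun d => .sub d d (d + 1)) fun d hd u v y s hs h1 h2 => ?_
  refine (Steps.exec (P := .sub d d (d + 1)) trivial ⟨?_, ?_, ?_⟩).mono
    (show 1 ≤ 1 * (inputLength u v y + 1) by omega) fun _ h => h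
  · refine hs.of_reg (fun i hi => ?_) rfl
    have : i ≠ d := by omega
    simp [Prog.exec, this]
  · simp [Prog.exec, h1, h2]
  · intro i _ hi
    have : i ≠ d := by omega
    simp [Prog.exec, this]

theorem LinearTime.neg (hf : LinearTime e f) : LinearTime e fun u v y => -f u v y := by
  simpa using (LinearTime.const 0).sub hf

theorem LinearTime.ite {k : List X → List X → List X → ℤ} (hf : LinearTime e f)
    (hg : LinearTime e g) (hh : LinearTime e h)
    (hk : ∀ u v y, k u v y = if 0 < f u v y then g u v y else h u v y) : LinearTime e k := by
  obtain ⟨C1, h1⟩ := hf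
  obtain ⟨C2, h2⟩ := hg
  obtain ⟨C3, h3⟩ := hh
  refine ⟨C1 + (C2 + C3 + 1), fun d hd => ?_⟩
  obtain ⟨P1, k1⟩ := h1 d hd
  obtain ⟨P2, k2⟩ := h2 d hd
  obtain ⟨P3, k3⟩ := h3 d hd
  refine ⟨.seq P1 (.branch d P2 P3), fun u v y s hs => ?_⟩
  rw [add_mul, add_mul, add_mul]
  refine (k1 u v y s hs).seq fun s1 ⟨a1, a2, a3⟩ => ?_
  by_cases hpos : 0 < f u v y
  · obtain ⟨s2, t, b1, b2, b3, b4, b5⟩ := k2 u v y s1 a1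
    refine ⟨s2, t + 1, .branch_pos (by rwa [a2]) b1, by omega, b3, ?_, fun i hi hid => ?_⟩
    · rw [hk, if_pos hpos, b4]
    · rw [b5 i hi hid, a3 i hi hid]
  · obtain ⟨s2, t, b1, b2, b3, b4, b5⟩ := k3 u v y s1 a1
    refine ⟨s2, t + 1, .branch_neg (by rwa [a2]) b1, by omega, b3, ?_, fun i hi hid => ?_⟩
    · rw [hk, if_neg hpos, b4]
    · rw [b5 i hi hid, a3 i hi hid]

/-- Division with remainder, by repeated subtraction; the quotient is computed in register
`d + 2`. -/
def divProg (d : ℕ) : Prog :=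
  .seq (Prog.block [.const (d + 2) 0, .sub (d + 3) d (d + 1), .add (d + 3) (d + 3) 4])
  (.seq (.loop (d + 3) (Prog.block [.sub d d (d + 1), .add (d + 2) (d + 2) 4,
    .sub (d + 3) d (d + 1), .add (d + 3) (d + 3) 4]))
  (.seq (Prog.block [.const (d + 3) 0, .sub (d + 3) (d + 3) d])
  (.seq (.loop (d + 3) (Prog.block [.add d d (d + 1), .sub (d + 2) (d + 2) 4,
    .const (d + 3) 0, .sub (d + 3) (d + 3) d]))
  (Prog.block [.const (d + 3) 0, .add d (d + 2) (d + 3)]))))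

/-- The hypothesis on `C` bounds the quotient linearly, so repeated subtraction of the divisor, or
addition for negative dividends, is fast enough. -/
theorem LinearTime.div (hf : LinearTime e f) (hg : LinearTime e g) (hpos : ∀ u v y, 0 < g u v y)
    {C : ℕ} (hC : ∀ u v y, |f u v y| ≤ C * (inputLength u v y + 1) * g u v y) :
    LinearTime e fun u v y => f u v y / g u v y := by
  refine hf.bind₂ hg (C := 12 * C + 14) (P := divProg) fun d hd u v y s hs h1 h2 => ?_
  have hCf := hC u v y
  have hg0 := hpos u v y
  generalize f u v y = x at *
  generalize g u v y = q at *
  generalize hB : inputLength u v y + 1 = B at *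
  have hB1 : 1 ≤ B := by omega
  have hCf' : |x| ≤ (C * B : ℕ) * q := by rw [← hB]; push_cast; exact hCf
  have n1 : ∀ i j : ℕ, i ≠ j → d + i ≠ d + j := fun i j h => by omega
  have n2 : ∀ i : ℕ, i ≠ 0 → d ≠ d + i := fun i h => by omega
  -- the common part of the invariants
  set J : State → Prop := fun t => (∀ i, i < d → t.reg i = s.reg i) ∧ t.mem = s.mem ∧
    t.reg (d + 1) = q ∧ t.reg d + t.reg (d + 2) * q = x with hJ
  have j4 : ∀ t, J t → t.reg 4 = 1 := fun t ht => by rw [ht.1 4 (by omega), hs.one]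
  refine Steps.mono (T := 4 + ((6 * (C * B) + 1) + (3 + ((6 * (C * B) + 1) + 3)))) ?_ (by
    rw [add_mul]; nlinarith) fun _ h => h
  have e1 : ∀ t, (Prog.block [.const (d + 2) 0, .sub (d + 3) d (d + 1),
      .add (d + 3) (d + 3) 4]).exec t = ((t.setReg (d + 2) 0).setReg (d + 3)
        (t.reg d - t.reg (d + 1))).setReg (d + 3) (t.reg d - t.reg (d + 1) + t.reg 4) := by
    intro t
    have a4 : 4 ≠ d + 3 := by omega
    have a4' : 4 ≠ d + 2 := by omega
    simp [Prog.block, Prog.exec, a4, a4']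
  refine Steps.seq (Q := fun t => J t ∧ t.reg (d + 3) = t.reg d - q + 1 ∧
    t.reg d = x) (Steps.exec (by simp [Prog.block, Prog.LoopFree]) ?_) fun s1 ⟨a1, a2, a3⟩ => ?_
  · rw [e1]
    refine ⟨⟨fun i hi => ?_, rfl, ?_, ?_⟩, ?_, ?_⟩
    · have b1 : i ≠ d + 2 := by omega
      have b2 : i ≠ d + 3 := by omega
      simp [b1, b2]
    · simp [h2]
    · simp [h1]
    · simp [h1, h2, hs.one]
    · simp [h1]
  -- Register `d + 3` holds the current remainder minus `q` plus `1`, which is positive exactly if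
  -- `q` can be subtracted again. Each turn costs `6`, including the test.
  refine Steps.seq (Q := fun t => J t ∧ t.reg d < q ∧ -((C * B : ℕ) * q) ≤ t.reg d)
    (Steps.mono (Steps.loop (n := 6 * (C * B)) (fun n t => J t ∧ t.reg (d + 3) = t.reg d - q + 1 ∧
      -((C * B : ℕ) * q) ≤ t.reg d ∧ ∃ k : ℕ, t.reg (d + 3) ≤ k * q ∧ 6 * k ≤ n) ?_
      ⟨a1, a2, ?_, C * B, ?_, le_rfl⟩) le_rfl ?_) fun s2 ⟨b1, b2, b3⟩ => ?_
  · rintro n t ⟨k1, k2, k3, k, k4, k5⟩ hp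
    have t4 := j4 t k1
    obtain ⟨k, rfl⟩ : ∃ k', k = k' + 1 := ⟨k - 1, by
      rcases Nat.eq_zero_or_pos k with rfl | h
      · simp at k4; omega
      · omega⟩
    have e2 : (Prog.block [.sub d d (d + 1), .add (d + 2) (d + 2) 4,
        .sub (d + 3) d (d + 1), .add (d + 3) (d + 3) 4]).exec t =
        (((t.setReg d (t.reg d - q)).setReg (d + 2) (t.reg (d + 2) + 1)).setReg (d + 3)
          (t.reg d - q - q)).setReg (d + 3) (t.reg d - q - q + 1) := by
      have c1 : 4 ≠ d := by omega
      have c2 : 4 ≠ d + 2 := by omega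
      have c3 : 4 ≠ d + 3 := by omega
      simp [Prog.block, Prog.exec, k1.2.2.1, t4, c1, c2, c3]
    refine ⟨5, Steps.exec (P := Prog.block [.sub d d (d + 1), .add (d + 2) (d + 2) 4,
        .sub (d + 3) d (d + 1), .add (d + 3) (d + 3) 4]) (by simp [Prog.block, Prog.LoopFree])
        ⟨6 * k, ⟨⟨fun i hi => ?_, ?_, ?_, ?_⟩, ?_, ?_, k, ?_, le_rfl⟩, by omega⟩⟩
    · have c1 : i ≠ d := by omega
      have c2 : i ≠ d + 2 := by omega
      have c3 : i ≠ d + 3 := by omega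
      rw [e2]; simp [c1, c2, c3, k1.1 i hi]
    · rw [e2]; exact k1.2.1
    · rw [e2]; simp [k1.2.2.1]
    · rw [e2]; simp only [State.setReg_reg]; simp; linarith [k1.2.2.2]
    · rw [e2]; simp
    · rw [e2]; simp only [State.setReg_reg]; simp
      have : 0 ≤ ((C : ℤ) * B) * q := by positivity
      linarith
    · rw [e2]; simp only [State.setReg_reg]; simp
      push_cast at k4
      rw [k2] at k4
      linarith
  · rw [a3]; exact neg_le_of_abs_le hCf'
  · rw [a2, a3]; linarith [le_of_abs_le hCf']
  · rintro t ⟨⟨n, k1, k2, k3, -⟩, hp⟩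
    exact ⟨k1, by omega, k3⟩
  refine Steps.seq (Q := fun t => J t ∧ t.reg (d + 3) = -t.reg d ∧ t.reg d < q ∧
    -((C * B : ℕ) * q) ≤ t.reg d) (Steps.exec (by simp [Prog.block, Prog.LoopFree]) ?_)
    fun s3 ⟨c1, c2, c3, c4⟩ => ?_
  · have e3 : (Prog.block [.const (d + 3) 0, .sub (d + 3) (d + 3) d]).exec s2 =
        (s2.setReg (d + 3) 0).setReg (d + 3) (-s2.reg d) := by
      simp [Prog.block, Prog.exec]
    rw [e3]
    refine ⟨⟨fun i hi => ?_, b1.2.1, ?_, ?_⟩, ?_, ?_, ?_⟩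
    · have d3 : i ≠ d + 3 := by omega
      simp [d3, b1.1 i hi]
    · simp [b1.2.2.1]
    · simp [b1.2.2.2]
    · simp
    · simp [b2]
    · simpa using b3
  refine Steps.seq (Q := fun t => J t ∧ t.reg d < q ∧ 0 ≤ t.reg d)
    (Steps.mono (Steps.loop (n := 6 * (C * B)) (fun n t => J t ∧ t.reg (d + 3) = -t.reg d ∧
      t.reg d < q ∧ ∃ k : ℕ, t.reg (d + 3) ≤ k * q ∧ 6 * k ≤ n) ?_
      ⟨c1, c2, c3, C * B, by rw [c2]; linarith, le_rfl⟩) le_rfl ?_) fun s4 ⟨d1, d2, d3⟩ => ?_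
  · rintro n t ⟨k1, k2, k3, k, k4, k5⟩ hp
    have t4 := j4 t k1
    obtain ⟨k, rfl⟩ : ∃ k', k = k' + 1 := ⟨k - 1, by
      rcases Nat.eq_zero_or_pos k with rfl | h
      · simp at k4; omega
      · omega⟩
    have e2 : (Prog.block [.add d d (d + 1), .sub (d + 2) (d + 2) 4,
        .const (d + 3) 0, .sub (d + 3) (d + 3) d]).exec t =
        (((t.setReg d (t.reg d + q)).setReg (d + 2) (t.reg (d + 2) - 1)).setReg (d + 3)
          0).setReg (d + 3) (-(t.reg d + q)) := by
      have c1 : 4 ≠ d := by omega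
      have c2 : 4 ≠ d + 2 := by omega
      have c3 : 4 ≠ d + 3 := by omega
      simp [Prog.block, Prog.exec, k1.2.2.1, t4, c1]
    refine ⟨5, Steps.exec (P := Prog.block [.add d d (d + 1), .sub (d + 2) (d + 2) 4,
        .const (d + 3) 0, .sub (d + 3) (d + 3) d]) (by simp [Prog.block, Prog.LoopFree])
        ⟨6 * k, ⟨⟨fun i hi => ?_, ?_, ?_, ?_⟩, ?_, ?_, k, ?_, le_rfl⟩, by omega⟩⟩
    · have c1 : i ≠ d := by omega
      have c2 : i ≠ d + 2 := by omega
      have c3 : i ≠ d + 3 := by omega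
      rw [e2]; simp [c1, c2, c3, k1.1 i hi]
    · rw [e2]; exact k1.2.1
    · rw [e2]; simp [k1.2.2.1]
    · rw [e2]; simp only [State.setReg_reg]; simp; linarith [k1.2.2.2]
    · rw [e2]; simp
    · rw [e2]; simp only [State.setReg_reg]; simp
      omega
    · rw [e2]; simp only [State.setReg_reg]; simp
      push_cast at k4
      rw [k2] at k4
      linarith
  · rintro t ⟨⟨n, k1, k2, k3, -⟩, hp⟩
    exact ⟨k1, k3, by omega⟩
  have e5 : (Prog.block [.const (d + 3) 0, .add d (d + 2) (d + 3)]).exec s4 =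
      (s4.setReg (d + 3) 0).setReg d (s4.reg (d + 2)) := by
    simp [Prog.block, Prog.exec]
  refine Steps.exec (P := Prog.block [.const (d + 3) 0, .add d (d + 2) (d + 3)])
    (by simp [Prog.block, Prog.LoopFree]) ?_
  rw [e5]
  have hr : ∀ i, i < d → ((s4.setReg (d + 3) 0).setReg d (s4.reg (d + 2))).reg i = s.reg i := by
    intro i hi
    have g1 : i ≠ d := by omega
    have g2 : i ≠ d + 3 := by omega
    simp [g1, g2, d1.1 i hi]
  refine ⟨hs.of_reg (fun i hi => hr i (by omega)) d1.2.1, ?_, fun i _ hi => hr i hi⟩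
  have := Int.ediv_emod_unique hg0 (a := x) (r := s4.reg d) (q := s4.reg (d + 2))
  simp only [State.setReg_reg, if_true]
  exact (this.2 ⟨by linarith [d1.2.2.2], d3, d2⟩).1.symm

variable [Group G]

theorem LinearTime.wordLength (hinv : ∀ x ∈ X, x⁻¹ ∈ X) (R : Reducer X) (i₁ i₂ : Fin 4)
    (hf : LinearTime e f) (hg : LinearTime e g) {C : ℕ}
    (hfC : ∀ u v y, |f u v y| * (y.length + 1) ≤ C * (inputLength u v y + 1))
    (hgC : ∀ u v y, |g u v y| * (y.length + 1) ≤ C * (inputLength u v y + 1)) :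
    LinearTime e fun u v y => (wordLength X (evalWord y ^ (-f u v y) *
      evalWord (inputWords u v y i₁) * evalWord y ^ g u v y *
        (evalWord (inputWords u v y i₂))⁻¹) : ℤ) := by
  obtain ⟨c, hc⟩ := lengthProg_spec e hinv R
  refine hf.bind₂ hg (C := c * (2 * C + 3)) (P := fun d => lengthProg e hinv R i₁ i₂ d (d + 1) d)
    fun d hd u v y s hs h1 h2 => ?_
  have hlen : ∀ i, (inputWords u v y i).length ≤ inputLength u v y := by
    intro i
    fin_cases i <;> simp [inputWords, inputLength] <;> omega
  refine (hc i₁ i₂ d (d + 1) d _ _ s hd (by omega) hd hs).mono ?_ fun s' ⟨k1, k2, k3⟩ =>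
    ⟨k2, ?_, fun i hi hid => k3 i hi (by omega)⟩
  · rw [h1, h2, mul_assoc]
    apply Nat.mul_le_mul_left
    have a1 := hfC u v y
    have a2 := hgC u v y
    rw [← Int.natCast_natAbs] at a1 a2
    have a1' : (f u v y).natAbs * (y.length + 1) ≤ C * (inputLength u v y + 1) := by
      exact_mod_cast a1
    have a2' : (g u v y).natAbs * (y.length + 1) ≤ C * (inputLength u v y + 1) := by
      exact_mod_cast a2
    have a3 := hlen i₁
    have a4 := hlen i₂
    change _ + ((f u v y).natAbs + (g u v y).natAbs) * (y.length + 1) + 1 ≤ _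
    rw [add_mul, add_mul (2 * C), mul_assoc 2 C]
    omega
  · rw [k1, h1, h2]; rfl

end LinearTime
-- Approximate projections as quotients of length differences
section Exponents

variable {G : Type*} {X : Finset G}

/-- The length of `y`, or `1` if `y` is empty. -/
def posLength (y : List X) : ℤ := if 0 < (y.length : ℤ) then y.length else 1

/-- An exponent such that the power of `y` is long compared with `u` and `v`. -/
def farExp (u v y : List X) : ℤ := 4 * (((u.length : ℤ) + v.length) / posLength y + 1) + 2

theorem posLength_pos (y : List X) : 0 < posLength y := by
  unfold posLength; split_ifs with h
  · exact h
  · norm_num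

theorem length_le_posLength (y : List X) : (y.length : ℤ) ≤ posLength y := by
  unfold posLength; split_ifs with h <;> omega

theorem posLength_le (u v y : List X) : posLength y ≤ inputLength u v y + 1 := by
  unfold posLength inputLength; split_ifs with h <;> push_cast <;> omega

/-- The lower bound meets the requirement of `near_of_diff` for `u` and `v`, and also after
multiplication by the left power, which can double the length and add `posLength y`. The upper bound
keeps the power of linear length. -/
theorem farExp_mul (u v y : List X) :
    4 * ((u.length : ℤ) + v.length) + 2 * posLength y ≤ farExp u v y * posLength y ∧
      farExp u v y * posLength y ≤ 4 * ((u.length : ℤ) + v.length) + 6 * posLength y := by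
  have h0 := posLength_pos y
  have h1 := Int.ediv_mul_le ((u.length : ℤ) + v.length) h0.ne'
  have h2 := Int.lt_ediv_add_one_mul_self ((u.length : ℤ) + v.length) h0
  unfold farExp
  constructor <;> linarith

theorem farExp_pos (u v y : List X) : 0 < farExp u v y := by
  have h0 := posLength_pos y
  have : 0 ≤ ((u.length : ℤ) + v.length) / posLength y := Int.ediv_nonneg (by positivity) h0.le
  unfold farExp; omega

theorem abs_ediv_mul_le (a : ℤ) {q : ℤ} (hq : 0 < q) : |a / (2 * q)| * (2 * q) ≤ |a| + 2 * q := by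
  have h1 := Int.ediv_mul_le a (b := 2 * q) (by omega)
  have h2 := Int.lt_ediv_add_one_mul_self a (b := 2 * q) (by omega)
  have h3 : |a / (2 * q) * (2 * q)| ≤ |a| + 2 * q := by
    rw [abs_le]
    have := neg_le_abs a
    have := le_abs_self a
    constructor <;> linarith
  rwa [abs_mul, abs_of_pos (a := 2 * q) (by omega)] at h3

variable [Group G]

/-- The length of `Y ^ (-j) * w * Y ^ j' * w'⁻¹`, where `w` and `w'` are input words. -/
noncomputable def twistedLength (i i' : Fin 4) (j j' : ℤ) (u v y : List X) : ℤ :=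
  wordLength X (evalWord y ^ (-j) * evalWord (inputWords u v y i) * evalWord y ^ j' *
    (evalWord (inputWords u v y i'))⁻¹)

/-- The index of a power of `y` near to the input word `i`. -/
noncomputable def leftExp (i : Fin 4) (u v y : List X) : ℤ :=
  (twistedLength i 3 (-farExp u v y) 0 u v y - twistedLength i 3 (farExp u v y) 0 u v y) /
    (2 * posLength y)

/-- An exponent that makes the input word `i` short, when used on the right after `leftExp` on
the left. -/
noncomputable def rightExp (i : Fin 4) (u v y : List X) : ℤ :=
  (twistedLength i 3 (leftExp i u v y) (-farExp u v y) u v y -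
    twistedLength i 3 (leftExp i u v y) (farExp u v y) u v y) / (2 * posLength y)

theorem wordLength_inputWords_le (i : Fin 4) (u v y : List X) :
    (wordLength X (evalWord (inputWords u v y i)) : ℤ) ≤ inputLength u v y := by
  have := wordLength_le (inputWords u v y i)
  have h : (inputWords u v y i).length ≤ inputLength u v y := by
    fin_cases i <;> simp [inputWords, inputLength] <;> omega
  omega

variable (hL : GeodesicLength (wordLength X))

include hL

theorem wordLength_zpow_le (y : List X) (n : ℤ) :
    (wordLength X (evalWord y ^ n) : ℤ) ≤ |n| * y.length := by
  have h : ∀ m : ℕ, (wordLength X (evalWord y ^ m) : ℤ) ≤ m * y.length := by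
    intro m
    induction m with
    | zero => simp [wordLength_one]
    | succ m ih =>
      have h1 := hL.mul_le (evalWord y ^ m) (evalWord y)
      have h2 := wordLength_le y
      rw [pow_succ, Nat.cast_succ, add_mul]
      omega
  rcases le_total 0 n with hn | hn
  · lift n to ℕ using hn
    simpa using h n
  · obtain ⟨m, hm⟩ := Int.eq_ofNat_of_zero_le (neg_nonneg.2 hn)
    obtain rfl : n = -(m : ℤ) := by omega
    rw [zpow_neg, hL.inv]
    simpa using h m

/-- `Y ^ n` and `Y ^ (-n)` have the same length and cancel in the difference. Hence the exponents
derived from it are controlled by the length of `g`, however large `n` is. -/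
theorem abs_wordLength_sub_left (Y g : G) (n : ℤ) :
    |(wordLength X (Y ^ n * g) : ℤ) - wordLength X (Y ^ (-n) * g)| ≤ 2 * wordLength X g := by
  have e : wordLength X (Y ^ (-n)) = wordLength X (Y ^ n) := by rw [zpow_neg, hL.inv]
  have h : ∀ a : G, wordLength X (a * g) ≤ wordLength X a + wordLength X g ∧
      wordLength X a ≤ wordLength X (a * g) + wordLength X g := fun a => by
    refine ⟨hL.mul_le a g, ?_⟩
    have := hL.mul_le (a * g) g⁻¹
    rwa [mul_inv_cancel_right, hL.inv] at this
  have h1 := h (Y ^ n)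
  have h2 := h (Y ^ (-n))
  rw [abs_le]; omega

theorem abs_wordLength_sub_right (Y g : G) (n : ℤ) :
    |(wordLength X (g * Y ^ (-n)) : ℤ) - wordLength X (g * Y ^ n)| ≤ 2 * wordLength X g := by
  have h := abs_wordLength_sub_left hL Y g⁻¹ n
  have e : ∀ n : ℤ, wordLength X (Y ^ n * g⁻¹) = wordLength X (g * Y ^ (-n)) := fun n => by
    rw [← hL.inv]; simp
  rwa [e, e, neg_neg, hL.inv] at h

theorem leftExp_bound (i : Fin 4) (u v y : List X) :
    |leftExp i u v y| * posLength y ≤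
      wordLength X (evalWord (inputWords u v y i)) + posLength y := by
  have h1 := abs_ediv_mul_le (twistedLength i 3 (-farExp u v y) 0 u v y -
    twistedLength i 3 (farExp u v y) 0 u v y) (posLength_pos y)
  have h2 := abs_wordLength_sub_left hL (evalWord y) (evalWord (inputWords u v y i)) (farExp u v y)
  simp only [twistedLength, inputWords, Matrix.cons_val, evalWord_nil, inv_one, mul_one, zpow_zero,
    neg_neg] at h1 h2
  simp only [leftExp, twistedLength, inputWords, Matrix.cons_val, evalWord_nil, inv_one, mul_one,
    zpow_zero, neg_neg]
  linarith

theorem wordLength_left_le (i : Fin 4) (u v y : List X) :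
    (wordLength X (evalWord y ^ (-leftExp i u v y) * evalWord (inputWords u v y i)) : ℤ) ≤
      2 * wordLength X (evalWord (inputWords u v y i)) + posLength y := by
  have h1 := leftExp_bound hL i u v y
  have h2 := hL.mul_le (evalWord y ^ (-leftExp i u v y)) (evalWord (inputWords u v y i))
  have h3 := wordLength_zpow_le hL y (-leftExp i u v y)
  rw [abs_neg] at h3
  have h4 := mul_le_mul_of_nonneg_left (length_le_posLength y) (abs_nonneg (leftExp i u v y))
  have h5 : (wordLength X (evalWord y ^ (-leftExp i u v y) * evalWord (inputWords u v y i)) : ℤ) ≤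
    wordLength X (evalWord y ^ (-leftExp i u v y)) +
      wordLength X (evalWord (inputWords u v y i)) := by exact_mod_cast h2
  linarith

theorem rightExp_diff_bound (i : Fin 4) (u v y : List X) :
    |twistedLength i 3 (leftExp i u v y) (-farExp u v y) u v y -
      twistedLength i 3 (leftExp i u v y) (farExp u v y) u v y| ≤
      2 * (2 * wordLength X (evalWord (inputWords u v y i)) + posLength y) := by
  have h2 := abs_wordLength_sub_right hL (evalWord y)
    (evalWord y ^ (-leftExp i u v y) * evalWord (inputWords u v y i)) (farExp u v y)
  have h3 := wordLength_left_le hL i u v y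
  simp only [twistedLength]
  have e : evalWord (inputWords u v y 3) = 1 := rfl
  simp only [e, inv_one, mul_one]
  linarith

theorem rightExp_bound (i : Fin 4) (u v y : List X) :
    |rightExp i u v y| * posLength y ≤
      2 * wordLength X (evalWord (inputWords u v y i)) + 2 * posLength y := by
  have h1 := abs_ediv_mul_le (twistedLength i 3 (leftExp i u v y) (-farExp u v y) u v y -
    twistedLength i 3 (leftExp i u v y) (farExp u v y) u v y) (posLength_pos y)
  have h2 := rightExp_diff_bound hL i u v y
  unfold rightExp
  linarith

end Exponents

/-! ### Linear time bounds for these exponents -/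

section LinearTimeExponents

variable {G : Type*} {X : Finset G} {e : X ≃ Fin X.card}

/-- The powers of `y` with exponent `f` have linear length. -/
def LinearPower (f : List X → List X → List X → ℤ) : Prop :=
  ∃ C : ℕ, ∀ u v y, |f u v y| * posLength y ≤ C * (inputLength u v y + 1)

variable {f g : List X → List X → List X → ℤ}

theorem LinearPower.const (c : ℤ) : LinearPower (X := X) fun _ _ _ => c :=
  ⟨c.natAbs, fun u v y => by
    rw [Int.natCast_natAbs]
    exact mul_le_mul_of_nonneg_left (posLength_le u v y) (abs_nonneg c)⟩

theorem LinearPower.add (hf : LinearPower f) (hg : LinearPower g) :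
    LinearPower fun u v y => f u v y + g u v y := by
  obtain ⟨C, hC⟩ := hf
  obtain ⟨C', hC'⟩ := hg
  refine ⟨C + C', fun u v y => ?_⟩
  beta_reduce
  have := mul_le_mul_of_nonneg_right (abs_add_le (f u v y) (g u v y)) (posLength_pos y).le
  push_cast
  linarith [hC u v y, hC' u v y]

theorem LinearPower.neg (hf : LinearPower f) : LinearPower fun u v y => -f u v y := by
  obtain ⟨C, hC⟩ := hf
  exact ⟨C, fun u v y => by rw [abs_neg]; exact hC u v y⟩

theorem LinearPower.sub (hf : LinearPower f) (hg : LinearPower g) :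
    LinearPower fun u v y => f u v y - g u v y := by
  simpa [sub_eq_add_neg] using hf.add hg.neg

theorem LinearPower.half (hf : LinearPower f) : LinearPower fun u v y => f u v y / 2 := by
  obtain ⟨C, hC⟩ := hf
  refine ⟨C, fun u v y => le_trans ?_ (hC u v y)⟩
  refine mul_le_mul_of_nonneg_right ?_ (posLength_pos y).le
  beta_reduce
  have := le_abs_self (f u v y)
  have := neg_le_abs (f u v y)
  rw [abs_le]; constructor <;> omega

theorem LinearTime.posLength : LinearTime e fun _ _ y => posLength y :=
  (LinearTime.length (e := e) 2).ite (LinearTime.length 2) (LinearTime.const 1) fun _ _ _ => rfl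

theorem LinearTime.double (hf : LinearTime e f) : LinearTime e fun u v y => 2 * f u v y := by
  simpa [two_mul] using hf.add hf

theorem LinearTime.farExp : LinearTime e farExp := by
  have h1 : LinearTime e fun u v y => ((u.length : ℤ) + v.length) / HypConj.posLength y := by
    refine ((LinearTime.length (e := e) 0).add (LinearTime.length 1)).div LinearTime.posLength
      (fun _ _ y => posLength_pos y) (C := 1) fun u v y => ?_
    have := posLength_pos y
    have h2 : |((u.length : ℤ) + v.length)| ≤ 1 * (inputLength u v y + 1) := by
      rw [abs_of_nonneg (by positivity), inputLength]; push_cast; omega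
    exact h2.trans (le_mul_of_one_le_right (by positivity) this)
  have h2 := ((h1.add (LinearTime.const 1)).double.double).add (LinearTime.const 2)
  have e : (HypConj.farExp (X := X)) = fun u v y => 2 * (2 * (((u.length : ℤ) + v.length) /
      HypConj.posLength y + 1)) + 2 := by
    funext u v y; unfold HypConj.farExp; ring
  rw [e]; exact h2

theorem LinearPower.farExp : LinearPower (X := X) farExp := by
  refine ⟨10, fun u v y => ?_⟩
  have h1 := (farExp_mul u v y).2
  have h2 := posLength_le u v y
  rw [abs_of_pos (farExp_pos u v y)]
  unfold inputLength at *
  push_cast at *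
  linarith

variable [Group G] (hinv : ∀ x ∈ X, x⁻¹ ∈ X) (R : Reducer X)

include hinv R

theorem LinearTime.twistedLength (i i' : Fin 4) (hf : LinearTime e f) (hg : LinearTime e g)
    (hf' : LinearPower f) (hg' : LinearPower g) :
    LinearTime e fun u v y => twistedLength i i' (f u v y) (g u v y) u v y := by
  obtain ⟨C, hC⟩ := hf'
  obtain ⟨C', hC'⟩ := hg'
  have h : ∀ (c : ℤ) (k : ℕ) (u v y : List X), |c| * HypConj.posLength y ≤ k * (inputLength u v y + 1) →
      |c| * (y.length + 1) ≤ 2 * k * (inputLength u v y + 1) := by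
    intro c k u v y h
    have h1 := posLength_pos y
    have h2 := length_le_posLength y
    have h3 : |c| * (y.length + 1) ≤ |c| * (2 * HypConj.posLength y) :=
      mul_le_mul_of_nonneg_left (by omega) (abs_nonneg c)
    linarith
  refine hf.wordLength hinv R i i' hg (C := 2 * (C + C')) (fun u v y => ?_) fun u v y => ?_
  · refine (h _ C u v y (hC u v y)).trans ?_
    push_cast; gcongr; omega
  · refine (h _ C' u v y (hC' u v y)).trans ?_
    push_cast; gcongr; omega

variable (hL : GeodesicLength (HypConj.wordLength X))

include hL

omit hinv R in
theorem LinearPower.leftExp (i : Fin 4) : LinearPower (X := X) (leftExp i) := by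
  refine ⟨2, fun u v y => ?_⟩
  have h1 := leftExp_bound hL i u v y
  have h2 := wordLength_inputWords_le i u v y
  have h3 := posLength_le u v y
  push_cast
  linarith

omit hinv R in
theorem LinearPower.rightExp (i : Fin 4) : LinearPower (X := X) (rightExp i) := by
  refine ⟨4, fun u v y => ?_⟩
  have h1 := rightExp_bound hL i u v y
  have h2 := wordLength_inputWords_le i u v y
  have h3 := posLength_le u v y
  push_cast
  linarith

theorem LinearTime.leftExp (i : Fin 4) : LinearTime e (leftExp i) := by
  refine ((LinearTime.twistedLength hinv R i 3 LinearTime.farExp.neg (LinearTime.const 0)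
    LinearPower.farExp.neg (LinearPower.const 0)).sub (LinearTime.twistedLength hinv R i 3
    LinearTime.farExp (LinearTime.const 0) LinearPower.farExp (LinearPower.const 0))).div
    LinearTime.posLength.double (fun _ _ y => by linarith [posLength_pos y]) (C := 1)
    fun u v y => ?_
  have h1 := abs_wordLength_sub_left hL (evalWord y) (evalWord (inputWords u v y i))
    (HypConj.farExp u v y)
  have h2 := wordLength_inputWords_le i u v y
  have e3 : evalWord (inputWords u v y 3) = 1 := rfl
  simp only [HypConj.twistedLength, e3, inv_one, mul_one, zpow_zero, neg_neg]
  have h3 := posLength_pos y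
  have h4 : (inputLength u v y + 1 : ℤ) * 1 ≤ (inputLength u v y + 1) * HypConj.posLength y :=
    mul_le_mul_of_nonneg_left h3 (by positivity)
  push_cast
  linarith

theorem LinearTime.rightExp (i : Fin 4) : LinearTime e (rightExp i) := by
  have ha := LinearTime.leftExp (e := e) hinv R hL i
  have ha' := LinearPower.leftExp hL i
  refine ((LinearTime.twistedLength hinv R i 3 ha LinearTime.farExp.neg ha'
    LinearPower.farExp.neg).sub (LinearTime.twistedLength hinv R i 3 ha
    LinearTime.farExp ha' LinearPower.farExp)).div
    LinearTime.posLength.double (fun _ _ y => by linarith [posLength_pos y]) (C := 3)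
    fun u v y => ?_
  have h1 := rightExp_diff_bound hL i u v y
  have h2 := wordLength_inputWords_le i u v y
  have h3 := posLength_pos y
  have h4 : (inputLength u v y + 1 : ℤ) * 1 ≤ (inputLength u v y + 1) * HypConj.posLength y :=
    mul_le_mul_of_nonneg_left h3 (by positivity)
  have h5 := posLength_le u v y
  push_cast
  linarith

end LinearTimeExponents

/-! ### Searching a fixed list of candidates -/

section Search

variable {G : Type*} {X : Finset G} {e : X ≃ Fin X.card}

/-- Search for the first entry of a list of candidates at which a test function vanishes. -/
theorem LinearTime.search {p : List X → List X → List X → ℤ → ℤ}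
    (hp : ∀ u v y j, 0 ≤ p u v y j) (l : List (List X → List X → List X → ℤ))
    (hl : ∀ c ∈ l, LinearTime e c ∧ LinearTime e fun u v y => p u v y (c u v y)) :
    (LinearTime e fun u v y =>
      ((l.map fun c => c u v y).find? fun j => p u v y j = 0).getD 0) ∧
    LinearTime e fun u v y =>
      if ((l.map fun c => c u v y).find? fun j => p u v y j = 0).isSome then 0 else 1 := by
  induction l with
  | nil => exact ⟨LinearTime.const 0, LinearTime.const 1⟩
  | cons c l ih =>
    obtain ⟨h1, h2⟩ := ih fun c hc => hl c (List.mem_cons_of_mem _ hc)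
    obtain ⟨h3, h4⟩ := hl c List.mem_cons_self
    constructor
    · refine h4.ite h1 h3 fun u v y => ?_
      have := hp u v y (c u v y)
      by_cases h : p u v y (c u v y) = 0
      · simp [h]
      · have h' : 0 < p u v y (c u v y) := by omega
        simp [h, h']
    · refine h4.ite h2 (LinearTime.const 0) fun u v y => ?_
      have := hp u v y (c u v y)
      by_cases h : p u v y (c u v y) = 0
      · simp [h]
      · have h' : 0 < p u v y (c u v y) := by omega
        simp [h, h']

end Search
-- The structure of the solution set
section Candidates

variable {G : Type*} [Group G]

namespace ThinLength

variable {L : G → ℕ} {D : ℕ} (hL : ThinLength L D) {Y : G} {l : ℕ}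
  (hY : ∀ n : ℤ, (L (Y ^ n) : ℤ) = |n| * l)

include hL hY

/-- The exponents that conjugate `u` to `v` are near to two numbers that depend on nearest points
of the axis only, or there is a short period. -/
theorem exponent_near (hl : 1 ≤ l) {u v : G} {a a' b b' j : ℤ} {V : ℕ}
    (ha : ∀ i : ℤ, gdist L (Y ^ a) u ≤ gdist L (Y ^ i) u + (D + l))
    (hb : ∀ i : ℤ, L (Y ^ (-a) * u * Y ^ b) ≤ L (Y ^ (-a) * u * Y ^ i) + (D + l))
    (ha' : ∀ i : ℤ, gdist L (Y ^ a') v ≤ gdist L (Y ^ i) v + (D + l))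
    (hb' : ∀ i : ℤ, L (Y ^ (-a') * v * Y ^ b') ≤ L (Y ^ (-a') * v * Y ^ i) + (D + l))
    (h : (Y ^ j)⁻¹ * u * Y ^ j = v) (hfin : {g | L g ≤ 2 * D}.Finite)
    (hV : {g | L g ≤ 2 * D}.ncard ≤ V) :
    |j - (a - a')| ≤ (2 * (9 * D + 7) + V + 1 : ℕ) ∨
    |j - (a - a' + (b - b')) / 2| ≤ (2 * (9 * D + 7) + V + 1 : ℕ) ∨
    ∃ t : ℕ, 1 ≤ t ∧ t ≤ V ∧ u * Y ^ (t : ℤ) = Y ^ (t : ℤ) * u := by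
  have e : ∀ i i' : ℤ, Y ^ (-i) * (Y ^ (-a) * u * Y ^ b) * Y ^ i' =
      Y ^ (-(i + a)) * u * Y ^ (b + i') := fun i i' => by
    rw [neg_add, zpow_add, zpow_add]; group
  have e' : ∀ i i' : ℤ, Y ^ (-i) * (Y ^ (-a) * u * Y ^ b) * Y ^ i' =
      Y ^ (-(i + a - j)) * v * Y ^ (b + i' - j) := fun i i' => by
    rw [← h]; group
  -- Between the shortened elements the exponents are `j + a' - a` on the left and `j + b' - b` on
  -- the right. A bound for the first locates `j`, and a bound for their sum locates `2 * j`.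
  rcases hL.exponent_cases hY hl (u := Y ^ (-a) * u * Y ^ b) (v := Y ^ (-a') * v * Y ^ b')
    (i := j + a' - a) (i' := j + b' - b) (V := V)
    (fun i i' => by rw [e]; exact hL.double_coset_min hY hl ha hb _ _)
    (fun i i' => by rw [e']; exact hL.double_coset_min hY hl ha' hb' _ _)
    (by rw [e']; congr 2 <;> ring_nf) hfin hV with h1 | h1 | ⟨t, h1, h2, h3⟩
  · left
    push_cast
    convert h1 using 2; ring
  · right; left
    rw [abs_le] at h1 ⊢
    push_cast
    constructor <;> omega
  · right; right
    refine ⟨t, h1, h2, ?_⟩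
    have h4 : Y ^ (-a) * (u * Y ^ (t : ℤ)) * Y ^ b = Y ^ (-a) * (Y ^ (t : ℤ) * u) * Y ^ b := by
      calc _ = Y ^ (-a) * u * Y ^ b * Y ^ (t : ℤ) := by group
        _ = _ := h3
        _ = _ := by group
    exact mul_left_cancel (mul_right_cancel h4)

end ThinLength

/-- The exponents of the powers of `Y` that commute with `u`. -/
def commExponents (u Y : G) : AddSubgroup ℤ where
  carrier := {d | Commute u (Y ^ d)}
  zero_mem' := by simp
  add_mem' := fun {a b} ha hb => by
    simp only [Set.mem_ofPred_eq, zpow_add] at *; exact ha.mul_right hb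
  neg_mem' := fun {a} ha => by
    simp only [Set.mem_ofPred_eq, zpow_neg] at *; exact ha.inv_right

variable {X : Finset G}

/-- Two exponents give the same conjugate of `u` exactly if their difference gives a power that
commutes with `u`. -/
theorem ConjByPow.iff_sub_mem {u v y : List X} {j : ℤ} (h : ConjByPow u v y j) (j' : ℤ) :
    ConjByPow u v y j' ↔ j' - j ∈ commExponents (evalWord u) (evalWord y) := by
  unfold ConjByPow at *
  change _ ↔ evalWord u * evalWord y ^ (j' - j) = evalWord y ^ (j' - j) * evalWord u
  rw [← h, zpow_sub]
  constructor
  · intro h1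
    have h2 := congrArg (fun g => evalWord y ^ j' * g * (evalWord y ^ j)⁻¹) h1
    simpa [mul_assoc] using h2
  · intro h1
    have h2 := congrArg (fun g => (evalWord y ^ j')⁻¹ * g * (evalWord y ^ j)) h1
    simpa [mul_assoc] using h2

theorem evalWord_wordPow (w : List X) (n : ℕ) : evalWord (wordPow w n) = evalWord w ^ n := by
  induction n with
  | zero => simp [wordPow, evalWord_nil]
  | succ n ih =>
    rw [pow_succ', ← ih, ← evalWord_append]; rfl

omit [Group G] in
theorem length_wordPow (w : List X) (n : ℕ) : (wordPow w n).length = n * w.length := by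
  simp [wordPow]

theorem IsStraight.wordLength_zpow {y : List X} (hy : IsStraight y)
    (hL : GeodesicLength (wordLength X)) (n : ℤ) :
    (wordLength X (evalWord y ^ n) : ℤ) = |n| * y.length := by
  have h : ∀ m : ℕ, wordLength X (evalWord y ^ m) = m * y.length := fun m => by
    rcases Nat.eq_zero_or_pos m with rfl | hm
    · simp [wordLength_one]
    · rw [← evalWord_wordPow, hy m hm, length_wordPow]
  rcases le_total 0 n with hn | hn
  · lift n to ℕ using hn
    simp [h]
  · obtain ⟨m, hm⟩ := Int.eq_ofNat_of_zero_le (neg_nonneg.2 hn)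
    obtain rfl : n = -(m : ℤ) := by omega
    rw [zpow_neg, hL.inv]
    simp [h]

theorem finite_wordLength_le (hinv : ∀ x ∈ X, x⁻¹ ∈ X)
    (hgen : Subgroup.closure (X : Set G) = ⊤) (n : ℕ) : {g : G | wordLength X g ≤ n}.Finite := by
  refine ((List.finite_length_le X n).image evalWord).subset fun g hg => ?_
  obtain ⟨w, h1, h2⟩ := exists_geodesic_word hinv hgen g
  exact ⟨w, by simpa [h1] using hg, h2⟩

/-- The pigeonhole argument uses the radius `2 * ⌊δ⌋₊`, and this ball lies in the ball of radius `2
* δ` that defines `V`. -/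
theorem ncard_le_ballCard (hinv : ∀ x ∈ X, x⁻¹ ∈ X)
    (hgen : Subgroup.closure (X : Set G) = ⊤) {δ : ℝ} (hδ : 0 ≤ δ) :
    {g : G | wordLength X g ≤ 2 * ⌊δ⌋₊}.ncard ≤ ballCard X δ := by
  refine Set.ncard_le_ncard (fun g hg => ?_) ?_
  · have h1 : (wordLength X g : ℝ) ≤ (2 * ⌊δ⌋₊ : ℕ) := by exact_mod_cast hg
    have h2 := Nat.floor_le hδ
    push_cast at h1
    exact h1.trans (by linarith)
  · refine (finite_wordLength_le hinv hgen ⌊2 * δ⌋₊).subset fun g hg => ?_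
    exact Nat.le_floor hg

variable {D : ℕ} (hL : ThinLength (wordLength X) D) {u v y : List X} (hy : IsStraight y)

include hL hy

theorem gdist_leftExp_le (hl : 1 ≤ y.length) {k : Fin 4} (hk : k = 0 ∨ k = 1) (i : ℤ) :
    gdist (wordLength X) (evalWord y ^ leftExp k u v y) (evalWord (inputWords u v y k)) ≤
      gdist (wordLength X) (evalWord y ^ i) (evalWord (inputWords u v y k)) + (D + y.length) := by
  have hq : posLength y = y.length := by unfold posLength; rw [if_pos (by omega)]
  refine hL.near_of_diff (hy.wordLength_zpow hL.toGeodesicLength) hl (N := farExp u v y) ?_ ?_ i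
  · have h1 := (farExp_mul u v y).1
    have h2 := wordLength_le (inputWords u v y k)
    have h3 : (inputWords u v y k).length ≤ u.length + v.length := by
      rcases hk with rfl | rfl <;> simp [inputWords]
    rw [← hq]
    have := posLength_pos y
    omega
  · have e3 : evalWord (inputWords u v y 3) = 1 := rfl
    simp [leftExp, twistedLength, e3, hq]

/-- `near_of_diff` applied to the inverse of `g = Y ^ (-a) * w`, where `Y` is the element of `y`,
`w` that of the input word and `a` its left exponent: the distance from `Y ^ n` to `g⁻¹` is the
length of `g * Y ^ n`. -/
theorem wordLength_rightExp_le (hl : 1 ≤ y.length) {k : Fin 4} (hk : k = 0 ∨ k = 1) (i : ℤ) :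
    wordLength X (evalWord y ^ (-leftExp k u v y) * evalWord (inputWords u v y k) *
      evalWord y ^ rightExp k u v y) ≤ wordLength X (evalWord y ^ (-leftExp k u v y) *
      evalWord (inputWords u v y k) * evalWord y ^ i) + (D + y.length) := by
  have hq : posLength y = y.length := by unfold posLength; rw [if_pos (by omega)]
  set g := evalWord y ^ (-leftExp k u v y) * evalWord (inputWords u v y k) with hg
  have e : ∀ n : ℤ, wordLength X (evalWord y ^ n * g⁻¹) = wordLength X (g * evalWord y ^ (-n)) :=
    fun n => by rw [← hL.inv]; simp
  have e' : ∀ n : ℤ, gdist (wordLength X) (evalWord y ^ n) g⁻¹ =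
      wordLength X (g * evalWord y ^ n) := fun n => by
    rw [gdist, ← zpow_neg, e, neg_neg]
  rw [← e', ← e']
  refine hL.near_of_diff (hy.wordLength_zpow hL.toGeodesicLength) hl (N := farExp u v y) ?_ ?_ i
  · have h1 := (farExp_mul u v y).1
    have h2 := wordLength_le (inputWords u v y k)
    have h3 : (inputWords u v y k).length ≤ u.length + v.length := by
      rcases hk with rfl | rfl <;> simp [inputWords]
    have h4 := wordLength_left_le hL.toGeodesicLength k u v y
    rw [← hg] at h4
    rw [← hq, hL.inv]
    omega
  · have e3 : evalWord (inputWords u v y 3) = 1 := rfl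
    rw [e, e]
    simp [rightExp, twistedLength, e3, hq, hg]

theorem ConjByPow.exponent_near {V : ℕ} {j : ℤ} (h : ConjByPow u v y j)
    (hfin : {g | wordLength X g ≤ 2 * D}.Finite) (hV : {g | wordLength X g ≤ 2 * D}.ncard ≤ V) :
    |j - (leftExp 0 u v y - leftExp 1 u v y)| ≤ (2 * (9 * D + 7) + V + 1 : ℕ) ∨
    |j - (leftExp 0 u v y - leftExp 1 u v y + (rightExp 0 u v y - rightExp 1 u v y)) / 2| ≤
      (2 * (9 * D + 7) + V + 1 : ℕ) ∨
    ∃ t : ℕ, 1 ≤ t ∧ t ≤ V ∧ (t : ℤ) ∈ commExponents (evalWord u) (evalWord y) := by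
  rcases Nat.eq_zero_or_pos y.length with h0 | hl
  · obtain rfl := List.length_eq_zero_iff.1 h0
    -- For empty `y` every exponent commutes, and `V ≥ 1` because the ball contains `1`.
    refine .inr (.inr ⟨1, le_rfl, le_trans ?_ hV, ?_⟩)
    · exact (Set.ncard_pos hfin).2 ⟨1, by simp [hL.one]⟩
    · change Commute _ _
      simp [evalWord_nil]
  · exact hL.exponent_near (hy.wordLength_zpow hL.toGeodesicLength) hl
      (gdist_leftExp_le hL hy hl (.inl rfl)) (wordLength_rightExp_le hL hy hl (.inl rfl))
      (gdist_leftExp_le hL hy hl (.inr rfl)) (wordLength_rightExp_le hL hy hl (.inr rfl)) h hfin hV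

theorem exists_short_commExponent {V : ℕ} {d : ℤ}
    (h : d ∈ commExponents (evalWord u) (evalWord y)) (hd : d ≠ 0)
    (hfin : {g | wordLength X g ≤ 2 * D}.Finite) (hV : {g | wordLength X g ≤ 2 * D}.ncard ≤ V) :
    ∃ t : ℕ, 1 ≤ t ∧ t ≤ V ∧ (t : ℤ) ∈ commExponents (evalWord u) (evalWord y) := by
  rcases Nat.eq_zero_or_pos y.length with h0 | hl
  · obtain rfl := List.length_eq_zero_iff.1 h0
    refine ⟨1, le_rfl, le_trans ?_ hV, ?_⟩
    · exact (Set.ncard_pos hfin).2 ⟨1, by simp [hL.one]⟩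
    · change Commute _ _
      simp [evalWord_nil]
  · have h' : |d| ∈ commExponents (evalWord u) (evalWord y) := by
      rcases abs_choice d with h1 | h1 <;> rw [h1]
      · exact h
      · exact neg_mem h
    exact hL.exists_short_period (hy.wordLength_zpow hL.toGeodesicLength) hl (abs_pos.2 hd) h'
      hfin hV

end Candidates

/-! ### From two searches to the three cases -/

section Answer

theorem find_range_append_some {p : ℤ → Bool} {V : ℕ} {l : List ℤ} {r : ℤ}
    (h : ((List.range V).map (fun k : ℕ => (k : ℤ)) ++ l).find? p = some r) :
    p r ∧ ∀ k : ℕ, k < V → p k → 0 ≤ r ∧ r ≤ k := by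
  refine ⟨List.find?_some h, fun k hk hpk => ?_⟩
  rw [List.find?_append, List.find?_map] at h
  cases h1 : (List.range V).find? (p ∘ fun k : ℕ => (k : ℤ)) with
  | none =>
    rw [List.find?_eq_none] at h1
    exact absurd hpk (h1 k (List.mem_range.2 hk))
  | some m =>
    rw [h1] at h
    obtain rfl : (m : ℤ) = r := by simpa using h
    rw [List.find?_range_eq_some] at h1
    refine ⟨by positivity, ?_⟩
    by_contra hlt
    have := h1.2.2 k (by omega)
    simp [hpk] at this

/-- If the set of solutions `p` is empty or a coset of a group `H` of integers, then it is
determined by two searches. -/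
theorem solution_cases {p q : ℤ → Bool} {H : AddSubgroup ℤ} {V : ℕ} {l : List ℤ}
    (hp : ∀ j, p j → ∀ j', p j' ↔ j' - j ∈ H) (hq : ∀ j, q j ↔ j + 1 ∈ H)
    (hH : ∀ d ∈ H, d ≠ 0 → ∃ t : ℕ, 1 ≤ t ∧ t ≤ V ∧ (t : ℤ) ∈ H)
    (hl : ∀ j, p j → j ∈ l ∨ ∃ t : ℕ, 1 ≤ t ∧ t ≤ V ∧ (t : ℤ) ∈ H) {r t : Option ℤ}
    (hr : ((List.range V).map (fun k : ℕ => (k : ℤ)) ++ l).find? p = r)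
    (ht : ((List.range V).map (fun k : ℕ => (k : ℤ)) ++ []).find? q = t) :
    (∃ r₀ t₀, r = some r₀ ∧ t = some t₀ ∧ 0 ≤ r₀ ∧ r₀ < t₀ + 1 ∧ t₀ + 1 ≤ V ∧
      ∀ j, p j ↔ j ≡ r₀ [ZMOD t₀ + 1]) ∨
    (∃ r₀, r = some r₀ ∧ t = none ∧ ∀ j, p j ↔ j = r₀) ∨
    (r = none ∧ ∀ j, ¬ p j) := by
  cases t with
  | none =>
    have h0 : ¬ ∃ t : ℕ, 1 ≤ t ∧ t ≤ V ∧ (t : ℤ) ∈ H := by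
      rintro ⟨t, h1, h2, h3⟩
      rw [List.find?_eq_none] at ht
      refine ht ((t - 1 : ℕ) : ℤ) ?_ ?_
      · simp only [List.append_nil, List.mem_map, List.mem_range]
        exact ⟨t - 1, by omega, rfl⟩
      · rw [hq]; convert h3; omega
    right
    cases r with
    | none =>
      refine .inr ⟨rfl, fun j hj => ?_⟩
      rw [List.find?_eq_none] at hr
      exact hr j (List.mem_append_right _ ((hl j hj).resolve_right h0)) hj
    | some r =>
      refine .inl ⟨r, rfl, rfl, fun j => ?_⟩
      rw [hp r (List.find?_some hr)]
      refine ⟨fun h => ?_, fun h => by simp [h]⟩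
      by_contra hne
      exact h0 (hH _ h (sub_ne_zero.2 hne))
  | some t =>
    obtain ⟨ht1, ht2⟩ := find_range_append_some ht
    have htm := List.mem_of_find?_eq_some ht
    simp only [List.append_nil, List.mem_map, List.mem_range] at htm
    obtain ⟨k, hk, rfl⟩ := htm
    rw [hq] at ht1
    -- The search for periods runs upwards, so `k + 1` is the least positive element of `H` and
    -- generates it.
    have hdvd : ∀ d, d ∈ H ↔ ((k : ℤ) + 1) ∣ d := by
      intro d
      refine ⟨fun hd => ?_, fun ⟨c, hc⟩ => ?_⟩
      · have h1 : d % ((k : ℤ) + 1) ∈ H := by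
          rw [Int.emod_def, mul_comm, ← smul_eq_mul]
          exact sub_mem hd (zsmul_mem ht1 _)
        have h2 := Int.emod_nonneg d (b := (k : ℤ) + 1) (by omega)
        have h3 := Int.emod_lt_of_pos d (b := (k : ℤ) + 1) (by omega)
        by_contra hne
        have h4 : d % ((k : ℤ) + 1) ≠ 0 := fun h => hne (Int.dvd_of_emod_eq_zero h)
        obtain ⟨m, hm⟩ := Int.eq_ofNat_of_zero_le h2
        have := (ht2 (m - 1) (by omega) (by rw [hq]; convert h1 using 1; omega)).2
        omega
      · rw [hc, mul_comm, ← smul_eq_mul]; exact zsmul_mem ht1 c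
    cases r with
    | none =>
      refine .inr (.inr ⟨rfl, fun j hj => ?_⟩)
      rw [List.find?_eq_none] at hr
      have h2 := Int.emod_nonneg j (b := (k : ℤ) + 1) (by omega)
      have h3 := Int.emod_lt_of_pos j (b := (k : ℤ) + 1) (by omega)
      obtain ⟨m, hm⟩ := Int.eq_ofNat_of_zero_le h2
      refine hr m (List.mem_append_left _ (List.mem_map.2 ⟨m, List.mem_range.2 (by omega), rfl⟩)) ?_
      rw [hp j hj, hdvd, ← hm]
      exact (Int.mod_modEq j _).symm.dvd
    | some r =>
      obtain ⟨hr1, hr2⟩ := find_range_append_some hr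
      have hpr : ∀ j, p j ↔ j ≡ r [ZMOD (k : ℤ) + 1] := fun j => by
        rw [hp r hr1, hdvd, Int.modEq_comm, Int.modEq_iff_dvd]
      have h2 := Int.emod_nonneg r (b := (k : ℤ) + 1) (by omega)
      have h3 := Int.emod_lt_of_pos r (b := (k : ℤ) + 1) (by omega)
      obtain ⟨m, hm⟩ := Int.eq_ofNat_of_zero_le h2
      -- The residue of `r` is itself a solution among the first candidates, so the search stops no
      -- later than there, and `r` is below the period.
      have h4 := hr2 m (by omega) (by rw [hpr, ← hm]; exact Int.mod_modEq r _)
      exact .inl ⟨r, k, rfl, rfl, h4.1, by omega, by omega, hpr⟩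

end Answer
-- Assembling one program from its parts
section Program

variable {G : Type*} {X : Finset G} {e : X ≃ Fin X.card}

/-- Set up the registers that describe the input words. -/
def initProg : Prog :=
  Prog.block [.const 4 1, .add 9 0 3, .add 10 0 3, .add 11 1 3, .add 12 0 1, .add 13 2 3,
    .add 16 12 2]

/-- Register `3` is `0` at the start, so adding it copies a register. Registers `8`, `14` and `15`
already hold the right zeros for the offset of `u` and for the empty word. -/
theorem initProg_spec (u v y : List X) :
    Steps initProg (inputState e u v y) 8 (Env e (inputWords u v y) (inputLength u v y)) := by
  have hw : ∀ w w₁ w₂ w₃ : List X, u ++ v ++ y = w₁ ++ w₂ ++ w₃ → w = w₂ →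
      WordAt e (inputState e u v y).mem w₁.length w := by
    rintro _ w₁ w₂ w₃ h rfl z₁ x z₂ rfl
    have h0 : (0 : ℤ) ≤ w₁.length + z₁.length := by positivity
    have h1 : ((w₁.length : ℤ) + z₁.length).toNat = w₁.length + z₁.length := by omega
    simp only [inputState, if_pos h0, h1, h]
    simp [List.getD_eq_getElem?_getD]
  refine Steps.exec (P := initProg) (by simp [initProg, Prog.block, Prog.LoopFree]) ?_
  have hm : (initProg.exec (inputState e u v y)).mem = (inputState e u v y).mem := rfl
  refine ⟨by simp [initProg, Prog.block, Prog.exec], ?_, by positivity, fun i => ?_⟩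
  · simp [initProg, Prog.block, Prog.exec, inputState, inputLength]
  · rw [hm]
    fin_cases i
    · exact ⟨([] : List X).length, by simp, by simp [inputWords, inputLength]; omega,
        by simp [initProg, Prog.block, Prog.exec, inputState],
        by simp [initProg, Prog.block, Prog.exec, inputState, inputWords],
        hw _ [] u (v ++ y) (by simp) rfl⟩
    · exact ⟨u.length, by simp, by simp [inputWords, inputLength],
        by simp [initProg, Prog.block, Prog.exec, inputState],
        by simp [initProg, Prog.block, Prog.exec, inputState, inputWords],
        hw _ u v y rfl rfl⟩
    · exact ⟨(u ++ v).length, by positivity, by simp [inputWords, inputLength],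
        by simp [initProg, Prog.block, Prog.exec, inputState],
        by simp [initProg, Prog.block, Prog.exec, inputState, inputWords],
        hw _ (u ++ v) y [] (by simp) rfl⟩
    · exact ⟨([] : List X).length, by simp, by simp [inputWords],
        by simp [initProg, Prog.block, Prog.exec, inputState],
        by simp [initProg, Prog.block, Prog.exec, inputState, inputWords],
        hw _ [] [] (u ++ v ++ y) (by simp) rfl⟩

/-- Four functions that can be computed in linear time can be computed by one program. -/
theorem LinearTime.exists_prog {f g h k : List X → List X → List X → ℤ} (hf : LinearTime e f)
    (hg : LinearTime e g) (hh : LinearTime e h) (hk : LinearTime e k) :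
    ∃ (P : Prog) (C : ℕ), ∀ u v y : List X, Steps P (inputState e u v y)
      (C * (inputLength u v y + 1)) fun s => s.reg 0 = f u v y ∧ s.reg 1 = g u v y ∧
        s.reg 2 = h u v y ∧ s.reg 3 = k u v y := by
  obtain ⟨C1, h1⟩ := hf
  obtain ⟨C2, h2⟩ := hg
  obtain ⟨C3, h3⟩ := hh
  obtain ⟨C4, h4⟩ := hk
  obtain ⟨P1, h1⟩ := h1 32 (by omega)
  obtain ⟨P2, h2⟩ := h2 33 (by omega)
  obtain ⟨P3, h3⟩ := h3 34 (by omega)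
  obtain ⟨P4, h4⟩ := h4 35 (by omega)
  -- Each result has its own register from `32` on, protected from later computations. Register `4`
  -- is finally set to `0`, so that adding it copies the results to the output registers.
  refine ⟨.seq initProg (.seq P1 (.seq P2 (.seq P3 (.seq P4 (Prog.block [.const 4 0, .add 0 32 4,
    .add 1 33 4, .add 2 34 4, .add 3 35 4]))))), C1 + C2 + C3 + C4 + 14, fun u v y => ?_⟩
  refine Steps.mono ((initProg_spec u v y).seq fun s0 a0 => (h1 u v y s0 a0).seq
    fun s1 ⟨a1, b1, c1⟩ => (h2 u v y s1 a1).seq fun s2 ⟨a2, b2, c2⟩ => (h3 u v y s2 a2).seq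
    fun s3 ⟨a3, b3, c3⟩ => (h4 u v y s3 a3).seq (T' := 6) fun s4 ⟨a4, b4, c4⟩ =>
      Steps.exec (by simp [Prog.block, Prog.LoopFree]) ?_) ?_ fun _ h => h
  · simp [Prog.block, Prog.exec]
    refine ⟨?_, ?_, ?_, b4⟩
    · rw [c4 32 (by omega) (by omega), c3 32 (by omega) (by omega), c2 32 (by omega) (by omega), b1]
    · rw [c4 33 (by omega) (by omega), c3 33 (by omega) (by omega), b2]
    · rw [c4 34 (by omega) (by omega), b3]
  · simp only [add_mul]
    omega

end Program

/-! ### The candidates and their tests -/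

section Algorithm

variable {G : Type*} [Group G] {X : Finset G}

/-- The candidates for an exponent that conjugates `u` to `v`, when no period is at most `V`;
their number depends on `K` only. -/
noncomputable def farCandidates (K : ℕ) : List (List X → List X → List X → ℤ) :=
  ((List.range (2 * K + 1)).map fun (k : ℕ) u v y =>
    leftExp 0 u v y - leftExp 1 u v y + ((k : ℤ) - K)) ++
  (List.range (2 * K + 1)).map fun (k : ℕ) u v y =>
    (leftExp 0 u v y - leftExp 1 u v y + (rightExp 0 u v y - rightExp 1 u v y)) / 2 +
      ((k : ℤ) - K)

theorem mem_farCandidates {K : ℕ} {u v y : List X} {j : ℤ}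
    (h : |j - (leftExp 0 u v y - leftExp 1 u v y)| ≤ K ∨
      |j - (leftExp 0 u v y - leftExp 1 u v y + (rightExp 0 u v y - rightExp 1 u v y)) / 2| ≤ K) :
    j ∈ (farCandidates K).map fun c => c u v y := by
  simp only [farCandidates, List.map_append, List.map_map, List.mem_append, List.mem_map,
    List.mem_range, Function.comp_apply, abs_le] at h ⊢
  rcases h with h | h
  · left
    generalize leftExp 0 u v y - leftExp 1 u v y = x at *
    exact ⟨(j - x + K).toNat, by omega, by omega⟩
  · right
    generalize (leftExp 0 u v y - leftExp 1 u v y +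
      (rightExp 0 u v y - rightExp 1 u v y)) / 2 = x at *
    exact ⟨(j - x + K).toNat, by omega, by omega⟩

variable {e : X ≃ Fin X.card} (hinv : ∀ x ∈ X, x⁻¹ ∈ X) (R : Reducer X)
  (hL : GeodesicLength (wordLength X))

include hinv R hL

theorem linear_farCandidates {K : ℕ} {c : List X → List X → List X → ℤ}
    (hc : c ∈ farCandidates K) : LinearTime e c ∧ LinearPower c := by
  have hl := LinearTime.leftExp (e := e) hinv R hL
  have hr := LinearTime.rightExp (e := e) hinv R hL
  have hl' := LinearPower.leftExp hL
  have hr' := LinearPower.rightExp hL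
  rcases List.mem_append.1 hc with hc | hc <;> obtain ⟨k, -, rfl⟩ := List.mem_map.1 hc
  · exact ⟨((hl 0).sub (hl 1)).add (.const _), ((hl' 0).sub (hl' 1)).add (.const _)⟩
  · have hs := ((hl 0).sub (hl 1)).add ((hr 0).sub (hr 1))
    have hs' := ((hl' 0).sub (hl' 1)).add ((hr' 0).sub (hr' 1))
    refine ⟨LinearTime.add ?_ (.const _), hs'.half.add (.const _)⟩
    obtain ⟨C, hC⟩ := hs'
    refine hs.div (.const 2) (fun _ _ _ => two_pos) (C := C) fun u v y => ?_
    have h1 := hC u v y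
    have h2 := le_mul_of_one_le_right (abs_nonneg (leftExp 0 u v y - leftExp 1 u v y +
      (rightExp 0 u v y - rightExp 1 u v y))) (posLength_pos y)
    have h3 : (0 : ℤ) ≤ C * (inputLength u v y + 1) := by positivity
    linarith

omit hinv R in
theorem twistedLength_eq_zero_iff {u v y : List X} {j : ℤ} :
    twistedLength 0 1 j j u v y = 0 ↔ ConjByPow u v y j := by
  have h : ∀ g : G, (wordLength X g : ℤ) = 0 ↔ g = 1 := fun g => by
    rw [Nat.cast_eq_zero]
    exact ⟨hL.eq_one g, fun h => by rw [h, hL.one]⟩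
  rw [twistedLength, h, mul_inv_eq_one, zpow_neg]
  rfl

omit hinv R in
theorem twistedLength_self_eq_zero_iff {u v y : List X} {j : ℤ} :
    twistedLength 0 0 j j u v y = 0 ↔ j ∈ commExponents (evalWord u) (evalWord y) := by
  have h : ∀ g : G, (wordLength X g : ℤ) = 0 ↔ g = 1 := fun g => by
    rw [Nat.cast_eq_zero]
    exact ⟨hL.eq_one g, fun h => by rw [h, hL.one]⟩
  rw [twistedLength, h, mul_inv_eq_one, zpow_neg, mul_assoc, inv_mul_eq_iff_eq_mul]
  rfl

end Algorithm
end HypConj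

/-! ### The main theorem -/

open HypConj in
theorem mainTheorem4 {G : Type*} [Group G] (X : Finset G)
    (hinv : ∀ x ∈ X, x⁻¹ ∈ X) (hgen : Subgroup.closure (X : Set G) = ⊤)
    (δ : ℝ) (hδ : 1 ≤ δ) (hhyp : HypConj.IsDeltaHyperbolic (HypConj.CayleyPoint X) δ)
    (e : X ≃ Fin X.card) :
    ∃ (P : HypConj.Prog) (C : ℕ), ∀ u v y : List X, HypConj.IsStraight y →
      ∃ (s : HypConj.State) (T : ℕ),
        HypConj.Run P (HypConj.inputState e u v y) s T ∧
        T ≤ C * (u.length + v.length + y.length + 1) ∧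
        ((∃ r t : ℤ, s.outR = WithTop.some r ∧ s.outT = WithTop.some t ∧
            0 ≤ r ∧ r < t ∧ t ≤ (HypConj.ballCard X δ : ℤ) ∧
            ∀ j : ℤ, HypConj.ConjByPow u v y j ↔ j ≡ r [ZMOD t]) ∨
          (∃ r : ℤ, s.outR = WithTop.some r ∧ s.outT = ⊤ ∧
            ∀ j : ℤ, HypConj.ConjByPow u v y j ↔ j = r) ∨
          (s.outR = ⊤ ∧ s.outT = ⊤ ∧ ∀ j : ℤ, ¬ HypConj.ConjByPow u v y j)) := by
  have hL := thinLength_wordLength (geodesicLength_wordLength hinv hgen) hhyp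
  have hG := hL.toGeodesicLength
  have hfin := finite_wordLength_le hinv hgen
  obtain ⟨R⟩ := exists_reducer hinv hgen hL hfin
  have hV := ncard_le_ballCard hinv hgen (zero_le_one.trans hδ)
  set V := ballCard X δ
  set D := ⌊δ⌋₊
  -- The radius in `ConjByPow.exponent_near`; the number of candidates depends on `D` and `V` only.
  set K := 2 * (9 * D + 7) + V + 1
  set near : List (List X → List X → List X → ℤ) :=
    (List.range V).map fun (k : ℕ) _ _ _ => (k : ℤ) with hnear
  have near_linear : ∀ c ∈ near, LinearTime e c ∧ LinearPower c := by
    intro c hc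
    obtain ⟨k, -, rfl⟩ := List.mem_map.1 hc
    exact ⟨.const _, .const _⟩
  have near_map : ∀ u v y, near.map (fun c => c u v y) = (List.range V).map fun k : ℕ => (k : ℤ) :=
    fun u v y => by simp [hnear, Function.comp_def]
  obtain ⟨rval, rflag⟩ := LinearTime.search (e := e)
    (p := fun u v y j => twistedLength 0 1 j j u v y) (fun _ _ _ _ => Int.natCast_nonneg _)
    (near ++ farCandidates K) fun c hc => by
      have hc' : LinearTime e c ∧ LinearPower c := by
        rcases List.mem_append.1 hc with hc | hc
        · exact near_linear c hc
        · exact linear_farCandidates hinv R hG hc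
      exact ⟨hc'.1, .twistedLength hinv R 0 1 hc'.1 hc'.1 hc'.2 hc'.2⟩
  -- The test is shifted by one, so that the candidates `0, …, V - 1` stand for the periods `1, …,
  -- V`.
  obtain ⟨tval, tflag⟩ := LinearTime.search (e := e)
    (p := fun u v y j => twistedLength 0 0 (j + 1) (j + 1) u v y)
    (fun _ _ _ _ => Int.natCast_nonneg _) (near ++ []) fun c hc => by
      have hc' := near_linear c (by simpa using hc)
      have h1 := hc'.1.add (.const 1)
      have h2 := hc'.2.add (.const 1)
      exact ⟨hc'.1, .twistedLength hinv R 0 0 h1 h1 h2 h2⟩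
  -- Without a solution the flag of `t` is set to `1` whether or not a period exists; otherwise it
  -- is the flag of the search for periods. Adding `1` to the value undoes the shift.
  obtain ⟨P, C, hP⟩ := rflag.exists_prog rval
    (rflag.ite (.const 1) tflag fun _ _ _ => rfl) (tval.add (.const 1))
  refine ⟨P, C, fun u v y hy => ?_⟩
  obtain ⟨s, T, h1, h2, h3, h4, h5, h6⟩ := hP u v y
  refine ⟨s, T, h1, h2, ?_⟩
  simp only [List.map_append, List.map_nil, near_map] at h3 h4 h5 h6
  have key := fun r t => solution_cases (V := V) (r := r) (t := t)
    (p := fun j => twistedLength 0 1 j j u v y = 0)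
    (q := fun j => twistedLength 0 0 (j + 1) (j + 1) u v y = 0)
    (H := commExponents (evalWord u) (evalWord y))
    (l := (farCandidates K).map fun c => c u v y)
    (fun j hj j' => by
      simp only [decide_eq_true_eq, twistedLength_eq_zero_iff hG] at hj ⊢
      exact hj.iff_sub_mem j')
    (fun j => by simp only [decide_eq_true_eq, twistedLength_self_eq_zero_iff hG])
    (fun d hd h0 => exists_short_commExponent hL hy hd h0 (hfin _) hV)
    (fun j hj => by
      simp only [decide_eq_true_eq, twistedLength_eq_zero_iff hG] at hj
      rcases hj.exponent_near hL hy (hfin _) hV with h | h | h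
      · exact .inl (mem_farCandidates (.inl h))
      · exact .inl (mem_farCandidates (.inr h))
      · exact .inr h)
  simp only [decide_eq_true_eq, twistedLength_eq_zero_iff hG] at key
  unfold State.outR State.outT State.readExt
  rw [h3, h4, h5, h6]
  rcases key _ _ rfl rfl with ⟨r, t, hr, ht, hh⟩ | ⟨r, hr, ht, hh⟩ | ⟨hr, hh⟩
  · exact .inl ⟨r, t + 1, by simp [hr], by simp only [hr, ht]; simp, hh⟩
  · exact .inr (.inl ⟨r, by simp [hr], by simp only [hr, ht]; simp, hh⟩)
  · exact .inr (.inr ⟨by simp [hr], by simp [hr], hh⟩)
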